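/- Let $n\ge 2$ be even and let $(M,g)$ be a smooth Riemannian manifold of dimension $n$. Let $g_+=r^{-2}(dr^2+g_r)$ be a Poincaré–Einstein metric on $M\times(0,\varepsilon)$ with $g_0=g$: $g_r$ is a smooth family of metrics with $$g_r=g+r^2g_{(2)}+\dots+r^{n-2}g_{(n-2)}+r^n\big(g_{(n)}+\log r\,\bar g_{(n)}\big)+\cdots\qquad(r\to0),$$ where $\bar g_{(n)}$ is trace-free with respect to $g$, such that $\operatorname{Ric}(g_+)+ng_+=O(r^{n-2})$ and such that the $g$-trace of the tangential part of $r^{2-n}(\operatorname{Ric}(g_+)+ng_+)$ vanishes at $r=0$. Let $v(r)=\mathrm{vol}(g_r)/\mathrm{vol}(g)$ and let $v_{2j}$ and $w_{2j}$, for $2j\le n$, denote the coefficients of $r^{2j}$ in the expansions of $v(r)$ and of $\sqrt{v(r)}$ as $r\to0$, which up to $o(r^n)$ contain only the even powers $1,r^2,\dots,r^n$. For $2K\le n$ let $\mathcal T_{2K}(\lambda)$, $\lambda\in\mathbb C\setminus\{\tfrac n2-1,\dots,\tfrac n2-K\}$, be the operators on $C^\infty(M)$ which describe the asymptotic expansion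 $$u\sim\sum_{j\ge0}r^{\lambda+2j}\,\mathcal T_{2j}(\lambda)f,\qquad \mathcal T_0(\lambda)f=f,$$ of solutions of $-\Delta_{g_+}u=\lambda(n-\lambda)u$; that is, for all $f\in C^\infty(M)$, $2K\le n$ and $\lambda\notin\{\tfrac n2-1,\dots,\tfrac n2-K\}$, the sum $\sum_{j\le K}r^{\lambda+2j}\mathcal T_{2j}(\lambda)f$ solves this equation up to $o(r^{\mathrm{Re}\,\lambda+2K})$. Let $\mathcal T_{2j}^*(\lambda)$ be the formal adjoint of $\mathcal T_{2j}(\lambda)$ with respect to the (bilinear) pairing $\int_M f h\,\mathrm{vol}(g)$. Then for every integer $N\ge 0$ with $2N\le n$ the $N$-th $Q$-curvature polynomial $$Q_{2N}^{res}(\lambda)=-2^{2N}N!\,\Big(\prod_{k=1}^N\big(\lambda+\tfrac n2-2N+k\big)\Big)\sum_{j=0}^N\mathcal T_{2j}^*(\lambda+n-2N)(v_{2N-2j})$$ (defined when $\lambda+n-2N\notin\{\tfrac n2-1,\dots,\tfrac n2-N\}$, and for the remaining $\lambda$ by continuation) is, at each point of $M$, a polynomial in $\lambda$ of degree at most $N$,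 and the coefficient of $\lambda^N$ in it is $$-2^{2N}N!\,w_{2N}.$$ -/

import Mathlib

open Filter Topology Asymptotics MeasureTheory
open scoped Manifold ContDiff Bundle Polynomial

noncomputable section

namespace QCurvature

/-! ## Riemannian geometry in coordinates

`V` is the coordinate space, `b : ι → V` its coordinate frame, and a metric is given by the matrix
`G` of its components, `G p i j = ⟨b i, b j⟩` at the point with coordinate vector `p`. -/

section Coordinates

variable {V : Type*} [NormedAddCommGroup V] [NormedSpace ℝ V]
  {ι : Type*} [Fintype ι] [DecidableEq ι]
  {F : Type*} [NormedAddCommGroup F] [NormedSpace ℝ F]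

/-- The partial derivative `∂_i f` at `p`. -/
def pderiv (b : ι → V) (i : ι) (f : V → F) (p : V) : F := fderiv ℝ f p (b i)

/-- The Christoffel symbol `Γ^k_{ij} = ½ ∑_l G^{kl} (∂_i G_{jl} + ∂_j G_{il} - ∂_l G_{ij})`. -/
def christoffel (b : ι → V) (G : V → Matrix ι ι ℝ) (k i j : ι) (p : V) : ℝ :=
  (1 / 2) * ∑ l, (G p)⁻¹ k l *
    (pderiv b i (fun q => G q j l) p + pderiv b j (fun q => G q i l) p
      - pderiv b l (fun q => G q i j) p)

/-- The Ricci tensor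
`Ric_{ij} = ∑_k (∂_k Γ^k_{ij} - ∂_j Γ^k_{ik}) + ∑_{k,l} (Γ^k_{kl} Γ^l_{ij} - Γ^k_{jl} Γ^l_{ik})`
(positive on round spheres). -/
def ricci (b : ι → V) (G : V → Matrix ι ι ℝ) (i j : ι) (p : V) : ℝ :=
  ∑ k, (pderiv b k (christoffel b G k i j) p - pderiv b j (christoffel b G k i k) p)
    + ∑ k, ∑ l, (christoffel b G k k l p * christoffel b G l i j p
        - christoffel b G k j l p * christoffel b G l i k p)

/-- The Laplace–Beltrami operator
`Δ f = (det G)^{-1/2} ∑_{i,j} ∂_i ((det G)^{1/2} G^{ij} ∂_j f)` (so `-Δ` is non-negative). -/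
def laplacian (b : ι → V) (G : V → Matrix ι ι ℝ) (f : V → F) (p : V) : F :=
  (√(G p).det)⁻¹ • ∑ i, ∑ j,
    pderiv b i (fun q => (√(G q).det * (G q)⁻¹ i j) • pderiv b j f q) p

end Coordinates

/-! ## Tensors on a manifold and their components in charts -/

/-- The model space `ℝⁿ`. -/
abbrev E (n : ℕ) : Type := EuclideanSpace ℝ (Fin n)

/-- The standard frame `∂_1, …, ∂_n` of `ℝⁿ`. -/
def frame (n : ℕ) (i : Fin n) : E n := EuclideanSpace.single i 1

/-- The frame `∂_1, …, ∂_n, ∂_r` of `ℝⁿ × ℝ`; the last coordinate is `r`. -/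
def frameR (n : ℕ) : Fin n ⊕ Unit → E n × ℝ :=
  Sum.elim (fun i => (frame n i, 0)) (fun _ => (0, 1))

variable {n : ℕ} {M : Type*} [TopologicalSpace M] [ChartedSpace (E n) M]

/-- Sections of `T*M ⊗ T*M`, without any regularity. -/
abbrev Tensor2 (n : ℕ) (M : Type*) [TopologicalSpace M] [ChartedSpace (E n) M] : Type _ :=
  ∀ x : M, TangentSpace 𝓘(ℝ, E n) x →L[ℝ] TangentSpace 𝓘(ℝ, E n) x →L[ℝ] ℝ

/-- The components `h(∂_i, ∂_j)` of a 2-tensor in the chart `e`, as a function on `e.target`. -/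
def comp (e : OpenPartialHomeomorph M (E n)) (h : Tensor2 n M) (y : E n) :
    Matrix (Fin n) (Fin n) ℝ :=
  Matrix.of fun i j => h (e.symm y)
    (mfderiv 𝓘(ℝ, E n) 𝓘(ℝ, E n) e.symm y (frame n i))
    (mfderiv 𝓘(ℝ, E n) 𝓘(ℝ, E n) e.symm y (frame n j))

/-- A smooth symmetric 2-tensor. -/
structure IsSmoothSymm (h : Tensor2 n M) : Prop where
  symm : ∀ x v w, h x v w = h x w v
  smooth : ∀ e ∈ atlas (E n) M, ∀ i j, ContDiffOn ℝ ∞ (fun y => comp e h y i j) e.target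

/-- Complex valued smooth functions on `M`. -/
def IsSmooth (n : ℕ) {M : Type*} [TopologicalSpace M] [ChartedSpace (E n) M] (f : M → ℂ) : Prop :=
  ContMDiff 𝓘(ℝ, E n) 𝓘(ℝ, ℂ) ∞ f

/-! ## The metric `g₊ = r⁻² (dr² + g_r)` on `M × (0, ε)`

A one-parameter family `r ↦ g_r` of metrics on `M` is a function `γ : ℝ → Tensor2 n M`; only its
values for `0 < r < ε` matter. -/

/-- The component matrix of `g₊ = r⁻² (dr² + g_r)` in the coordinates `(y, r)`. -/
def gPlus (e : OpenPartialHomeomorph M (E n)) (γ : ℝ → Tensor2 n M) (q : E n × ℝ) :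
    Matrix (Fin n ⊕ Unit) (Fin n ⊕ Unit) ℝ :=
  (q.2 ^ 2)⁻¹ • Matrix.fromBlocks (comp e (γ q.2) q.1) 0 0 1

/-- The components of `Ric(g₊) + n g₊` in the coordinates `(y, r)`. -/
def einsteinTensor (e : OpenPartialHomeomorph M (E n)) (γ : ℝ → Tensor2 n M)
    (a c : Fin n ⊕ Unit) (q : E n × ℝ) : ℝ :=
  ricci (frameR n) (gPlus e γ) a c q + n * gPlus e γ q a c

/-- The Laplace–Beltrami operator of `g₊`, applied to a function `u` on `M × (0, ε)`, at `(x, r)`;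
it is computed in the preferred chart at `x`. -/
def laplacianPlus (γ : ℝ → Tensor2 n M) (u : M → ℝ → ℂ) (x : M) (r : ℝ) : ℂ :=
  laplacian (frameR n) (gPlus (chartAt (E n) x) γ)
    (fun q => u ((chartAt (E n) x).symm q.1) q.2) (chartAt (E n) x x, r)

/-- Iterated derivatives along the vector fields `∂_1, …, ∂_n` and `r ∂_r`. -/
def totalDeriv : List (Fin n ⊕ Unit) → (E n × ℝ → ℝ) → E n × ℝ → ℝ
  | [], R => R
  | Sum.inl i :: l, R => pderiv (frameR n) (Sum.inl i) (totalDeriv l R)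
  | Sum.inr () :: l, R => fun q => q.2 * pderiv (frameR n) (Sum.inr ()) (totalDeriv l R) q

/-- The expansion `g_r = ∑_{2j ≤ n} r^{2j} g_{(2j)} + r^n log r ḡ_{(n)} + o(r^n)`, `r → 0`, with
coefficients `h j = g_{(2j)}` and `hbar = ḡ_{(n)}`. As usual for asymptotic expansions it holds
locally uniformly on `M` and can be differentiated any number of times along `M` and
along `r ∂_r`. -/
def HasMetricExpansion (γ : ℝ → Tensor2 n M) (h : ℕ → Tensor2 n M) (hbar : Tensor2 n M) : Prop :=
  ∀ e ∈ atlas (E n) M, ∀ y ∈ e.target, ∀ i j : Fin n, ∀ l : List (Fin n ⊕ Unit),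
    totalDeriv l (fun q : E n × ℝ => comp e (γ q.2) q.1 i j
        - ∑ k ∈ Finset.range (n / 2 + 1), q.2 ^ (2 * k) * comp e (h k) q.1 i j
        - q.2 ^ n * Real.log q.2 * comp e hbar q.1 i j)
      =o[𝓝 y ×ˢ 𝓝[>] (0 : ℝ)] fun q => q.2 ^ n

variable [IsManifold 𝓘(ℝ, E n) ∞ M]

/-- Smooth Riemannian metrics on `M`. -/
abbrev Metric (n : ℕ) (M : Type*) [TopologicalSpace M] [ChartedSpace (E n) M]
    [IsManifold 𝓘(ℝ, E n) ∞ M] : Type _ :=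
  Bundle.ContMDiffRiemannianMetric 𝓘(ℝ, E n) ∞ (E n) (fun x : M => TangentSpace 𝓘(ℝ, E n) x)

/-- `g₊ = r⁻² (dr² + g_r)` on `M × (0, ε)`, for `n` even, is a Poincaré–Einstein metric with
`g_0 = g`. -/
structure IsPoincareEinstein (g : Metric n M) (ε : ℝ) (γ : ℝ → Tensor2 n M) : Prop where
  eps_pos : 0 < ε
  /-- each `g_r` is a Riemannian metric -/
  symm : ∀ r ∈ Set.Ioo 0 ε, ∀ x v w, γ r x v w = γ r x w v
  pos : ∀ r ∈ Set.Ioo 0 ε, ∀ x v, v ≠ 0 → 0 < γ r x v v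
  /-- `g_r` is jointly smooth on `M × (0, ε)` -/
  smooth : ∀ e ∈ atlas (E n) M, ∀ i j,
    ContDiffOn ℝ ∞ (fun q : E n × ℝ => comp e (γ q.2) q.1 i j) (e.target ×ˢ Set.Ioo 0 ε)
  /-- `g_r = g + r² g_{(2)} + ⋯ + r^{n-2} g_{(n-2)} + r^n (g_{(n)} + log r ḡ_{(n)}) + ⋯`, with
  `ḡ_{(n)}` trace-free with respect to `g` -/
  expansion : ∃ (h : ℕ → Tensor2 n M) (hbar : Tensor2 n M),
    h 0 = g.inner ∧ (∀ j, IsSmoothSymm (h j)) ∧ IsSmoothSymm hbar ∧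
    (∀ e ∈ atlas (E n) M, ∀ y ∈ e.target,
      ((comp e g.inner y)⁻¹ * comp e hbar y).trace = 0) ∧
    HasMetricExpansion γ h hbar
  /-- the Einstein condition `Ric(g₊) + n g₊ = O(r^{n-2})` -/
  einstein : ∀ e ∈ atlas (E n) M, ∀ y ∈ e.target, ∀ a c,
    einsteinTensor e γ a c =O[𝓝 y ×ˢ 𝓝[>] (0 : ℝ)] fun q => q.2 ^ ((n : ℤ) - 2)
  /-- the trace condition: the `g`-trace of the restriction to `TM` of
  `r^{2-n} (Ric(g₊) + n g₊)` vanishes at `r = 0` -/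
  trace : ∀ e ∈ atlas (E n) M, ∀ y ∈ e.target,
    (fun q : E n × ℝ =>
      ∑ i, ∑ j, (comp e g.inner q.1)⁻¹ i j * einsteinTensor e γ (Sum.inl i) (Sum.inl j) q)
      =o[𝓝 y ×ˢ 𝓝[>] (0 : ℝ)] fun q => q.2 ^ ((n : ℤ) - 2)

/-! ## Holographic coefficients -/

/-- The coefficient `c_k` in the expansion `f(r) = c_0 + c_1 r + c_2 r² + ⋯` as `r → 0`, `r > 0`,
that is `c_k = lim (f(r) - ∑_{i < k} c_i r^i) / r^k`. -/
def taylorCoeff (f : ℝ → ℝ) (k : ℕ) : ℝ :=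
  limUnder (𝓝[>] (0 : ℝ)) fun r => (f r - ∑ i : Fin k, taylorCoeff f i * r ^ (i : ℕ)) / r ^ k
termination_by k
decreasing_by exact i.2

/-- `v(r) = vol(g_r) / vol(g)` at the point `x`. -/
def volRatio (g : Metric n M) (γ : ℝ → Tensor2 n M) (x : M) (r : ℝ) : ℝ :=
  √(comp (chartAt (E n) x) (γ r) (chartAt (E n) x x)).det /
    √(comp (chartAt (E n) x) g.inner (chartAt (E n) x x)).det

/-- The holographic coefficient `v_k`, the coefficient of `r^k` in `v(r)`. -/
def holo (g : Metric n M) (γ : ℝ → Tensor2 n M) (k : ℕ) (x : M) : ℝ :=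
  taylorCoeff (volRatio g γ x) k

/-- The coefficient `w_k` of `r^k` in `√v(r)`. -/
def holoSqrt (g : Metric n M) (γ : ℝ → Tensor2 n M) (k : ℕ) (x : M) : ℝ :=
  taylorCoeff (fun r => √(volRatio g γ x r)) k

/-! ## Solution operators and their formal adjoints -/

/-- `λ` is not one of `n/2 - 1, …, n/2 - N`, the possible poles of `𝒯_{2N}`. -/
def IsRegular (n N : ℕ) (lam : ℂ) : Prop := ∀ k ∈ Finset.Icc 1 N, lam ≠ n / 2 - k

/-- The partial sum `∑_{j ≤ K} r^{λ+2j} 𝒯_{2j}(λ) f` of the asymptotic expansion of an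
eigenfunction. The argument `j` of `T` stands for the index `2j` of `𝒯_{2j}`. -/
def partialSum (T : ℕ → ℂ → (M → ℂ) → M → ℂ) (K : ℕ) (lam : ℂ) (f : M → ℂ) (x : M) (r : ℝ) : ℂ :=
  ∑ j ∈ Finset.range (K + 1), (r : ℂ) ^ (lam + 2 * j) * T j lam f x

/-- `T j λ = 𝒯_{2j}(g; λ)`, `2j ≤ n`, are the coefficients of the asymptotic expansion
`u ∼ ∑_j r^{λ+2j} 𝒯_{2j}(g; λ) f`, `𝒯_0(g; λ) f = f`, of solutions of
`-Δ_{g₊} u = λ(n - λ) u`: the partial sum up to `r^{λ+2K}` solves the equation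
up to an error `o(r^{Re λ + 2K})`. -/
structure IsSolutionFamily (γ : ℝ → Tensor2 n M) (T : ℕ → ℂ → (M → ℂ) → M → ℂ) : Prop where
  smooth : ∀ K, 2 * K ≤ n → ∀ lam, IsRegular n K lam → ∀ f, IsSmooth n f →
    IsSmooth n (T K lam f)
  zero : ∀ lam f, IsSmooth n f → T 0 lam f = f
  eigen : ∀ K, 2 * K ≤ n → ∀ lam, IsRegular n K lam → ∀ f, IsSmooth n f → ∀ x,
    (fun r : ℝ => -laplacianPlus γ (partialSum T K lam f) x r
        - lam * (n - lam) * partialSum T K lam f x r)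
      =o[𝓝[>] (0 : ℝ)] fun r => r ^ (lam.re + 2 * K)

/-- `B` is the formal adjoint of the (local) operator `A` with respect to `vol(g)`:
`∫_M (A f) h vol(g) = ∫_M f (B h) vol(g)` for smooth `f`, `h`, where `f` has compact support in the
domain of a chart. Since `A` is local, both integrands live in that domain, and the integrals are
written in that chart. -/
structure IsFormalAdjoint (g : Metric n M) (A B : (M → ℂ) → M → ℂ) : Prop where
  smooth : ∀ h, IsSmooth n h → IsSmooth n (B h)
  adjoint : ∀ e ∈ atlas (E n) M, ∀ f h : M → ℂ, IsSmooth n f → IsSmooth n h →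
    HasCompactSupport f → tsupport f ⊆ e.source →
    ∫ y in e.target, A f (e.symm y) * h (e.symm y) * (√(comp e g.inner y).det : ℂ) =
      ∫ y in e.target, f (e.symm y) * B h (e.symm y) * (√(comp e g.inner y).det : ℂ)

/-- `Tadj j λ` is the formal adjoint of `T j λ` away from the poles. -/
def IsAdjointFamily (g : Metric n M) (T Tadj : ℕ → ℂ → (M → ℂ) → M → ℂ) : Prop :=
  ∀ j, 2 * j ≤ n → ∀ lam, IsRegular n j lam → IsFormalAdjoint g (T j lam) (Tadj j lam)

/-! ## `Q`-curvature polynomials -/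

/-- The expression defining the `N`-th `Q`-curvature polynomial,
`-2^{2N} N! (λ + n/2 - 2N + 1) ⋯ (λ + n/2 - N) ∑_{j ≤ N} 𝒯_{2j}^*(λ + n - 2N)(v_{2N-2j})`, at `x`;
it is meaningful if `λ + n - 2N` is not a pole. -/
def qRes (g : Metric n M) (γ : ℝ → Tensor2 n M) (Tadj : ℕ → ℂ → (M → ℂ) → M → ℂ)
    (N : ℕ) (lam : ℂ) (x : M) : ℂ :=
  -(2 ^ (2 * N) * (N.factorial : ℂ)) *
    (∏ k ∈ Finset.Icc 1 N, (lam + n / 2 - 2 * N + k)) *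
    ∑ j ∈ Finset.range (N + 1),
      Tadj j (lam + n - 2 * N) (fun z => (holo g γ (2 * (N - j)) z : ℂ)) x

/-- `P x` is the polynomial `λ ↦ Q_{2N}^{res}(g; λ)(x)`. -/
def IsQPolynomial (g : Metric n M) (γ : ℝ → Tensor2 n M) (Tadj : ℕ → ℂ → (M → ℂ) → M → ℂ)
    (N : ℕ) (P : M → ℂ[X]) : Prop :=
  ∀ lam : ℂ, IsRegular n N (lam + n - 2 * N) → ∀ x, (P x).eval lam = qRes g γ Tadj N lam x

end QCurvature

end

/-! Put `X = r²`, `D = det g_r`, `w = √v`. The coefficient of `r^n log r` in `D` is `det g` times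
the `g`-trace of `ḡ_(n)`, hence zero (`snd_det_dualNumber`), so `v = √(D / det g)` and `w` have even
expansions up to `o(r^n)`. In coordinates `Δ_{g₊}` is `r² ∂_r² + ((1 - n) r + r² v'/v) ∂_r` plus
`r²` times a second order operator along `M`. Comparing the coefficients of `r^{λ+2K}` in the
eigenvalue equation gives (`MetricExpansion.exists_recursion`)

`4K (λ + K - n/2) 𝒯_{2K} f + ∑_{k<K} ((λ + 2k) A_{K-k} + L_{K-1-k}) 𝒯_{2k} f = 0`,

where `A_j` is the coefficient of `r^{2j}` in `r v'/v` and the differential operators `L_l` do not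
depend on `λ`.

Multiplied by `∏_{k≤j} (λ - n/2 + k)`, the function `𝒯_{2j}(λ) f` is therefore a polynomial in `λ`
of degree at most `j`. Only the terms `λ A_{j-i}` reach the top degree, so its coefficient of `λ^j`
is `c_j f` with `c_0 = 1` and `4j c_j = -∑_{i<j} A_{j-i} c_i`
(`IsRecursiveFamily.exists_polynomial`). For `c = ∑ c_j X^j` this says `4X c' = -A c`. Since `D` is
a constant times `w⁴`, also `A = X D'/D = 4X w'/w`, and hence `c = 1/w`
(`MetricExpansion.invSqrtVol_recursion`).

The top coefficient is multiplication by a function, so the adjoints have the same one. To pass to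
adjoints without assuming anything about their dependence on `λ`, the polynomial statements are
written as linear identities between the operators at finitely many values of `λ`, by Lagrange
interpolation at `n/2, n/2 + 1, …`, and such identities dualise (`sum_adjoint_eq`,
`MetricExpansion.exists_adjoint_polynomial`).

In `Q_{2N}^{res}` the prefactor clears the poles of the `j`-th summand and leaves a monic factor of
degree `N - j`. The coefficient of `λ^N` is thus `-2^{2N} N!` times `∑_j c_j v_{2N-2j}`, which is
the coefficient of `r^{2N}` in `w⁻¹ v = w`. -/

noncomputable section

namespace QCurvature


/-! ## Even asymptotic expansions -/

section Expansions

variable {𝕜 : Type*} [RCLike 𝕜] {m : ℕ} {f g : ℝ → 𝕜} {a b : PowerSeries 𝕜}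

/-- `f(r) = ∑_{k ≤ m} a_k r^{2k} + o(r^{2m})` as `r → 0`, `r > 0`. -/
def HasExp (m : ℕ) (f : ℝ → 𝕜) (a : PowerSeries 𝕜) : Prop :=
  (fun r : ℝ => f r - (PowerSeries.trunc (m + 1) a).eval ((r : 𝕜) ^ 2))
    =o[𝓝[>] (0 : ℝ)] fun r : ℝ => r ^ (2 * m)

theorem HasExp.congr' (h : HasExp m f a) (hfg : f =ᶠ[𝓝[>] (0 : ℝ)] g) : HasExp m g a :=
  Asymptotics.IsLittleO.congr' h (hfg.mono fun r hr => by simp only [hr]) EventuallyEq.rfl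

/-- Only the coefficients up to `m` matter. A whole power series is carried along nevertheless, so
that products, inverses and square roots can be formed in the ring without truncating. -/
theorem HasExp.congr_coeff (h : HasExp m f a)
    (hab : ∀ k ≤ m, PowerSeries.coeff k a = PowerSeries.coeff k b) : HasExp m f b := by
  have : PowerSeries.trunc (m + 1) a = PowerSeries.trunc (m + 1) b := by
    ext k
    rw [PowerSeries.coeff_trunc, PowerSeries.coeff_trunc]
    split_ifs with hk
    · exact hab k (by omega)
    · rfl
  rwa [HasExp, ← this]

theorem isBigO_eval_sq (p : 𝕜[X]) :
    (fun r : ℝ => p.eval ((r : 𝕜) ^ 2)) =O[𝓝[>] (0 : ℝ)] fun _ => (1 : ℝ) := by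
  have hc : Continuous fun r : ℝ => p.eval ((r : 𝕜) ^ 2) := by
    exact p.continuous.comp (RCLike.continuous_ofReal.pow 2)
  exact ((hc.tendsto 0).isBigO_one ℝ).mono nhdsWithin_le_nhds

theorem isBigO_eval_sq_of_dvd {p : 𝕜[X]} {k : ℕ} (h : Polynomial.X ^ k ∣ p) :
    (fun r : ℝ => p.eval ((r : 𝕜) ^ 2)) =O[𝓝[>] (0 : ℝ)] fun r : ℝ => r ^ (2 * k) := by
  obtain ⟨q, rfl⟩ := h
  have h1 : (fun r : ℝ => ((r : 𝕜) ^ 2) ^ k) =O[𝓝[>] (0 : ℝ)] fun r : ℝ => r ^ (2 * k) := by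
    refine IsBigO.of_bound 1 (Eventually.of_forall fun r => ?_)
    simp [pow_mul]
  simpa using h1.mul (isBigO_eval_sq q)

theorem pow_isLittleO_pow_zero_right {k l : ℕ} (h : k < l) :
    (fun r : ℝ => r ^ l) =o[𝓝[>] (0 : ℝ)] fun r : ℝ => r ^ k :=
  (isLittleO_pow_pow h).mono nhdsWithin_le_nhds

theorem hasExp_eval_of_dvd {p : 𝕜[X]} 
    (h : Polynomial.X ^ (m + 1) ∣ p - PowerSeries.trunc (m + 1) a) :
    HasExp m (fun r => p.eval ((r : 𝕜) ^ 2)) a := by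
  have := (isBigO_eval_sq_of_dvd h).trans_isLittleO
    (pow_isLittleO_pow_zero_right (show 2 * m < 2 * (m + 1) by omega))
  simpa [HasExp] using this

theorem hasExp_eval_trunc : HasExp m
    (fun r => (PowerSeries.trunc (m + 1) a).eval ((r : 𝕜) ^ 2)) a :=
  hasExp_eval_of_dvd (by simp)

theorem hasExp_const (c : 𝕜) : HasExp m (fun _ => c) (PowerSeries.C c) := by
  simpa using hasExp_eval_of_dvd (m := m) (p := Polynomial.C c) (a := PowerSeries.C c)
    (by simp [PowerSeries.trunc_C])

theorem hasExp_zero : HasExp m (fun _ => (0 : 𝕜)) 0 := by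
  simpa using hasExp_const (m := m) (0 : 𝕜)

theorem hasExp_one : HasExp m (fun _ => (1 : 𝕜)) 1 := by
  simpa using hasExp_const (m := m) (1 : 𝕜)

theorem HasExp.add (hf : HasExp m f a) (hg : HasExp m g b) :
    HasExp m (fun r => f r + g r) (a + b) := by
  refine (Asymptotics.IsLittleO.add hf hg).congr (fun r => ?_) fun _ => rfl
  simp only [map_add, Polynomial.eval_add]; ring

theorem HasExp.isBigO_one (hf : HasExp m f a) : f =O[𝓝[>] (0 : ℝ)] fun _ => (1 : ℝ) := by
  have h1 : (fun r : ℝ => r ^ (2 * m)) =O[𝓝[>] (0 : ℝ)] fun _ => (1 : ℝ) :=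
    ((continuous_pow (2 * m)).tendsto (0 : ℝ)).isBigO_one ℝ |>.mono nhdsWithin_le_nhds
  have := (Asymptotics.IsLittleO.isBigO hf |>.trans h1).add
    (isBigO_eval_sq (PowerSeries.trunc (m + 1) a))
  simpa using this

theorem HasExp.mul (hf : HasExp m f a) (hg : HasExp m g b) :
    HasExp m (fun r => f r * g r) (a * b) := by
  have hfO := hf.isBigO_one
  have h1 := hfO.mul_isLittleO hg
  have h2 := Asymptotics.IsLittleO.mul_isBigO hf (isBigO_eval_sq (PowerSeries.trunc (m + 1) b))
  -- The product of the truncations differs from the truncation of `a * b` by a multiple of `X ^ (m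
  -- + 1)`, which is `o(r^{2m})` at `X = r²`.
  have h3 : HasExp m (fun r => ((PowerSeries.trunc (m + 1) a) * (PowerSeries.trunc (m + 1) b)).eval
      ((r : 𝕜) ^ 2)) (a * b) := by
    refine hasExp_eval_of_dvd ?_
    rw [Polynomial.X_pow_dvd_iff]
    intro d hd
    rw [Polynomial.coeff_sub, PowerSeries.coeff_trunc, if_pos hd,
      PowerSeries.coeff_mul_eq_coeff_trunc_mul_trunc _ _ hd, ← Polynomial.coe_mul,
      Polynomial.coeff_coe, sub_self]
  simp only [one_mul, mul_one] at h1 h2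
  refine ((h1.add h2).add h3).congr (fun r => ?_) fun _ => rfl
  simp only [Polynomial.eval_mul]; ring

theorem HasExp.const_mul (c : 𝕜) (hf : HasExp m f a) :
    HasExp m (fun r => c * f r) (PowerSeries.C c * a) :=
  (hasExp_const c).mul hf

theorem HasExp.neg (hf : HasExp m f a) : HasExp m (fun r => - f r) (-a) := by
  simpa using hf.const_mul (-1)

theorem hasExp_pow (k : ℕ) : HasExp m (fun r : ℝ => (r : 𝕜) ^ (2 * k)) (PowerSeries.X ^ k) := by
  have h := hasExp_eval_of_dvd (m := m) (p := (Polynomial.X ^ k : 𝕜[X]))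
    (a := PowerSeries.X ^ k) (by
      rw [Polynomial.X_pow_dvd_iff]
      intro d hd
      rw [Polynomial.coeff_sub, PowerSeries.coeff_trunc, if_pos hd, Polynomial.coeff_X_pow,
        PowerSeries.coeff_X_pow, sub_self])
  simpa [pow_mul] using h

theorem HasExp.sum {ι : Type*} {s : Finset ι} {F : ι → ℝ → 𝕜} {A : ι → PowerSeries 𝕜}
    (h : ∀ i ∈ s, HasExp m (F i) (A i)) :
    HasExp m (fun r => ∑ i ∈ s, F i r) (∑ i ∈ s, A i) := by
  classical
  induction s using Finset.induction_on with
  | empty => simpa using hasExp_zero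
  | insert i s hi ih =>
    simp only [Finset.sum_insert hi]
    exact (h i (by simp)).add (ih fun j hj => h j (by simp [hj]))

theorem HasExp.mono {k : ℕ} (hk : k ≤ m) (hf : HasExp m f a) : HasExp k f a := by
  have h1 : (fun r : ℝ => r ^ (2 * m)) =O[𝓝[>] (0 : ℝ)] fun r : ℝ => r ^ (2 * k) := by
    rcases hk.eq_or_lt with rfl | h
    · exact isBigO_refl _ _
    · exact (pow_isLittleO_pow_zero_right (by omega)).isBigO
  have h2 : HasExp k (fun r => (PowerSeries.trunc (m + 1) a).eval ((r : 𝕜) ^ 2)) a := by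
    refine hasExp_eval_of_dvd ?_
    rw [Polynomial.X_pow_dvd_iff]
    intro d hd
    rw [Polynomial.coeff_sub, PowerSeries.coeff_trunc, PowerSeries.coeff_trunc, if_pos hd,
      if_pos (by omega), sub_self]
  refine ((Asymptotics.IsLittleO.trans_isBigO hf h1).add h2).congr (fun r => ?_) fun _ => rfl
  ring

theorem HasExp.tendsto (hf : HasExp m f a) :
    Tendsto f (𝓝[>] 0) (𝓝 (PowerSeries.constantCoeff a)) := by
  have h := hf.mono (Nat.zero_le m)
  have h2 : Tendsto (fun r : ℝ => f r - PowerSeries.constantCoeff a) (𝓝[>] 0) (𝓝 0) := by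
    rw [← isLittleO_one_iff ℝ]
    simpa [HasExp, PowerSeries.trunc_succ] using h
  simpa using h2.add_const (PowerSeries.constantCoeff a)

theorem HasExp.of_sub_isLittleO (hg : HasExp m g a)
    (h : (fun r => f r - g r) =o[𝓝[>] (0 : ℝ)] fun r : ℝ => r ^ (2 * m)) : HasExp m f a :=
  (h.add hg).congr (fun r => by ring) fun _ => rfl

theorem HasExp.sub_isLittleO (hf : HasExp m f a) (hg : HasExp m g a) :
    (fun r => f r - g r) =o[𝓝[>] (0 : ℝ)] fun r : ℝ => r ^ (2 * m) :=
  (Asymptotics.IsLittleO.sub hf hg).congr (fun r => by ring) fun _ => rfl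

/-- With `B` the truncation of `a⁻¹`, `1/f - B = (1/f)(1 - f B)`. Here `1/f` is bounded and `f B`
has the expansion `1`. -/
theorem HasExp.inv (hf : HasExp m f a) (ha : PowerSeries.constantCoeff a ≠ 0) :
    HasExp m (fun r => (f r)⁻¹) a⁻¹ := by
  have hne : ∀ᶠ r in 𝓝[>] (0 : ℝ), f r ≠ 0 := hf.tendsto.eventually_ne ha
  have hO : (fun r => (f r)⁻¹) =O[𝓝[>] (0 : ℝ)] fun _ => (1 : ℝ) :=
    (hf.tendsto.inv₀ ha).isBigO_one ℝ
  have hB : HasExp m _ a⁻¹ := hasExp_eval_trunc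
  have h1 := hf.mul hB
  rw [PowerSeries.mul_inv_cancel _ ha] at h1
  have h2 := hO.mul_isLittleO (hasExp_one.sub_isLittleO h1)
  refine HasExp.of_sub_isLittleO hB (h2.congr' ?_ (by simp))
  filter_upwards [hne] with r hr
  field_simp

/-- With `B` the truncation of `b`, `√f - B = (f - B²) / (√f + B)`. The denominator has a positive
limit because `b` has positive constant coefficient, which also selects the branch of the root. -/
theorem HasExp.sqrt {f : ℝ → ℝ} {a b : PowerSeries ℝ} (hf : HasExp m f a) (hb : b * b = a)
    (hb0 : 0 < PowerSeries.constantCoeff b) : HasExp m (fun r => √(f r)) b := by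
  have ha : 0 < PowerSeries.constantCoeff a := by rw [← hb, map_mul]; positivity
  have hpos : ∀ᶠ r in 𝓝[>] (0 : ℝ), 0 < f r := hf.tendsto.eventually_const_lt ha
  have hB : HasExp m _ b := hasExp_eval_trunc
  have hBpos := hB.tendsto.eventually_const_lt hb0
  have h1 := hB.mul hB
  rw [hb] at h1
  have hO : (fun r => (√(f r) + (PowerSeries.trunc (m + 1) b).eval ((r : ℝ) ^ 2))⁻¹)
      =O[𝓝[>] (0 : ℝ)] fun _ => (1 : ℝ) := by
    refine Tendsto.isBigO_one ℝ ((hf.tendsto.sqrt.add hB.tendsto).inv₀ ?_)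
    positivity
  have h2 := hO.mul_isLittleO (hf.sub_isLittleO h1)
  refine HasExp.of_sub_isLittleO hB (h2.congr' ?_ (by simp))
  filter_upwards [hpos, hBpos] with r hr hr2
  simp only [RCLike.ofReal_real_eq_id, id] at hr2 ⊢
  have : √(f r) + (PowerSeries.trunc (m + 1) b).eval (r ^ 2) ≠ 0 := by positivity
  field_simp
  have := Real.mul_self_sqrt hr.le
  linear_combination -this

/-- An asymptotic expansion of zero has zero coefficients. -/
theorem HasExp.coeff_eq_zero (h : HasExp m (fun _ => (0 : 𝕜)) a) :
    ∀ k ≤ m, PowerSeries.coeff k a = 0 := by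
  intro k
  induction k using Nat.strong_induction_on with
  | _ k ih =>
    intro hk
    have h1 := h.mono hk
    have h2 : PowerSeries.trunc (k + 1) a
        = Polynomial.monomial k (PowerSeries.coeff k a) := by
      ext d
      rw [PowerSeries.coeff_trunc, Polynomial.coeff_monomial]
      split_ifs with h1 h2 h2
      · rw [h2]
      · exact ih d (by omega) (by omega)
      · omega
      · rfl
    rw [HasExp, h2] at h1
    simp only [Polynomial.eval_monomial, zero_sub] at h1
    by_contra hne
    have h3 := h1.tendsto_inv_smul_nhds_zero
    have h4 : Tendsto (fun _ : ℝ => -PowerSeries.coeff k a) (𝓝[>] 0) (𝓝 0) := by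
      refine h3.congr' ?_
      filter_upwards [self_mem_nhdsWithin] with r (hr : 0 < r)
      have : (r : 𝕜) ≠ 0 := by exact_mod_cast hr.ne'
      rw [RCLike.real_smul_eq_coe_mul]
      push_cast
      field_simp
      ring
    exact hne (by simpa using tendsto_nhds_unique tendsto_const_nhds h4)

theorem HasExp.isLittleO_sum (h : HasExp m f a) :
    (fun r : ℝ => f r - ∑ k ∈ Finset.range (m + 1), PowerSeries.coeff k a * (r : 𝕜) ^ (2 * k))
      =o[𝓝[>] (0 : ℝ)] fun r : ℝ => r ^ (2 * m) := by
  refine Asymptotics.IsLittleO.congr h (fun r => ?_) fun _ => rfl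
  rw [Polynomial.eval, PowerSeries.eval₂_trunc_eq_sum_range]
  simp [pow_mul]

theorem HasExp.of_isLittleO_sum 
    (h : (fun r : ℝ => f r - ∑ k ∈ Finset.range (m + 1), PowerSeries.coeff k a * (r : 𝕜) ^ (2 * k))
      =o[𝓝[>] (0 : ℝ)] fun r : ℝ => r ^ (2 * m)) : HasExp m f a := by
  refine Asymptotics.IsLittleO.congr h (fun r => ?_) fun _ => rfl
  rw [Polynomial.eval, PowerSeries.eval₂_trunc_eq_sum_range]
  simp [pow_mul]

theorem HasExp.ofReal {f : ℝ → ℝ} {a : PowerSeries ℝ} (hf : HasExp m f a) :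
    HasExp m (fun r => (f r : 𝕜)) (PowerSeries.map (algebraMap ℝ 𝕜) a) := by
  refine HasExp.of_isLittleO_sum (IsLittleO.of_norm_left
    ((IsLittleO.norm_left hf.isLittleO_sum).congr (fun r => ?_) fun _ => rfl))
  rw [Real.norm_eq_abs, ← RCLike.norm_ofReal (K := 𝕜)]
  congr 1
  push_cast
  simp [PowerSeries.coeff_map]

/-- `taylorCoeff` is a recursive `limUnder`, which has a meaning only if the limits exist. The
expansion provides them. -/
theorem HasExp.taylorCoeff_eq {f : ℝ → ℝ} {a : PowerSeries ℝ} (h : HasExp m f a) :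
    ∀ k ≤ 2 * m, taylorCoeff f k = if Even k then PowerSeries.coeff (k / 2) a else 0 := by
  intro k
  induction k using Nat.strong_induction_on with
  | _ k ih =>
    intro hk
    set t : ℕ → ℝ := fun k => if Even k then PowerSeries.coeff (k / 2) a else 0 with ht
    -- The even sum is rewritten over all exponents, with zeros at the odd ones, to match the
    -- recursion of `taylorCoeff`.
    have hs : ∀ r : ℝ, ∑ j ∈ Finset.range (m + 1), PowerSeries.coeff j a * r ^ (2 * j)
        = ∑ i ∈ Finset.range (2 * m + 1), t i * r ^ i := by
      intro r
      clear h hk ih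
      induction m with
      | zero => simp [ht]
      | succ m ihm =>
        rw [Finset.sum_range_succ, ihm, show 2 * (m + 1) + 1 = (2 * m + 1 + 1) + 1 by ring,
          Finset.sum_range_succ _ (2 * m + 1 + 1), Finset.sum_range_succ _ (2 * m + 1)]
        have h1 : t (2 * m + 1) = 0 := by simp [ht]
        have h2 : t (2 * m + 1 + 1) = PowerSeries.coeff (m + 1) a := by
          have : Even (2 * m + 1 + 1) := ⟨m + 1, by ring⟩
          simp only [ht, if_pos this]
          congr 2; omega
        rw [h1, h2]; ring
    rw [taylorCoeff]
    refine Tendsto.limUnder_eq ?_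
    have h1 := h.isLittleO_sum
    simp only [RCLike.ofReal_real_eq_id, id, hs] at h1
    have h2 : (fun r : ℝ => r ^ (2 * m)) =O[𝓝[>] (0 : ℝ)] fun r : ℝ => r ^ k := by
      rcases hk.eq_or_lt with rfl | h
      · exact isBigO_refl _ _
      · exact (pow_isLittleO_pow_zero_right h).isBigO
    have h3 := (h1.trans_isBigO h2).tendsto_div_nhds_zero
    have hc : Continuous fun r : ℝ => ∑ i ∈ Finset.Ico k (2 * m + 1), t i * r ^ (i - k) := by
      fun_prop
    have h4 : Tendsto (fun r : ℝ => ∑ i ∈ Finset.Ico k (2 * m + 1), t i * r ^ (i - k))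
        (𝓝[>] 0) (𝓝 (t k)) := by
      have := (hc.tendsto 0).mono_left (nhdsWithin_le_nhds (s := Set.Ioi 0))
      convert this using 2
      rw [Finset.sum_eq_single_of_mem k (by simp; omega)]
      · simp
      · intro i hi hik
        simp only [Finset.mem_Ico] at hi
        rw [zero_pow (by omega), mul_zero]
    have h5 := h3.add h4
    rw [zero_add] at h5
    refine h5.congr' ?_
    filter_upwards [self_mem_nhdsWithin] with r (hr : 0 < r)
    have e1 : ∑ i : Fin k, taylorCoeff f i * r ^ (i : ℕ) = ∑ i ∈ Finset.range k, t i * r ^ i := by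
      rw [Finset.sum_range]
      exact Finset.sum_congr rfl fun i _ => by rw [ih i i.2 (by omega)]
    rw [e1, ← Finset.sum_range_add_sum_Ico (fun i => t i * r ^ i) (show k ≤ 2 * m + 1 by omega)]
    have e2 : ∑ i ∈ Finset.Ico k (2 * m + 1), t i * r ^ i
        = (∑ i ∈ Finset.Ico k (2 * m + 1), t i * r ^ (i - k)) * r ^ k := by
      rw [Finset.sum_mul]
      refine Finset.sum_congr rfl fun i hi => ?_
      rw [mul_assoc, ← pow_add, Nat.sub_add_cancel (Finset.mem_Ico.1 hi).1]
    rw [e2]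
    field_simp
    ring

end Expansions


/-! ## Square roots of power series -/

/-- The coefficients of the square root with constant coefficient `1` of `∑ a_k X^k`, `a_0 = 1`. -/
def sqrtCoeff (a : ℕ → ℝ) : ℕ → ℝ
  | 0 => 1
  | k + 1 => (a (k + 1) - ∑ i : Fin k, sqrtCoeff a (i + 1) * sqrtCoeff a (k - i)) / 2
decreasing_by
  · exact Nat.succ_lt_succ i.2
  · omega

theorem sqrtCoeff_zero (a : ℕ → ℝ) : sqrtCoeff a 0 = 1 := by rw [sqrtCoeff]

theorem sqrtCoeff_succ (a : ℕ → ℝ) (k : ℕ) : sqrtCoeff a (k + 1)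
    = (a (k + 1) - ∑ i ∈ Finset.range k, sqrtCoeff a (i + 1) * sqrtCoeff a (k - i)) / 2 := by
  rw [sqrtCoeff, Finset.sum_range]

/-- The square root with constant coefficient `1` of a power series with constant
coefficient `1`. -/
def sqrtSeries (a : PowerSeries ℝ) : PowerSeries ℝ :=
  PowerSeries.mk (sqrtCoeff fun k => PowerSeries.coeff k a)

theorem constantCoeff_sqrtSeries (a : PowerSeries ℝ) :
    PowerSeries.constantCoeff (sqrtSeries a) = 1 := by
  rw [← PowerSeries.coeff_zero_eq_constantCoeff_apply, sqrtSeries, PowerSeries.coeff_mk,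
    sqrtCoeff_zero]

theorem sqrtSeries_mul_self {a : PowerSeries ℝ} (ha : PowerSeries.constantCoeff a = 1) :
    sqrtSeries a * sqrtSeries a = a := by
  ext k
  rw [PowerSeries.coeff_mul,
    Finset.Nat.sum_antidiagonal_eq_sum_range_succ
      (fun i j => PowerSeries.coeff i (sqrtSeries a) * PowerSeries.coeff j (sqrtSeries a))]
  simp only [sqrtSeries, PowerSeries.coeff_mk]
  rcases k with _ | k
  · simpa [sqrtCoeff_zero] using ha.symm
  -- Both extreme terms of the Cauchy product equal the unknown coefficient, since the constant
  -- coefficient is `1`; hence the division by `2` in `sqrtCoeff`.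
  · rw [Finset.sum_range_succ, Finset.sum_range_succ', Nat.sub_self, Nat.sub_zero, sqrtCoeff_zero]
    simp only [Nat.add_sub_add_right]
    have := sqrtCoeff_succ (fun k => PowerSeries.coeff k a) k
    linear_combination 2 * this

/-! ## Subrings closed under determinants -/

/-- Properties such as smoothness or the existence of an expansion are packaged below as subrings. A
determinant then inherits them from its entries, being a polynomial in them. -/
theorem _root_.Subring.det_mem {R ι : Type*} [CommRing R] [Fintype ι] [DecidableEq ι] (S : Subring R)
    {A : Matrix ι ι R} (h : ∀ i j, A i j ∈ S) : A.det ∈ S := by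
  rw [Matrix.det_apply]
  exact S.sum_mem fun σ _ => S.toAddSubgroup.zsmul_mem (S.prod_mem fun i _ => h _ _) _

theorem det_apply_fun {X R ι : Type*} [CommRing R] [Fintype ι] [DecidableEq ι]
    (A : Matrix ι ι (X → R)) (x : X) : A.det x = (Matrix.of fun i j => A i j x).det :=
  RingHom.map_det (Pi.evalRingHom (fun _ : X => R) x) A

/-- Families of power series with smooth coefficients. -/
def smoothSeries {V : Type*} [NormedAddCommGroup V] [NormedSpace ℝ V] (U : Set V) :
    Subring (V → PowerSeries ℝ) where
  carrier := {A | ∀ k, ContDiffOn ℝ ∞ (fun y => PowerSeries.coeff k (A y)) U}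
  mul_mem' {A B} hA hB k := by
    simp only [Pi.mul_apply, PowerSeries.coeff_mul]
    exact ContDiffOn.sum fun p _ => (hA p.1).mul (hB p.2)
  one_mem' k := by simpa using contDiffOn_const
  add_mem' {A B} hA hB k := by simpa using (hA k).add (hB k)
  zero_mem' k := by simpa using contDiffOn_const
  neg_mem' {A} hA k := by simpa using (hA k).neg

theorem sqrtSeries_mem_smoothSeries {V : Type*} [NormedAddCommGroup V] [NormedSpace ℝ V]
    {U : Set V} {A : V → PowerSeries ℝ} (hA : A ∈ smoothSeries U) :
    (fun y => sqrtSeries (A y)) ∈ smoothSeries U := by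
  intro k
  simp only [sqrtSeries, PowerSeries.coeff_mk]
  induction k using Nat.strong_induction_on with
  | _ k ih =>
    rcases k with _ | k
    · simpa only [sqrtCoeff_zero] using contDiffOn_const
    · refine ContDiffOn.congr ?_ fun y _ => sqrtCoeff_succ _ _
      refine ((hA (k + 1)).sub (ContDiffOn.sum fun i hi => ?_)).div_const 2
      have := Finset.mem_range.1 hi
      exact (ih _ (by omega)).mul (ih _ (by omega))

/-! ## Expansions with a logarithmic term -/

/-- `f(r) = ∑_{k ≤ m} a_k r^{2k} + c r^{2m} log r + o(r^{2m})` as `r → 0`, `r > 0`. -/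
def HasLogExp (m : ℕ) (f : ℝ → ℝ) (a : PowerSeries ℝ) (c : ℝ) : Prop :=
  HasExp m (fun r => f r - c * (r ^ (2 * m) * Real.log r)) a

section Log

variable {m : ℕ} {f g : ℝ → ℝ} {a b : PowerSeries ℝ} {c d : ℝ}

theorem HasExp.hasLogExp (h : HasExp m f a) : HasLogExp m f a 0 := by
  simpa [HasLogExp] using h

theorem HasLogExp.hasExp (h : HasLogExp m f a 0) : HasExp m f a := by
  simpa [HasLogExp] using h

theorem HasLogExp.add (hf : HasLogExp m f a c) (hg : HasLogExp m g b d) :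
    HasLogExp m (fun r => f r + g r) (a + b) (c + d) :=
  (HasExp.add hf hg).congr' (Eventually.of_forall fun r => by ring)

theorem tendsto_log_mul_self : Tendsto (fun r : ℝ => r * Real.log r) (𝓝[>] 0) (𝓝 0) := by
  have := Real.continuous_mul_log.tendsto 0
  simp only [Real.log_zero, mul_zero] at this
  exact this.mono_left nhdsWithin_le_nhds

/-- As `m ≥ 1`, the difference `f - a_0` is `O(r²)`, and `r² log r → 0`. So in a product the
logarithmic term only meets the constant coefficient of the other factor. -/
theorem HasExp.log_mul_sub (hm : 1 ≤ m) (hf : HasExp m f a) :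
    (fun r => r ^ (2 * m) * Real.log r * (f r - PowerSeries.constantCoeff a))
      =o[𝓝[>] (0 : ℝ)] fun r : ℝ => r ^ (2 * m) := by
  have h1 : (fun r => f r - PowerSeries.constantCoeff a) =O[𝓝[>] (0 : ℝ)] fun r : ℝ => r ^ 2 := by
    have h := (hf.mono hm).isLittleO_sum.isBigO
    have h2 : (fun r : ℝ => PowerSeries.coeff 1 a * r ^ 2) =O[𝓝[>] (0 : ℝ)] fun r : ℝ => r ^ 2 :=
      isBigO_const_mul_self _ _ _
    refine (h.add h2).congr (fun r => ?_) fun r => by norm_num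
    simp [Finset.sum_range_succ]
    ring
  have h2 : (fun r : ℝ => Real.log r * r ^ 2) =o[𝓝[>] (0 : ℝ)] fun _ => (1 : ℝ) := by
    rw [isLittleO_one_iff]
    have h3 : Tendsto (fun r : ℝ => r) (𝓝[>] 0) (𝓝 0) := tendsto_id.mono_left nhdsWithin_le_nhds
    have := h3.mul tendsto_log_mul_self
    rw [mul_zero] at this
    exact this.congr fun r => by ring
  have h3 := ((isBigO_refl (fun r : ℝ => Real.log r) (𝓝[>] 0)).mul h1).trans_isLittleO h2
  have h4 := (isBigO_refl (fun r : ℝ => r ^ (2 * m)) (𝓝[>] 0)).mul_isLittleO h3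
  exact h4.congr (fun r => by ring) fun r => by ring

theorem log_mul_log_isLittleO (hm : 1 ≤ m) :
    (fun r : ℝ => r ^ (2 * m) * Real.log r * (r ^ (2 * m) * Real.log r))
      =o[𝓝[>] (0 : ℝ)] fun r : ℝ => r ^ (2 * m) := by
  obtain ⟨k, rfl⟩ := Nat.exists_eq_add_of_le' hm
  have h3 : (fun r : ℝ => r ^ (2 * k) * (r * Real.log r) ^ 2) =o[𝓝[>] (0 : ℝ)]
      fun _ => (1 : ℝ) := by
    rw [isLittleO_one_iff]
    have h3 : Tendsto (fun r : ℝ => r ^ (2 * k)) (𝓝[>] 0) (𝓝 (0 ^ (2 * k))) :=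
      ((continuous_pow (2 * k)).tendsto 0).mono_left nhdsWithin_le_nhds
    have := h3.mul (tendsto_log_mul_self.pow 2)
    simpa using this
  have h4 := (isBigO_refl (fun r : ℝ => r ^ (2 * (k + 1))) (𝓝[>] 0)).mul_isLittleO h3
  exact h4.congr (fun r => by ring) fun r => by ring

/-- The pair of constant and logarithmic coefficients multiplies like `a_0 + c ε` with `ε² = 0`.
This is why dual numbers can keep track of the logarithms. -/
theorem HasLogExp.mul (hm : 1 ≤ m) (hf : HasLogExp m f a c) (hg : HasLogExp m g b d) :
    HasLogExp m (fun r => f r * g r) (a * b)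
      (PowerSeries.constantCoeff a * d + c * PowerSeries.constantCoeff b) := by
  refine HasExp.of_sub_isLittleO (HasExp.mul hf hg) ?_
  have h1 := ((HasExp.log_mul_sub hm hg).const_mul_left c).add
    ((HasExp.log_mul_sub hm hf).const_mul_left d)
  have h2 := h1.add ((log_mul_log_isLittleO hm).const_mul_left (c * d))
  refine h2.congr (fun r => ?_) fun _ => rfl
  ring

open PowerSeries in
/-- Functions `f` with an expansion `f(r) = ∑_{k ≤ m} a_k r^{2k} + c r^{2m} log r + o(r^{2m})` which
may be differentiated once along `r ∂_r`, together with the power series `∑ a_k X^k` and the dual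
number `a_0 + c ε`. -/
def logExpSubring (m : ℕ) (hm : 1 ≤ m) : Subring ((ℝ → ℝ) × PowerSeries ℝ × DualNumber ℝ) where
  -- `r ∂_r` maps `c r^{2m} log r` to `2m c r^{2m} log r + c r^{2m}`, and on even powers it is `2 X
  -- d/dX` in `X = r²`.
  carrier := {p | (∀ᶠ r in 𝓝[>] (0 : ℝ), DifferentiableAt ℝ p.1 r) ∧
    p.2.2.fst = constantCoeff p.2.1 ∧ HasLogExp m p.1 p.2.1 p.2.2.snd ∧
    HasLogExp m (fun r => r * deriv p.1 r) (2 * X * d⁄dX ℝ p.2.1 + C p.2.2.snd * X ^ m)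
      (2 * m * p.2.2.snd)}
  mul_mem' {p q} := by
    rintro ⟨h1, h2, h3, h4⟩ ⟨k1, k2, k3, k4⟩
    refine ⟨?_, ?_, ?_, ?_⟩
    · filter_upwards [h1, k1] with r hr kr using hr.mul kr
    · simp [h2, k2]
    · have h5 := h3.mul hm k3
      rwa [← h2, ← k2, ← DualNumber.snd_mul] at h5
    · have h5 := (h4.mul hm k3).add (h3.mul hm k4)
      have h6 := HasExp.congr' (g := fun r => r * deriv (p.1 * q.1) r
          - (2 * m * (p.2.2 * q.2.2).snd) * (r ^ (2 * m) * Real.log r)) h5 (by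
        filter_upwards [h1, k1] with r hr kr
        rw [deriv_mul hr kr]
        simp [h2, k2, show m ≠ 0 by omega]
        ring)
      refine HasExp.congr_coeff h6 fun k hk => ?_
      have e : (2 * X * d⁄dX ℝ p.2.1 + C p.2.2.snd * X ^ m) * q.2.1
          + p.2.1 * (2 * X * d⁄dX ℝ q.2.1 + C q.2.2.snd * X ^ m)
          = 2 * X * d⁄dX ℝ (p.2.1 * q.2.1)
            + (C p.2.2.snd * q.2.1 + C q.2.2.snd * p.2.1) * X ^ m := by
        simp only [Derivation.leibniz, smul_eq_mul]; ring
      rw [e]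
      simp only [Prod.fst_mul, Prod.snd_mul, map_add]
      congr 1
      -- The two sides differ only in what multiplies `X ^ m`. Up to order `m` just its constant
      -- coefficient counts, and there the product rule for dual numbers gives equality.
      rw [coeff_mul_X_pow', coeff_mul_X_pow']
      split_ifs with h
      · obtain rfl : k = m := le_antisymm hk h
        simp [h2, k2]
        ring
      · rfl
  one_mem' := by
    refine ⟨?_, ?_, ?_, ?_⟩
    · exact Eventually.of_forall fun r => differentiableAt_const _
    · simp
    · exact hasExp_one.hasLogExp
    · have : (fun r => r * deriv (1 : ℝ → ℝ) r) = fun _ => 0 := by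
        funext r; simp [show deriv (1 : ℝ → ℝ) r = 0 from deriv_const r 1]
      simpa [this] using hasExp_zero.hasLogExp
  add_mem' {p q} := by
    rintro ⟨h1, h2, h3, h4⟩ ⟨k1, k2, k3, k4⟩
    refine ⟨?_, ?_, ?_, ?_⟩
    · filter_upwards [h1, k1] with r hr kr using hr.add kr
    · simp [h2, k2]
    · exact h3.add k3
    · have h5 := h4.add k4
      have h6 := HasExp.congr' (g := fun r => r * deriv (p.1 + q.1) r
          - (2 * m * (p.2.2 + q.2.2).snd) * (r ^ (2 * m) * Real.log r)) h5 (by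
        filter_upwards [h1, k1] with r hr kr
        rw [deriv_add hr kr]
        simp
        ring)
      refine HasExp.congr_coeff h6 fun k hk => ?_
      congr 1
      simp
      ring
  zero_mem' := by
    refine ⟨?_, ?_, ?_, ?_⟩
    · exact Eventually.of_forall fun r => differentiableAt_const _
    · simp
    · exact hasExp_zero.hasLogExp
    · have : (fun r => r * deriv (0 : ℝ → ℝ) r) = fun _ => 0 := by
        funext r; simp [show deriv (0 : ℝ → ℝ) r = 0 from deriv_const r 0]
      simpa [this] using hasExp_zero.hasLogExp
  neg_mem' {p} := by
    rintro ⟨h1, h2, h3, h4⟩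
    refine ⟨?_, ?_, ?_, ?_⟩
    · filter_upwards [h1] with r hr using hr.neg
    · simp [h2]
    · exact (HasExp.neg h3).congr' (Eventually.of_forall fun r => by simp; ring)
    · have h6 := HasExp.congr' (g := fun r => r * deriv (-p.1) r
          - (2 * m * (-p.2.2).snd) * (r ^ (2 * m) * Real.log r)) (HasExp.neg h4) 
          (Eventually.of_forall fun r => by
            change -(r * deriv p.1 r - _) = r * deriv (fun r => -p.1 r) r - _
            rw [deriv.fun_neg]; simp; ring)
      refine HasExp.congr_coeff h6 fun k hk => ?_
      congr 1
      simp
      ring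

end Log

/-- Jacobi's formula, `det (A + ε B) = det A · (1 + ε tr (A⁻¹ B))`. It turns trace-freeness of
`ḡ_(n)` into the absence of a logarithm in `det g_r`. -/
theorem snd_det_dualNumber {ι : Type*} [Fintype ι] [DecidableEq ι] {A B : Matrix ι ι ℝ}
    (hA : IsUnit A.det) (hB : (A⁻¹ * B).trace = 0) :
    (Matrix.of fun i j => (TrivSqZeroExt.inl (A i j) + TrivSqZeroExt.inr (B i j) :
      DualNumber ℝ)).det.snd = 0 := by
  have e : (Matrix.of fun i j => (TrivSqZeroExt.inl (A i j) + TrivSqZeroExt.inr (B i j) :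
      DualNumber ℝ)) = A.map (algebraMap ℝ (DualNumber ℝ))
        * (1 + (DualNumber.eps : DualNumber ℝ) • (A⁻¹ * B).map (algebraMap ℝ (DualNumber ℝ))) := by
    have h : A * (A⁻¹ * B) = B := by rw [← Matrix.mul_assoc, Matrix.mul_nonsing_inv _ hA, one_mul]
    rw [mul_add, mul_one, Matrix.mul_smul, ← Matrix.map_mul, h]
    refine Matrix.ext fun i j => ?_
    simp only [Matrix.of_apply, Matrix.add_apply, Matrix.map_apply, Matrix.smul_apply, smul_eq_mul,
      TrivSqZeroExt.algebraMap_eq_inl]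
    refine TrivSqZeroExt.ext ?_ ?_
    · rw [TrivSqZeroExt.fst_add, TrivSqZeroExt.fst_add, TrivSqZeroExt.fst_mul]; simp
    · rw [TrivSqZeroExt.snd_add, TrivSqZeroExt.snd_add, DualNumber.snd_mul]; simp
  rw [e, Matrix.det_mul, Matrix.det_one_add_smul, ← AddMonoidHom.map_trace, hB]
  have : (DualNumber.eps : DualNumber ℝ) ^ 2 = 0 := by rw [pow_two, DualNumber.eps_mul_eps]
  have e2 : (A.map (algebraMap ℝ (DualNumber ℝ))).det = algebraMap ℝ (DualNumber ℝ) A.det :=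
    (RingHom.map_det _ _).symm
  rw [e2]
  simp [this, TrivSqZeroExt.algebraMap_eq_inl]


/-! ## Components in charts -/

section Charts

variable {n : ℕ} {M : Type*} [TopologicalSpace M] [ChartedSpace (E n) M]

theorem sum_smul_frame (v : E n) : ∑ i, v i • frame n i = v := by
  ext j
  simp [frame, Pi.single_apply]

theorem sum_map_frame {W : Type*} [AddCommGroup W] [Module ℝ W] [TopologicalSpace W]
    (L : E n →L[ℝ] W) (v : E n) : L v = ∑ i, v i • L (frame n i) := by
  conv_lhs => rw [← sum_smul_frame v]
  simp

theorem sum_comp_mul (e : OpenPartialHomeomorph M (E n)) (h : Tensor2 n M) (y v w : E n) :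
    h (e.symm y) (mfderiv 𝓘(ℝ, E n) 𝓘(ℝ, E n) e.symm y v)
      (mfderiv 𝓘(ℝ, E n) 𝓘(ℝ, E n) e.symm y w) = ∑ i, ∑ j, v i * w j * comp e h y i j := by
  have h1 : ∀ u : E n, mfderiv 𝓘(ℝ, E n) 𝓘(ℝ, E n) e.symm y u
      = ∑ i, u i • mfderiv 𝓘(ℝ, E n) 𝓘(ℝ, E n) e.symm y (frame n i) :=
    fun u => sum_map_frame (mfderiv 𝓘(ℝ, E n) 𝓘(ℝ, E n) e.symm y : E n →L[ℝ] E n) u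
  rw [h1 v, h1 w]
  rw [Finset.sum_comm]
  simp only [map_sum, map_smul, sum_apply, smul_apply,
    smul_eq_mul, comp, Matrix.of_apply, Finset.mul_sum]
  exact Finset.sum_congr rfl fun j _ => Finset.sum_congr rfl fun i _ => by ring

variable [IsManifold 𝓘(ℝ, E n) ∞ M]

theorem mem_maximalAtlas_of_mem_atlas {e : OpenPartialHomeomorph M (E n)}
    (he : e ∈ atlas (E n) M) : e ∈ IsManifold.maximalAtlas 𝓘(ℝ, E n) ∞ M :=
  IsManifold.subset_maximalAtlas he

theorem mdifferentiable_of_mem_atlas' {e : OpenPartialHomeomorph M (E n)}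
    (he : e ∈ atlas (E n) M) : e.MDifferentiable 𝓘(ℝ, E n) 𝓘(ℝ, E n) := by
  have : IsManifold 𝓘(ℝ, E n) 1 M := IsManifold.of_le (n := ∞) (by exact_mod_cast le_top)
  exact mdifferentiable_of_mem_atlas he

theorem mfderiv_symm_injective {e : OpenPartialHomeomorph M (E n)} (he : e ∈ atlas (E n) M)
    {y : E n} (hy : y ∈ e.target) :
    Function.Injective (mfderiv 𝓘(ℝ, E n) 𝓘(ℝ, E n) e.symm y) :=
  (mdifferentiable_of_mem_atlas' he).symm.mfderiv_injective hy

theorem posDef_comp {e : OpenPartialHomeomorph M (E n)} (he : e ∈ atlas (E n) M)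
    {h : Tensor2 n M} (hs : ∀ x v w, h x v w = h x w v) (hp : ∀ x v, v ≠ 0 → 0 < h x v v)
    {y : E n} (hy : y ∈ e.target) : (comp e h y).PosDef := by
  refine Matrix.PosDef.of_dotProduct_mulVec_pos ?_ fun v hv => ?_
  · ext i j
    exact hs _ _ _
  · have hv' : (WithLp.toLp 2 v : E n) ≠ 0 := fun h => hv (by simpa using congrArg WithLp.ofLp h)
    have h1 := hp (e.symm y) (mfderiv 𝓘(ℝ, E n) 𝓘(ℝ, E n) e.symm y (WithLp.toLp 2 v : E n))
      (fun h0 => hv' (mfderiv_symm_injective he hy (h0.trans (map_zero _).symm)))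
    rw [sum_comp_mul] at h1
    refine h1.trans_eq ?_
    simp only [dotProduct, Matrix.mulVec, Finset.mul_sum, Pi.star_apply, star_trivial]
    exact Finset.sum_congr rfl fun i _ => Finset.sum_congr rfl fun j _ => by ring

/-- The Jacobian matrix at `y` of the coordinate change from `e` to `e'`. -/
def jacobian (e e' : OpenPartialHomeomorph M (E n)) (y : E n) : Matrix (Fin n) (Fin n) ℝ :=
  Matrix.of fun a i =>
    (show E n from mfderiv 𝓘(ℝ, E n) 𝓘(ℝ, E n) (e' ∘ e.symm) y (frame n i)).ofLp a

theorem comp_eq_jacobian {e e' : OpenPartialHomeomorph M (E n)} (he : e ∈ atlas (E n) M)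
    (he' : e' ∈ atlas (E n) M) (h : Tensor2 n M) {y : E n} (hy : y ∈ e.target)
    (hy' : e.symm y ∈ e'.source) :
    comp e h y = (jacobian e e' y).transpose * comp e' h (e' (e.symm y)) * jacobian e e' y := by
  have hx : e'.symm (e' (e.symm y)) = e.symm y := e'.left_inv hy'
  have hd : ∀ v : E n, mfderiv 𝓘(ℝ, E n) 𝓘(ℝ, E n) e.symm y v
      = mfderiv 𝓘(ℝ, E n) 𝓘(ℝ, E n) e'.symm (e' (e.symm y))
        (mfderiv 𝓘(ℝ, E n) 𝓘(ℝ, E n) (e' ∘ e.symm) y v) := by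
    intro v
    have h1 : e.symm =ᶠ[𝓝 y] e'.symm ∘ (e' ∘ e.symm) := by
      have : ∀ᶠ z in 𝓝 y, e.symm z ∈ e'.source :=
        (e.symm.continuousAt hy).eventually (e'.open_source.mem_nhds hy')
      filter_upwards [this] with z hz
      exact (e'.left_inv hz).symm
    have h2 : MDifferentiableAt 𝓘(ℝ, E n) 𝓘(ℝ, E n) (e' ∘ e.symm) y :=
      ((mdifferentiable_of_mem_atlas' he').mdifferentiableAt hy').comp y
        ((mdifferentiable_of_mem_atlas' he).mdifferentiableAt_symm hy)
    have h3 : MDifferentiableAt 𝓘(ℝ, E n) 𝓘(ℝ, E n) e'.symm ((e' ∘ e.symm) y) :=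
      (mdifferentiable_of_mem_atlas' he').mdifferentiableAt_symm (e'.map_source hy')
    have h4 := mfderiv_comp y h3 h2
    rw [← h1.mfderiv_eq] at h4
    exact DFunLike.congr_fun h4 v
  -- The base point is part of the type of the vectors; its equality is eliminated here, all tangent
  -- spaces being `E n` by definition.
  have key : ∀ z : M, z = e.symm y → ∀ v w : E n, h z v w = h (e.symm y) v w := by
    rintro z rfl v w; rfl
  ext i j
  have h5 := sum_comp_mul e' h (e' (e.symm y))
    (mfderiv 𝓘(ℝ, E n) 𝓘(ℝ, E n) (e' ∘ e.symm) y (frame n i))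
    (mfderiv 𝓘(ℝ, E n) 𝓘(ℝ, E n) (e' ∘ e.symm) y (frame n j))
  rw [← hd, ← hd] at h5
  refine ((key _ hx _ _).symm.trans h5).trans ?_
  simp only [Matrix.mul_apply, Matrix.transpose_apply, jacobian, Matrix.of_apply, Finset.sum_mul]
  rw [Finset.sum_comm]
  refine Finset.sum_congr rfl fun a _ => Finset.sum_congr rfl fun b _ => ?_
  ring

variable {g : Metric n M} {ε : ℝ} {γ : ℝ → Tensor2 n M}

theorem det_comp_metric_pos (g : Metric n M) {e : OpenPartialHomeomorph M (E n)}
    (he : e ∈ atlas (E n) M) {y : E n} (hy : y ∈ e.target) : 0 < (comp e g.inner y).det :=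
  (posDef_comp he g.symm g.pos hy).det_pos

/-- Under a change of chart both determinants acquire the square of the Jacobian determinant. The
ratio, defined through the chart preferred at a moving point, can thus be computed in one fixed
chart, which makes its dependence on the point accessible. -/
theorem volRatio_eq (g : Metric n M) (γ : ℝ → Tensor2 n M) {e : OpenPartialHomeomorph M (E n)}
    (he : e ∈ atlas (E n) M) {y : E n} (hy : y ∈ e.target) (r : ℝ) :
    volRatio g γ (e.symm y) r = √((comp e (γ r) y).det / (comp e g.inner y).det) := by
  set x := e.symm y with hx
  have hxs : x ∈ (chartAt (E n) x).source := mem_chart_source _ x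
  have h0 := det_comp_metric_pos g he hy
  have h1 := comp_eq_jacobian he (chart_mem_atlas (E n) x) (γ r) hy hxs
  have h2 := comp_eq_jacobian he (chart_mem_atlas (E n) x) g.inner hy hxs
  rw [← hx] at h1 h2
  have h3 := det_comp_metric_pos g (chart_mem_atlas (E n) x) ((chartAt (E n) x).map_source hxs)
  rw [h2, Matrix.det_mul, Matrix.det_mul, Matrix.det_transpose] at h0
  have hJ : (jacobian e (chartAt (E n) x) y).det ≠ 0 := by
    intro h; simp [h] at h0
  rw [volRatio, h1, h2, Matrix.det_mul, Matrix.det_mul, Matrix.det_mul, Matrix.det_mul,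
    Matrix.det_transpose, ← Real.sqrt_div' _ h3.le]
  congr 1
  field_simp

end Charts


/-! ## Partial derivatives on `ℝⁿ × ℝ` -/

section PartialDerivatives

variable {n : ℕ} {W : Type*} [NormedAddCommGroup W] [NormedSpace ℝ W]

theorem pderiv_inl_eq {f : E n × ℝ → W} {y : E n} {r : ℝ} (hf : DifferentiableAt ℝ f (y, r))
    (i : Fin n) :
    pderiv (frameR n) (Sum.inl i) f (y, r) = pderiv (frame n) i (fun z => f (z, r)) y := by
  have h1 : HasFDerivAt (fun z : E n => ((z, r) : E n × ℝ))
      (ContinuousLinearMap.inl ℝ (E n) ℝ) y := hasFDerivAt_prodMk_left y r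
  have h2 := HasFDerivAt.comp y (f := fun z : E n => ((z, r) : E n × ℝ)) hf.hasFDerivAt h1
  have h3 : fderiv ℝ (fun z => f (z, r)) y
      = (fderiv ℝ f (y, r)).comp (ContinuousLinearMap.inl ℝ (E n) ℝ) := h2.fderiv
  simp [pderiv, h3, frameR]

theorem pderiv_inr_eq {f : E n × ℝ → W} {y : E n} {r : ℝ} (hf : DifferentiableAt ℝ f (y, r)) :
    pderiv (frameR n) (Sum.inr ()) f (y, r) = deriv (fun s => f (y, s)) r := by
  have h1 : HasFDerivAt (fun s : ℝ => ((y, s) : E n × ℝ))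
      (ContinuousLinearMap.inr ℝ (E n) ℝ) r := hasFDerivAt_prodMk_right y r
  have h2 := HasFDerivAt.comp r (f := fun s : ℝ => ((y, s) : E n × ℝ)) hf.hasFDerivAt h1
  have h3 : fderiv ℝ (fun s => f (y, s)) r
      = (fderiv ℝ f (y, r)).comp (ContinuousLinearMap.inr ℝ (E n) ℝ) := h2.fderiv
  simp [pderiv, ← fderiv_apply_one_eq_deriv, h3, frameR]

theorem DifferentiableAt.comp_slice {f : E n × ℝ → W} {y : E n} {r : ℝ}
    (hf : DifferentiableAt ℝ f (y, r)) : DifferentiableAt ℝ (fun s => f (y, s)) r :=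
  DifferentiableAt.comp (f := fun s : ℝ => ((y, s) : E n × ℝ)) r hf (by fun_prop)

section

variable {V ι : Type*} [NormedAddCommGroup V] [NormedSpace ℝ V] {b : ι → V} {i : ι} {p : V}

theorem pderiv_congr {f g : V → W} (h : f =ᶠ[𝓝 p] g) : pderiv b i f p = pderiv b i g p := by
  rw [pderiv, h.fderiv_eq, pderiv]

theorem pderiv_add {f g : V → W} (hf : DifferentiableAt ℝ f p) (hg : DifferentiableAt ℝ g p) :
    pderiv b i (fun q => f q + g q) p = pderiv b i f p + pderiv b i g p := by
  rw [pderiv, fderiv_fun_add hf hg]; rfl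

theorem pderiv_mul {f g : V → ℝ} (hf : DifferentiableAt ℝ f p) (hg : DifferentiableAt ℝ g p) :
    pderiv b i (fun q => f q * g q) p = f p * pderiv b i g p + g p * pderiv b i f p := by
  rw [pderiv, fderiv_fun_mul hf hg]; rfl

theorem pderiv_smul {f : V → ℝ} {g : V → W} (hf : DifferentiableAt ℝ f p)
    (hg : DifferentiableAt ℝ g p) :
    pderiv b i (fun q => f q • g q) p = f p • pderiv b i g p + pderiv b i f p • g p := by
  rw [pderiv, fderiv_fun_smul hf hg]; rfl

theorem pderiv_const (c : W) : pderiv b i (fun _ => c) p = 0 := by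
  simp [pderiv]

theorem pderiv_neg (f : V → W) : pderiv b i (fun q => -f q) p = - pderiv b i f p := by
  simp [pderiv]

theorem pderiv_inv {f : V → ℝ} (hf : DifferentiableAt ℝ f p) (h0 : f p ≠ 0) :
    pderiv b i (fun q => (f q)⁻¹) p = -((f p)⁻¹ * (f p)⁻¹ * pderiv b i f p) := by
  have := (hasDerivAt_inv h0).comp_hasFDerivAt p hf.hasFDerivAt
  have h2 : fderiv ℝ (fun q => (f q)⁻¹) p = _ := this.fderiv
  rw [pderiv, h2]
  simp [pderiv, pow_two]

end

/-- Functions on `ℝⁿ × ℝ` which have, together with their first derivatives along `ℝⁿ`, even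
expansions in the last variable at the point `y`. -/
def expSubring (m : ℕ) (y : E n) : Subring (E n × ℝ → ℝ) where
  carrier := {f | (∀ᶠ r in 𝓝[>] (0 : ℝ), DifferentiableAt ℝ f (y, r)) ∧
    (∃ a, HasExp m (fun r => f (y, r)) a) ∧
    ∀ i, ∃ a, HasExp m (fun r => pderiv (frameR n) (Sum.inl i) f (y, r)) a}
  mul_mem' {f g} := by
    rintro ⟨h1, ⟨a, h2⟩, h3⟩ ⟨k1, ⟨b, k2⟩, k3⟩
    refine ⟨?_, ⟨_, h2.mul k2⟩, fun i => ?_⟩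
    · filter_upwards [h1, k1] with r hr kr using hr.mul kr
    · obtain ⟨a', h3⟩ := h3 i
      obtain ⟨b', k3⟩ := k3 i
      refine ⟨_, ((h2.mul k3).add (k2.mul h3)).congr' ?_⟩
      filter_upwards [h1, k1] with r hr kr using (pderiv_mul hr kr).symm
  one_mem' := ⟨Eventually.of_forall fun r => differentiableAt_const _, ⟨_, hasExp_one⟩, fun i =>
    ⟨_, hasExp_zero.congr' (Eventually.of_forall fun r => (pderiv_const (1 : ℝ)).symm)⟩⟩
  add_mem' {f g} := by
    rintro ⟨h1, ⟨a, h2⟩, h3⟩ ⟨k1, ⟨b, k2⟩, k3⟩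
    refine ⟨?_, ⟨_, h2.add k2⟩, fun i => ?_⟩
    · filter_upwards [h1, k1] with r hr kr using hr.add kr
    · obtain ⟨a', h3⟩ := h3 i
      obtain ⟨b', k3⟩ := k3 i
      refine ⟨_, (h3.add k3).congr' ?_⟩
      filter_upwards [h1, k1] with r hr kr using (pderiv_add hr kr).symm
  zero_mem' := ⟨Eventually.of_forall fun r => differentiableAt_const _, ⟨_, hasExp_zero⟩, fun i =>
    ⟨_, hasExp_zero.congr' (Eventually.of_forall fun r => (pderiv_const (0 : ℝ)).symm)⟩⟩
  neg_mem' {f} := by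
    rintro ⟨h1, ⟨a, h2⟩, h3⟩
    refine ⟨?_, ⟨_, h2.neg⟩, fun i => ?_⟩
    · filter_upwards [h1] with r hr using hr.neg
    · obtain ⟨a', h3⟩ := h3 i
      exact ⟨_, h3.neg.congr' (Eventually.of_forall fun r => (pderiv_neg f).symm)⟩

theorem inv_mem_expSubring {m : ℕ} {y : E n} {f : E n × ℝ → ℝ} (hf : f ∈ expSubring m y)
    {c : ℝ} (hc : Tendsto (fun r => f (y, r)) (𝓝[>] 0) (𝓝 c)) (hc0 : c ≠ 0) :
    (fun q => (f q)⁻¹) ∈ expSubring m y := by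
  obtain ⟨h1, ⟨a, h2⟩, h3⟩ := hf
  have ha : PowerSeries.constantCoeff a ≠ 0 := by rwa [tendsto_nhds_unique h2.tendsto hc]
  have hne := hc.eventually_ne hc0
  have h4 := h2.inv ha
  refine ⟨?_, ⟨_, h4⟩, fun i => ?_⟩
  · filter_upwards [h1, hne] with r hr hr' using hr.inv hr'
  · obtain ⟨a', h3⟩ := h3 i
    refine ⟨_, ((h4.mul h4).mul h3).neg.congr' ?_⟩
    filter_upwards [h1, hne] with r hr hr' using (pderiv_inv hr hr').symm

end PartialDerivatives

/-! ## Expansions of the metric -/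

section MetricExpansion

variable {n m : ℕ} {M : Type*} [TopologicalSpace M] [ChartedSpace (E n) M]
  {γ : ℝ → Tensor2 n M} {h : ℕ → Tensor2 n M} {hbar : Tensor2 n M}

/-- The components of `∑ h_k X^k`. -/
def metricSeries (e : OpenPartialHomeomorph M (E n)) (h : ℕ → Tensor2 n M) (y : E n) :
    Matrix (Fin n) (Fin n) (PowerSeries ℝ) :=
  Matrix.of fun i j => PowerSeries.mk fun k => comp e (h k) y i j

theorem constantCoeff_det_metricSeries (e : OpenPartialHomeomorph M (E n)) (h : ℕ → Tensor2 n M)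
    (y : E n) :
    PowerSeries.constantCoeff (metricSeries e h y).det = (comp e (h 0) y).det := by
  rw [RingHom.map_det]
  congr 1

theorem det_metricSeries_mem {e : OpenPartialHomeomorph M (E n)} (he : e ∈ atlas (E n) M)
    (hs : ∀ k, IsSmoothSymm (h k)) :
    (fun y => (metricSeries e h y).det) ∈ smoothSeries e.target := by
  have : (fun y => (metricSeries e h y).det)
      = (Matrix.of fun i j => fun y => metricSeries e h y i j).det :=
    funext fun y => (det_apply_fun (Matrix.of fun i j => fun y => metricSeries e h y i j) y).symm
  rw [this]
  refine Subring.det_mem _ fun i j k => ?_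
  simpa [metricSeries] using (hs k).smooth e he i j

section Fixed

variable {e : OpenPartialHomeomorph M (E n)} {y : E n} {i j : Fin n}

/-- The remainder of the expansion of `g_r`. -/
def remainder (e : OpenPartialHomeomorph M (E n)) (γ : ℝ → Tensor2 n M) (h : ℕ → Tensor2 n M)
    (hbar : Tensor2 n M) (i j : Fin n) (q : E n × ℝ) : ℝ :=
  comp e (γ q.2) q.1 i j
    - ∑ k ∈ Finset.range (n / 2 + 1), q.2 ^ (2 * k) * comp e (h k) q.1 i j
    - q.2 ^ n * Real.log q.2 * comp e hbar q.1 i j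

theorem IsSmoothSymm.differentiableAt {T : Tensor2 n M} (hT : IsSmoothSymm T)
    (he : e ∈ atlas (E n) M) (hy : y ∈ e.target) :
    DifferentiableAt ℝ (fun z => comp e T z i j) y :=
  ((hT.smooth e he i j).contDiffAt (e.open_target.mem_nhds hy)).differentiableAt (by simp)

theorem tendsto_slice (y : E n) :
    Tendsto (fun r : ℝ => (y, r)) (𝓝[>] 0) (𝓝 y ×ˢ 𝓝[>] (0 : ℝ)) :=
  tendsto_const_nhds.prodMk tendsto_id

/-- The expansion hypothesis concerns `fderiv` of the whole remainder. Differentiability is needed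
to identify it with derivatives of slices, since `fderiv` takes the default value `0` otherwise. -/
theorem remainder_differentiableAt (he : e ∈ atlas (E n) M) (hy : y ∈ e.target)
    (hs : ∀ k, IsSmoothSymm (h k)) (hbs : IsSmoothSymm hbar)
    (hd : ∀ᶠ r in 𝓝[>] (0 : ℝ),
      DifferentiableAt ℝ (fun q : E n × ℝ => comp e (γ q.2) q.1 i j) (y, r)) :
    ∀ᶠ r in 𝓝[>] (0 : ℝ), DifferentiableAt ℝ (remainder e γ h hbar i j) (y, r) := by
  filter_upwards [hd, self_mem_nhdsWithin] with r hr (hr0 : 0 < r)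
  have hc : ∀ {T : Tensor2 n M}, IsSmoothSymm T →
      DifferentiableAt ℝ (fun q : E n × ℝ => comp e T q.1 i j) (y, r) := fun hT =>
    DifferentiableAt.comp (g := fun z => comp e _ z i j) (y, r) (hT.differentiableAt he hy)
      differentiableAt_fst
  refine (hr.sub (DifferentiableAt.fun_sum fun k _ => ?_)).sub (DifferentiableAt.mul ?_ (hc hbs))
  · exact DifferentiableAt.mul (by fun_prop) (hc (hs k))
  · exact DifferentiableAt.mul (by fun_prop) (differentiableAt_snd.log hr0.ne')

open PowerSeries in
theorem coeff_X_mul_derivative (a : PowerSeries ℝ) (k : ℕ) :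
    coeff k (X * d⁄dX ℝ a) = k * coeff k a := by
  rcases k with _ | k
  · simp
  · rw [coeff_succ_X_mul, coeff_derivative]; push_cast; ring

theorem hasLogExp_comp (hn : n = 2 * m) (he : e ∈ atlas (E n) M) (hy : y ∈ e.target)
    (hexp : HasMetricExpansion γ h hbar) :
    HasLogExp m (fun r => comp e (γ r) y i j) (metricSeries e h y i j) (comp e hbar y i j) := by
  have h1 := (hexp e he y hy i j []).comp_tendsto (tendsto_slice y)
  have e1 : ∀ r : ℝ, r ^ n = r ^ (2 * m) := fun r => by rw [hn]
  have e2 : n / 2 = m := by omega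
  refine HasExp.of_isLittleO_sum (h1.congr (fun r => ?_) fun r => e1 r)
  simp only [totalDeriv, Function.comp, e1, e2, metricSeries, Matrix.of_apply, PowerSeries.coeff_mk,
    RCLike.ofReal_real_eq_id, id]
  rw [Finset.sum_congr rfl fun k _ => mul_comm _ _]
  ring

open PowerSeries in
theorem hasLogExp_deriv_comp (hn : n = 2 * m) (he : e ∈ atlas (E n) M)
    (hy : y ∈ e.target) (hs : ∀ k, IsSmoothSymm (h k)) (hbs : IsSmoothSymm hbar)
    (hexp : HasMetricExpansion γ h hbar)
    (hd : ∀ᶠ r in 𝓝[>] (0 : ℝ),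
      DifferentiableAt ℝ (fun q : E n × ℝ => comp e (γ q.2) q.1 i j) (y, r)) :
    HasLogExp m (fun r => r * deriv (fun r => comp e (γ r) y i j) r)
      (2 * X * d⁄dX ℝ (metricSeries e h y i j) + C (comp e hbar y i j) * X ^ m)
      (2 * m * comp e hbar y i j) := by
  have h1 := (hexp e he y hy i j [Sum.inr ()]).comp_tendsto (tendsto_slice y)
  have e1 : ∀ r : ℝ, r ^ n = r ^ (2 * m) := fun r => by rw [hn]
  have e2 : n / 2 = m := by omega
  refine HasExp.of_isLittleO_sum (h1.congr' ?_ (Eventually.of_forall fun r => e1 r))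
  filter_upwards [hd, remainder_differentiableAt he hy hs hbs hd, self_mem_nhdsWithin]
    with r hr hr' (hr0 : 0 < r)
  have h2 := pderiv_inr_eq hr'
  have h3 : HasDerivAt (fun s => remainder e γ h hbar i j (y, s))
      (deriv (fun r => comp e (γ r) y i j) r
        - ∑ k ∈ Finset.range (n / 2 + 1), (((2 * k : ℕ) : ℝ) * r ^ (2 * k - 1)) * comp e (h k) y i j
        - (((2 * m : ℕ) : ℝ) * r ^ (2 * m - 1) * Real.log r + r ^ (2 * m) * r⁻¹)
          * comp e hbar y i j) r := by
    have h4 := DifferentiableAt.comp_slice hr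
    simp only [remainder, e1]
    exact (h4.hasDerivAt.sub (HasDerivAt.fun_sum fun k _ => (hasDerivAt_pow (2 * k) r).mul_const _)).sub
      (((hasDerivAt_pow (2 * m) r).mul (Real.hasDerivAt_log hr0.ne')).mul_const _)
  rw [h3.deriv] at h2
  simp only [Function.comp, totalDeriv]
  change r * pderiv (frameR n) (Sum.inr ()) (remainder e γ h hbar i j) (y, r) = _
  rw [h2, e2]
  -- At `k = 0` the truncated exponent `2 * k - 1` is harmless because of the factor `2 * k`.
  have e3 : ∀ k : ℕ, ((2 * k : ℕ) : ℝ) * r ^ (2 * k - 1) * r = 2 * k * r ^ (2 * k) := by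
    intro k
    rcases k with _ | k
    · simp
    · rw [mul_assoc, ← pow_succ]; push_cast; congr 2
  have e4 : ∀ k : ℕ, coeff k (2 * X * d⁄dX ℝ (metricSeries e h y i j) + C (comp e hbar y i j) * X ^ m)
      = 2 * k * comp e (h k) y i j + comp e hbar y i j * if k = m then 1 else 0 := by
    intro k
    have : (2 : PowerSeries ℝ) = C 2 := (map_ofNat (C (R := ℝ)) 2).symm
    rw [map_add, mul_assoc, this, coeff_C_mul, coeff_X_mul_derivative, coeff_C_mul, coeff_X_pow]
    simp [metricSeries, mul_assoc]
  simp only [e4, add_mul, Finset.sum_add_distrib, RCLike.ofReal_real_eq_id, id]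
  have e5 : ∑ k ∈ Finset.range (m + 1),
      (comp e hbar y i j * if k = m then 1 else 0) * r ^ (2 * k) = comp e hbar y i j * r ^ (2 * m) := by
    rw [Finset.sum_eq_single_of_mem m (by simp) (fun k _ hk => by simp [hk])]
    simp
  have e6 : (∑ k ∈ Finset.range (m + 1), (((2 * k : ℕ) : ℝ) * r ^ (2 * k - 1)) * comp e (h k) y i j)
      * r = ∑ k ∈ Finset.range (m + 1), 2 * k * comp e (h k) y i j * r ^ (2 * k) := by
    rw [Finset.sum_mul]
    refine Finset.sum_congr rfl fun k _ => ?_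
    linear_combination comp e (h k) y i j * e3 k
  rw [e5]
  have e7 := e3 m
  have e8 : r * r⁻¹ = 1 := mul_inv_cancel₀ hr0.ne'
  linear_combination (-1) * e6 - comp e hbar y i j * Real.log r * e7
    - r ^ (2 * m) * comp e hbar y i j * e8

theorem comp_mem_logExpSubring (hn : n = 2 * m) (hm : 1 ≤ m) (he : e ∈ atlas (E n) M)
    (hy : y ∈ e.target) (hs : ∀ k, IsSmoothSymm (h k)) (hbs : IsSmoothSymm hbar)
    (hexp : HasMetricExpansion γ h hbar)
    (hd : ∀ᶠ r in 𝓝[>] (0 : ℝ),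
      DifferentiableAt ℝ (fun q : E n × ℝ => comp e (γ q.2) q.1 i j) (y, r)) :
    ((fun r => comp e (γ r) y i j, metricSeries e h y i j,
      TrivSqZeroExt.inl (comp e (h 0) y i j) + TrivSqZeroExt.inr (comp e hbar y i j)) :
      (ℝ → ℝ) × PowerSeries ℝ × DualNumber ℝ) ∈ logExpSubring m hm := by
  refine ⟨?_, ?_, ?_, ?_⟩
  · filter_upwards [hd] with r hr using DifferentiableAt.comp_slice hr
  · simp [metricSeries, ← PowerSeries.coeff_zero_eq_constantCoeff_apply]
  · rw [TrivSqZeroExt.snd_add, TrivSqZeroExt.snd_inl, TrivSqZeroExt.snd_inr, zero_add]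
    exact hasLogExp_comp hn he hy hexp
  · rw [TrivSqZeroExt.snd_add, TrivSqZeroExt.snd_inl, TrivSqZeroExt.snd_inr, zero_add]
    exact hasLogExp_deriv_comp hn he hy hs hbs hexp hd

/-- Dropping from order `m` to `m - 1` absorbs the logarithm, as `r^{2m} log r = o(r^{2m-2})`. The
lower order suffices because the tangential part of `Δ_{g₊}` carries a factor `r²`. -/
theorem comp_mem_expSubring (hn : n = 2 * m) (hm : 1 ≤ m) (he : e ∈ atlas (E n) M)
    (hy : y ∈ e.target) (hs : ∀ k, IsSmoothSymm (h k)) (hbs : IsSmoothSymm hbar)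
    (hexp : HasMetricExpansion γ h hbar)
    (hd : ∀ᶠ r in 𝓝[>] (0 : ℝ),
      DifferentiableAt ℝ (fun q : E n × ℝ => comp e (γ q.2) q.1 i j) (y, r)) :
    (fun q : E n × ℝ => comp e (γ q.2) q.1 i j) ∈ expSubring (m - 1) y := by
  have e1 : ∀ r : ℝ, r ^ n = r ^ (2 * m) := fun r => by rw [hn]
  have e2 : n / 2 = m := by omega
  have hlog : (fun r : ℝ => r ^ (2 * m) * Real.log r) =o[𝓝[>] (0 : ℝ)]
      fun r : ℝ => r ^ (2 * (m - 1)) := by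
    have h1 : (fun r : ℝ => r * (r * Real.log r)) =o[𝓝[>] (0 : ℝ)] fun _ => (1 : ℝ) := by
      rw [isLittleO_one_iff]
      have h3 : Tendsto (fun r : ℝ => r) (𝓝[>] 0) (𝓝 0) := tendsto_id.mono_left nhdsWithin_le_nhds
      simpa using h3.mul tendsto_log_mul_self
    have h2 := (isBigO_refl (fun r : ℝ => r ^ (2 * (m - 1))) (𝓝[>] 0)).mul_isLittleO h1
    refine h2.congr (fun r => ?_) fun r => by simp
    obtain ⟨k, rfl⟩ := Nat.exists_eq_add_of_le' hm
    simp only [Nat.add_sub_cancel]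
    ring
  have key : ∀ {f : ℝ → ℝ} {a : PowerSeries ℝ} {c : ℝ}, HasLogExp m f a c → HasExp (m - 1) f a :=
    fun {f a c} hf => (HasExp.mono (Nat.sub_le m 1) hf).of_sub_isLittleO
      ((hlog.const_mul_left c).congr (fun r => by ring) fun _ => rfl)
  refine ⟨hd, ⟨_, key (hasLogExp_comp hn he hy hexp)⟩, fun l => ?_⟩
  refine ⟨PowerSeries.mk fun k => pderiv (frame n) l (fun z => comp e (h k) z i j) y,
    key (c := pderiv (frame n) l (fun z => comp e hbar z i j) y) ?_⟩
  have h1 := (hexp e he y hy i j [Sum.inl l]).comp_tendsto (tendsto_slice y)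
  refine HasExp.of_isLittleO_sum (h1.congr' ?_ (Eventually.of_forall fun r => e1 r))
  filter_upwards [hd, remainder_differentiableAt he hy hs hbs hd] with r hr hr'
  have h2 := pderiv_inl_eq hr' l
  simp only [Function.comp, totalDeriv]
  change pderiv (frameR n) (Sum.inl l) (remainder e γ h hbar i j) (y, r) = _
  rw [h2, pderiv_inl_eq hr]
  have h4 : DifferentiableAt ℝ (fun z => comp e (γ r) z i j) y :=
    DifferentiableAt.comp (f := fun z : E n => ((z, r) : E n × ℝ)) y hr (by fun_prop)
  have h5 := ((h4.hasFDerivAt.sub (HasFDerivAt.fun_sum (u := Finset.range (n / 2 + 1)) fun k _ =>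
      ((hs k).differentiableAt he hy (i := i) (j := j)).hasFDerivAt.const_mul (r ^ (2 * k)))).sub
      ((hbs.differentiableAt he hy (i := i) (j := j)).hasFDerivAt.const_mul
        (r ^ n * Real.log r))).fderiv
  have h6 : pderiv (frame n) l (fun z => remainder e γ h hbar i j (z, r)) y = _ :=
    DFunLike.congr_fun h5 (frame n l)
  rw [h6, e2]
  simp only [_root_.sub_apply, _root_.sum_apply, _root_.smul_apply, smul_eq_mul, pderiv, e1,
    PowerSeries.coeff_mk, RCLike.ofReal_real_eq_id, id]
  rw [Finset.sum_congr rfl fun k _ => mul_comm _ _]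
  ring

end Fixed

/-- The properties of a metric expansion used for the expansions of volume and Laplacian. -/
structure MetricExpansion (m : ℕ) (γ : ℝ → Tensor2 n M) (h : ℕ → Tensor2 n M)
    (hbar : Tensor2 n M) : Prop where
  dim : n = 2 * m
  one_le : 1 ≤ m
  smooth : ∀ k, IsSmoothSymm (h k)
  smooth_bar : IsSmoothSymm hbar
  expansion : HasMetricExpansion γ h hbar
  contDiffAt : ∀ e ∈ atlas (E n) M, ∀ y ∈ e.target, ∀ᶠ r in 𝓝[>] (0 : ℝ), ∀ i j,
    ContDiffAt ℝ ∞ (fun q : E n × ℝ => comp e (γ q.2) q.1 i j) (y, r)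
  det_pos : ∀ e ∈ atlas (E n) M, ∀ y ∈ e.target, 0 < (comp e (h 0) y).det
  trace : ∀ e ∈ atlas (E n) M, ∀ y ∈ e.target, ((comp e (h 0) y)⁻¹ * comp e hbar y).trace = 0

namespace MetricExpansion

variable {e : OpenPartialHomeomorph M (E n)} {y : E n}

theorem differentiableAt (H : MetricExpansion m γ h hbar) (he : e ∈ atlas (E n) M)
    (hy : y ∈ e.target) (i j : Fin n) : ∀ᶠ r in 𝓝[>] (0 : ℝ),
      DifferentiableAt ℝ (fun q : E n × ℝ => comp e (γ q.2) q.1 i j) (y, r) :=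
  (H.contDiffAt e he y hy).mono fun _ hr => (hr i j).differentiableAt (by simp)

-- One determinant in the product ring yields the function, its power series and its dual number at
-- once. The last has no `ε`-part by the trace condition, so the expansion of `det g_r` and that of
-- its `r ∂_r`-derivative reach order `m` without logarithms.
open PowerSeries in
theorem det_mem_logExpSubring (H : MetricExpansion m γ h hbar) (he : e ∈ atlas (E n) M)
    (hy : y ∈ e.target) :
    ((fun r => (comp e (γ r) y).det, (metricSeries e h y).det,
      TrivSqZeroExt.inl (comp e (h 0) y).det) :
      (ℝ → ℝ) × PowerSeries ℝ × DualNumber ℝ) ∈ logExpSubring m H.one_le := by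
  let A : Matrix (Fin n) (Fin n) ((ℝ → ℝ) × PowerSeries ℝ × DualNumber ℝ) :=
    Matrix.of fun i j => (fun r => comp e (γ r) y i j, metricSeries e h y i j,
      TrivSqZeroExt.inl (comp e (h 0) y i j) + TrivSqZeroExt.inr (comp e hbar y i j))
  have hA : A.det ∈ logExpSubring m H.one_le := Subring.det_mem _ fun i j =>
    comp_mem_logExpSubring H.dim H.one_le he hy H.smooth H.smooth_bar H.expansion
      (H.differentiableAt he hy i j)
  have h1 : A.det.1 = fun r => (comp e (γ r) y).det := by
    funext r
    have e1 : A.det.1 = (Matrix.of fun i j => fun r => comp e (γ r) y i j).det :=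
      RingHom.map_det (RingHom.fst _ _) A
    rw [e1, det_apply_fun]
    rfl
  have h2 : A.det.2.1 = (metricSeries e h y).det :=
    RingHom.map_det ((RingHom.fst (PowerSeries ℝ) (DualNumber ℝ)).comp
      (RingHom.snd (ℝ → ℝ) (PowerSeries ℝ × DualNumber ℝ))) A
  have h3 : A.det.2.2.snd = 0 := by
    have e1 : A.det.2.2 = (Matrix.of fun i j => (TrivSqZeroExt.inl (comp e (h 0) y i j)
        + TrivSqZeroExt.inr (comp e hbar y i j) : DualNumber ℝ)).det :=
      RingHom.map_det ((RingHom.snd (PowerSeries ℝ) (DualNumber ℝ)).comp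
        (RingHom.snd (ℝ → ℝ) (PowerSeries ℝ × DualNumber ℝ))) A
    rw [e1]
    exact snd_det_dualNumber (H.det_pos e he y hy).ne'.isUnit (H.trace e he y hy)
  have h4 : A.det.2.2 = TrivSqZeroExt.inl (comp e (h 0) y).det := by
    refine TrivSqZeroExt.ext ?_ h3
    rw [hA.2.1, h2, constantCoeff_det_metricSeries, TrivSqZeroExt.fst_inl]
  rwa [show A.det = (A.det.1, A.det.2.1, A.det.2.2) from rfl, h1, h2, h4] at hA

theorem hasExp_det (H : MetricExpansion m γ h hbar) (he : e ∈ atlas (E n) M) (hy : y ∈ e.target) :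
    HasExp m (fun r => (comp e (γ r) y).det) (metricSeries e h y).det :=
  (H.det_mem_logExpSubring he hy).2.2.1.hasExp

open PowerSeries in
theorem hasExp_deriv_det (H : MetricExpansion m γ h hbar) (he : e ∈ atlas (E n) M)
    (hy : y ∈ e.target) :
    HasExp m (fun r => r * deriv (fun r => (comp e (γ r) y).det) r)
      (2 * X * d⁄dX ℝ (metricSeries e h y).det) := by
  have := (H.det_mem_logExpSubring he hy).2.2.2
  simp only [TrivSqZeroExt.snd_inl, map_zero, zero_mul, mul_zero, add_zero] at this
  exact this.hasExp

theorem comp_mem_expSubring (H : MetricExpansion m γ h hbar) (he : e ∈ atlas (E n) M)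
    (hy : y ∈ e.target) (i j : Fin n) :
    (fun q : E n × ℝ => comp e (γ q.2) q.1 i j) ∈ expSubring (m - 1) y :=
  QCurvature.comp_mem_expSubring H.dim H.one_le he hy H.smooth H.smooth_bar H.expansion
      (H.differentiableAt he hy i j)

theorem det_mem_expSubring (H : MetricExpansion m γ h hbar) (he : e ∈ atlas (E n) M)
    (hy : y ∈ e.target) :
    (fun q : E n × ℝ => (comp e (γ q.2) q.1).det) ∈ expSubring (m - 1) y := by
  have : (fun q : E n × ℝ => (comp e (γ q.2) q.1).det)
      = (Matrix.of fun i j => fun q : E n × ℝ => comp e (γ q.2) q.1 i j).det := 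
    funext fun q => (det_apply_fun (Matrix.of fun i j => fun q : E n × ℝ =>
      comp e (γ q.2) q.1 i j) q).symm
  rw [this]
  exact Subring.det_mem _ fun i j => H.comp_mem_expSubring he hy i j

/-- Cramer's rule: an entry of the adjugate is the determinant of the matrix with one row replaced
by a unit vector, so the subring argument applies again. -/
theorem inv_mem_expSubring (H : MetricExpansion m γ h hbar) (he : e ∈ atlas (E n) M)
    (hy : y ∈ e.target) (i j : Fin n) :
    (fun q : E n × ℝ => (comp e (γ q.2) q.1)⁻¹ i j) ∈ expSubring (m - 1) y := by
  have h1 : (fun q : E n × ℝ => ((comp e (γ q.2) q.1).det)⁻¹) ∈ expSubring (m - 1) y := by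
    refine QCurvature.inv_mem_expSubring (H.det_mem_expSubring he hy)
      (H.hasExp_det he hy).tendsto ?_
    rw [constantCoeff_det_metricSeries]
    exact (H.det_pos e he y hy).ne'
  have h2 : (fun q : E n × ℝ => (comp e (γ q.2) q.1).adjugate i j) ∈ expSubring (m - 1) y := by
    have : (fun q : E n × ℝ => (comp e (γ q.2) q.1).adjugate i j)
        = ((Matrix.of fun i j => fun q : E n × ℝ => comp e (γ q.2) q.1 i j).updateRow j
          (Pi.single i 1)).det := by
      funext q
      rw [Matrix.adjugate_apply, det_apply_fun]
      congr 1
      ext a b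
      simp only [Matrix.updateRow_apply, Matrix.of_apply]
      split_ifs with hab
      · by_cases hb : b = i
        · subst hb; simp
        · simp [hb]
      · rfl
    rw [this]
    refine Subring.det_mem _ fun a b => ?_
    rw [Matrix.updateRow_apply]
    split_ifs with hab
    · by_cases hb : b = i
      · subst hb; rw [Pi.single_eq_same]; exact Subring.one_mem _
      · rw [Pi.single_eq_of_ne hb]; exact Subring.zero_mem _
    · exact H.comp_mem_expSubring he hy a b
  have h3 := Subring.mul_mem _ h1 h2
  refine (congrArg (· ∈ expSubring (m - 1) y) (funext fun q => ?_)).mp h3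
  rw [Matrix.inv_def, Ring.inverse_eq_inv']
  rfl

end MetricExpansion

theorem IsPoincareEinstein.exists_metricExpansion [IsManifold 𝓘(ℝ, E n) ∞ M] {g : Metric n M}
    {ε : ℝ} (hγ : IsPoincareEinstein g ε γ) (hn : n = 2 * m) (hm : 1 ≤ m) :
    ∃ (h : ℕ → Tensor2 n M) (hbar : Tensor2 n M), h 0 = g.inner ∧
      MetricExpansion m γ h hbar := by
  obtain ⟨h, hbar, h0, hs, hbs, htr, hexp⟩ := hγ.expansion
  refine ⟨h, hbar, h0, hn, hm, hs, hbs, hexp, fun e he y hy => ?_, fun e he y hy => ?_, ?_⟩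
  · filter_upwards [Ioo_mem_nhdsGT hγ.eps_pos] with r hr i j
    exact (hγ.smooth e he i j).contDiffAt
      ((e.open_target.prod isOpen_Ioo).mem_nhds ⟨hy, hr⟩)
  · rw [h0]; exact det_comp_metric_pos g he hy
  · rwa [h0]

end MetricExpansion


/-! ## The volume ratio -/

section Volume

variable {n m : ℕ} {M : Type*} [TopologicalSpace M] [ChartedSpace (E n) M]
  {γ : ℝ → Tensor2 n M} {h : ℕ → Tensor2 n M} {hbar : Tensor2 n M}
  {e : OpenPartialHomeomorph M (E n)} {y : E n}

/-- The expansion of `det g_r / det g`. -/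
def detRatioSeries (e : OpenPartialHomeomorph M (E n)) (h : ℕ → Tensor2 n M) (y : E n) :
    PowerSeries ℝ :=
  PowerSeries.C (comp e (h 0) y).det⁻¹ * (metricSeries e h y).det

/-- The expansion of `v(r)`. -/
def volSeries (e : OpenPartialHomeomorph M (E n)) (h : ℕ → Tensor2 n M) (y : E n) :
    PowerSeries ℝ :=
  sqrtSeries (detRatioSeries e h y)

theorem constantCoeff_volSeries (e : OpenPartialHomeomorph M (E n)) (h : ℕ → Tensor2 n M)
    (y : E n) : PowerSeries.constantCoeff (volSeries e h y) = 1 :=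
  constantCoeff_sqrtSeries _

theorem MetricExpansion.constantCoeff_detRatioSeries (H : MetricExpansion m γ h hbar)
    (he : e ∈ atlas (E n) M) (hy : y ∈ e.target) :
    PowerSeries.constantCoeff (detRatioSeries e h y) = 1 := by
  rw [detRatioSeries, map_mul, PowerSeries.constantCoeff_C, constantCoeff_det_metricSeries,
    inv_mul_cancel₀ (H.det_pos e he y hy).ne']

theorem MetricExpansion.volSeries_mem (H : MetricExpansion m γ h hbar)
    (he : e ∈ atlas (E n) M) : volSeries e h ∈ smoothSeries e.target := by
  refine sqrtSeries_mem_smoothSeries (Subring.mul_mem (smoothSeries e.target)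
    (x := fun y => PowerSeries.C (comp e (h 0) y).det⁻¹) (fun k => ?_)
    (det_metricSeries_mem he H.smooth))
  have h1 := det_metricSeries_mem he H.smooth 0
  simp only [PowerSeries.coeff_zero_eq_constantCoeff_apply, constantCoeff_det_metricSeries] at h1
  simp only [PowerSeries.coeff_C]
  split_ifs
  · exact h1.inv fun y hy => (H.det_pos e he y hy).ne'
  · exact contDiffOn_const

variable [IsManifold 𝓘(ℝ, E n) ∞ M] {g : Metric n M}

theorem MetricExpansion.hasExp_volRatio (H : MetricExpansion m γ h hbar) (h0 : h 0 = g.inner)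
    (he : e ∈ atlas (E n) M) (hy : y ∈ e.target) :
    HasExp m (volRatio g γ (e.symm y)) (volSeries e h y) := by
  have h1 := (H.hasExp_det he hy).const_mul (comp e (h 0) y).det⁻¹
  have h2 := h1.sqrt (sqrtSeries_mul_self (H.constantCoeff_detRatioSeries he hy))
    (by rw [constantCoeff_sqrtSeries]; exact one_pos)
  refine h2.congr' (Eventually.of_forall fun r => ?_)
  rw [volRatio_eq g γ he hy, h0]
  rw [div_eq_inv_mul]

theorem MetricExpansion.hasExp_sqrt_volRatio (H : MetricExpansion m γ h hbar)
    (h0 : h 0 = g.inner) (he : e ∈ atlas (E n) M) (hy : y ∈ e.target) :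
    HasExp m (fun r => √(volRatio g γ (e.symm y) r)) (sqrtSeries (volSeries e h y)) :=
  (H.hasExp_volRatio h0 he hy).sqrt (sqrtSeries_mul_self (constantCoeff_volSeries e h y))
    (by rw [constantCoeff_sqrtSeries]; exact one_pos)

theorem MetricExpansion.holo_eq (H : MetricExpansion m γ h hbar) (h0 : h 0 = g.inner)
    (he : e ∈ atlas (E n) M) (hy : y ∈ e.target) {k : ℕ} (hk : k ≤ m) :
    holo g γ (2 * k) (e.symm y) = PowerSeries.coeff k (volSeries e h y) := by
  rw [holo, (H.hasExp_volRatio h0 he hy).taylorCoeff_eq _ (by omega), if_pos (even_two_mul k)]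
  congr 2
  omega

theorem MetricExpansion.holoSqrt_eq (H : MetricExpansion m γ h hbar) (h0 : h 0 = g.inner)
    (he : e ∈ atlas (E n) M) (hy : y ∈ e.target) {k : ℕ} (hk : k ≤ m) :
    holoSqrt g γ (2 * k) (e.symm y) = PowerSeries.coeff k (sqrtSeries (volSeries e h y)) := by
  rw [holoSqrt, (H.hasExp_sqrt_volRatio h0 he hy).taylorCoeff_eq _ (by omega),
    if_pos (even_two_mul k)]
  congr 2
  omega

/-- Smoothness can be checked in charts. -/
theorem isSmooth_of_charts {f : M → ℂ}
    (hf : ∀ e ∈ atlas (E n) M, ContDiffOn ℝ ∞ (fun y => f (e.symm y)) e.target) :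
    IsSmooth n f := by
  intro x
  have he := chart_mem_atlas (E n) x
  refine ContMDiffOn.contMDiffAt (s := (chartAt (E n) x).source) ?_ (chart_source_mem_nhds _ x)
  have h1 : ContMDiffOn 𝓘(ℝ, E n) 𝓘(ℝ, ℂ) ∞ (fun y => f ((chartAt (E n) x).symm y))
      (chartAt (E n) x).target := contMDiffOn_iff_contDiffOn.2 (hf _ he)
  have h2 := h1.comp (contMDiffOn_of_mem_maximalAtlas (mem_maximalAtlas_of_mem_atlas he))
    (fun z hz => (chartAt (E n) x).map_source hz)
  refine h2.congr fun z hz => ?_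
  simp [(chartAt (E n) x).left_inv hz]

theorem IsSmooth.contDiffOn {f : M → ℂ} (hf : IsSmooth n f) (he : e ∈ atlas (E n) M) :
    ContDiffOn ℝ ∞ (fun y => f (e.symm y)) e.target :=
  contMDiffOn_iff_contDiffOn.1
    (hf.comp_contMDiffOn (contMDiffOn_symm_of_mem_maximalAtlas (mem_maximalAtlas_of_mem_atlas he)))

/-- The formal adjoints are controlled on smooth functions only, so this is required before they can
be applied to `v_{2k}`. -/
theorem MetricExpansion.isSmooth_holo (H : MetricExpansion m γ h hbar) (h0 : h 0 = g.inner)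
    {k : ℕ} (hk : k ≤ m) : IsSmooth n fun x => (holo g γ (2 * k) x : ℂ) := by
  refine isSmooth_of_charts fun e he => ?_
  exact (Complex.ofRealCLM.contDiff.comp_contDiffOn (H.volSeries_mem he k)).congr fun y hy => by
    simp [H.holo_eq h0 he hy hk]

end Volume


/-! ## The Laplacian of `g₊` -/

section Laplacian

variable {n : ℕ} {M : Type*} [TopologicalSpace M] [ChartedSpace (E n) M]
  {γ : ℝ → Tensor2 n M} {e : OpenPartialHomeomorph M (E n)} {y : E n} {r : ℝ}

theorem sqrt_det_gPlus {q : E n × ℝ} (hq : 0 < q.2) :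
    √(gPlus e γ q).det = (q.2 ^ (n + 1))⁻¹ * √(comp e (γ q.2) q.1).det := by
  rw [gPlus, Matrix.det_smul, Matrix.det_fromBlocks_zero₂₁, Matrix.det_one, mul_one]
  have h1 : ((q.2 ^ 2)⁻¹ : ℝ) ^ Fintype.card (Fin n ⊕ Unit) = ((q.2 ^ (n + 1))⁻¹) ^ 2 := by
    rw [Fintype.card_sum, Fintype.card_fin, Fintype.card_unit, inv_pow, inv_pow, ← pow_mul,
      ← pow_mul, mul_comm]
  rw [h1, Real.sqrt_mul (by positivity), Real.sqrt_sq (by positivity)]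

theorem inv_gPlus {q : E n × ℝ} (hq : 0 < q.2) (hD : (comp e (γ q.2) q.1).det ≠ 0) :
    (gPlus e γ q)⁻¹ = (q.2 ^ 2) • Matrix.fromBlocks (comp e (γ q.2) q.1)⁻¹ 0 0 1 := by
  have h0 : q.2 ^ 2 ≠ 0 := by positivity
  refine Matrix.inv_eq_right_inv ?_
  rw [gPlus, Matrix.smul_mul, Matrix.mul_smul, smul_smul, inv_mul_cancel₀ h0, one_smul,
    Matrix.fromBlocks_multiply]
  simp [Matrix.mul_nonsing_inv _ hD.isUnit]

theorem pderiv_inl_snd {W : Type*} [NormedAddCommGroup W] [NormedSpace ℝ W] {φ : ℝ → W}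
    (hφ : DifferentiableAt ℝ φ r) (i : Fin n) :
    pderiv (frameR n) (Sum.inl i) (fun q : E n × ℝ => φ q.2) (y, r) = 0 := by
  have h : DifferentiableAt ℝ (fun q : E n × ℝ => φ q.2) (y, r) :=
    DifferentiableAt.comp (g := φ) (y, r) hφ differentiableAt_snd
  rw [pderiv_inl_eq h]
  exact pderiv_const (φ r)

theorem pderiv_inr_snd {W : Type*} [NormedAddCommGroup W] [NormedSpace ℝ W] {φ : ℝ → W}
    (hφ : DifferentiableAt ℝ φ r) :
    pderiv (frameR n) (Sum.inr ()) (fun q : E n × ℝ => φ q.2) (y, r) = deriv φ r := by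
  have h : DifferentiableAt ℝ (fun q : E n × ℝ => φ q.2) (y, r) :=
    DifferentiableAt.comp (g := φ) (y, r) hφ differentiableAt_snd
  rw [pderiv_inr_eq h]

theorem pderiv_sqrt {V ι : Type*} [NormedAddCommGroup V] [NormedSpace ℝ V] {b : ι → V} {i : ι}
    {p : V} {D : V → ℝ} (hD : DifferentiableAt ℝ D p) (h0 : 0 < D p) :
    pderiv b i (fun q => √(D q)) p = √(D p) * (pderiv b i D p / (2 * D p)) := by
  have h1 := (hD.hasFDerivAt.sqrt h0.ne').fderiv
  rw [pderiv, h1]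
  have h2 : √(D p) ≠ 0 := (Real.sqrt_pos.2 h0).ne'
  have h3 := Real.sq_sqrt h0.le
  simp only [smul_apply, smul_eq_mul, pderiv]
  rw [div_mul_eq_mul_div, one_mul, ← mul_div_assoc, div_eq_div_iff (by positivity) (by positivity)]
  linear_combination (2 * fderiv ℝ D p (b i)) * (-h3)

/-- The density of `g₊` is `S = r^{-n-1} √D`, and the inverse metric is `r²` times a block diagonal
matrix, so no mixed terms occur. The logarithmic derivative of `r² S = r^{1-n} √D` along `r`
produces `1 - n` and `∂_r D / (2D)`. -/
theorem laplacian_gPlus {u : E n × ℝ → ℂ} (hr : 0 < r)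
    (hpos : ∀ᶠ q in 𝓝 (y, r), 0 < (comp e (γ q.2) q.1).det)
    (hD : DifferentiableAt ℝ (fun q : E n × ℝ => (comp e (γ q.2) q.1).det) (y, r))
    (hI : ∀ i j, DifferentiableAt ℝ (fun q : E n × ℝ => (comp e (γ q.2) q.1)⁻¹ i j) (y, r))
    (hu : ∀ c, DifferentiableAt ℝ (pderiv (frameR n) c u) (y, r)) :
    laplacian (frameR n) (gPlus e γ) u (y, r) =
      ∑ i, ∑ j, (r ^ 2 * (pderiv (frameR n) (Sum.inl i)
              (fun q : E n × ℝ => (comp e (γ q.2) q.1)⁻¹ i j) (y, r)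
            + (comp e (γ r) y)⁻¹ i j * (pderiv (frameR n) (Sum.inl i)
              (fun q : E n × ℝ => (comp e (γ q.2) q.1).det) (y, r) / (2 * (comp e (γ r) y).det))))
          • pderiv (frameR n) (Sum.inl j) u (y, r)
      + ∑ i, ∑ j, (r ^ 2 * (comp e (γ r) y)⁻¹ i j)
          • pderiv (frameR n) (Sum.inl i) (pderiv (frameR n) (Sum.inl j) u) (y, r)
      + r ^ 2 • pderiv (frameR n) (Sum.inr ()) (pderiv (frameR n) (Sum.inr ()) u) (y, r)
      + ((1 - n) * r + r ^ 2 * (pderiv (frameR n) (Sum.inr ())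
              (fun q : E n × ℝ => (comp e (γ q.2) q.1).det) (y, r) / (2 * (comp e (γ r) y).det)))
          • pderiv (frameR n) (Sum.inr ()) u (y, r) := by
  set D : E n × ℝ → ℝ := fun q => (comp e (γ q.2) q.1).det with hDdef
  set I : Fin n → Fin n → E n × ℝ → ℝ := fun i j q => (comp e (γ q.2) q.1)⁻¹ i j with hIdef
  set S : E n × ℝ → ℝ := fun q => (q.2 ^ (n + 1))⁻¹ * √(D q) with hS
  have hDp : 0 < D (y, r) := hpos.self_of_nhds
  have hφ : DifferentiableAt ℝ (fun s : ℝ => (s ^ (n + 1))⁻¹) r :=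
    (differentiableAt_pow (n + 1)).inv (by positivity)
  have hφ2 : DifferentiableAt ℝ (fun s : ℝ => s ^ 2) r := differentiableAt_pow 2
  have hφ' : DifferentiableAt ℝ (fun q : E n × ℝ => (q.2 ^ (n + 1))⁻¹) (y, r) :=
    DifferentiableAt.comp (g := fun s : ℝ => (s ^ (n + 1))⁻¹) (y, r) hφ differentiableAt_snd
  have hφ2' : DifferentiableAt ℝ (fun q : E n × ℝ => q.2 ^ 2) (y, r) := by fun_prop
  have hsq : DifferentiableAt ℝ (fun q => √(D q)) (y, r) := hD.sqrt hDp.ne'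
  have hSd : DifferentiableAt ℝ S (y, r) := hφ'.mul hsq
  have hSp : 0 < S (y, r) := by
    have := Real.sqrt_pos.2 hDp
    simp only [hS]; positivity
  have hS1 : ∀ i, pderiv (frameR n) (Sum.inl i) S (y, r)
      = S (y, r) * (pderiv (frameR n) (Sum.inl i) D (y, r) / (2 * D (y, r))) := by
    intro i
    rw [hS, pderiv_mul hφ' hsq, pderiv_inl_snd hφ, pderiv_sqrt hD hDp]
    ring
  have hS2 : pderiv (frameR n) (Sum.inr ()) S (y, r)
      = S (y, r) * (-(n + 1) * r⁻¹ + pderiv (frameR n) (Sum.inr ()) D (y, r) / (2 * D (y, r))) := by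
    have h1 : deriv (fun s : ℝ => (s ^ (n + 1))⁻¹) r = -(n + 1) * r⁻¹ * (r ^ (n + 1))⁻¹ := by
      rw [((hasDerivAt_pow (n + 1) r).fun_inv (by positivity)).deriv]
      have : r ≠ 0 := hr.ne'
      simp only [Nat.add_sub_cancel, Nat.cast_add, Nat.cast_one]
      field_simp
      ring
    rw [hS, pderiv_mul hφ' hsq, pderiv_inr_snd hφ, pderiv_sqrt hD hDp, h1]
    ring
  have hev : ∀ᶠ q in 𝓝 (y, r), 0 < q.2 ∧ 0 < D q :=
    (((continuous_snd.tendsto (y, r)).eventually (eventually_gt_nhds hr))).and hpos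
  have t0 : √(gPlus e γ (y, r)).det = S (y, r) := sqrt_det_gPlus hr
  have t1 : ∀ i j, pderiv (frameR n) (Sum.inl i) (fun q => (√(gPlus e γ q).det
        * (gPlus e γ q)⁻¹ (Sum.inl i) (Sum.inl j)) • pderiv (frameR n) (Sum.inl j) u q) (y, r)
      = S (y, r) • ((r ^ 2 * (pderiv (frameR n) (Sum.inl i) (I i j) (y, r) + I i j (y, r) *
            (pderiv (frameR n) (Sum.inl i) D (y, r) / (2 * D (y, r)))))
          • pderiv (frameR n) (Sum.inl j) u (y, r) + (r ^ 2 * I i j (y, r))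
          • pderiv (frameR n) (Sum.inl i) (pderiv (frameR n) (Sum.inl j) u) (y, r)) := by
    intro i j
    have h1 : (fun q => (√(gPlus e γ q).det
        * (gPlus e γ q)⁻¹ (Sum.inl i) (Sum.inl j)) • pderiv (frameR n) (Sum.inl j) u q)
        =ᶠ[𝓝 (y, r)] fun q => (S q * (q.2 ^ 2 * I i j q)) • pderiv (frameR n) (Sum.inl j) u q := by
      filter_upwards [hev] with q hq
      rw [sqrt_det_gPlus hq.1, inv_gPlus hq.1 hq.2.ne']
      simp [hS, hDdef, hIdef]
    have h2 : DifferentiableAt ℝ (fun q => q.2 ^ 2 * I i j q) (y, r) := hφ2'.mul (hI i j)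
    have h3 : DifferentiableAt ℝ (fun q => S q * (q.2 ^ 2 * I i j q)) (y, r) := hSd.mul h2
    rw [pderiv_congr h1, pderiv_smul h3 (hu _), pderiv_mul hSd h2, pderiv_mul hφ2' (hI i j), pderiv_inl_snd hφ2, hS1]
    module
  have t2 : pderiv (frameR n) (Sum.inr ()) (fun q => (√(gPlus e γ q).det
        * (gPlus e γ q)⁻¹ (Sum.inr ()) (Sum.inr ())) • pderiv (frameR n) (Sum.inr ()) u q) (y, r)
      = S (y, r) • (r ^ 2 • pderiv (frameR n) (Sum.inr ()) (pderiv (frameR n) (Sum.inr ()) u) (y, r)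
      + ((1 - n) * r + r ^ 2 * (pderiv (frameR n) (Sum.inr ()) D (y, r) / (2 * D (y, r))))
          • pderiv (frameR n) (Sum.inr ()) u (y, r)) := by
    have h1 : (fun q => (√(gPlus e γ q).det
        * (gPlus e γ q)⁻¹ (Sum.inr ()) (Sum.inr ())) • pderiv (frameR n) (Sum.inr ()) u q)
        =ᶠ[𝓝 (y, r)] fun q => (S q * q.2 ^ 2) • pderiv (frameR n) (Sum.inr ()) u q := by
      filter_upwards [hev] with q hq
      rw [sqrt_det_gPlus hq.1, inv_gPlus hq.1 hq.2.ne']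
      simp [hS, hDdef]
    have h2 : deriv (fun s : ℝ => s ^ 2) r = 2 * r := by simp
    have h3 : r ^ 2 * (-(n + 1) * r⁻¹) = -(n + 1) * r := by field_simp
    have h5 : DifferentiableAt ℝ (fun q => S q * q.2 ^ 2) (y, r) := hSd.mul hφ2'
    rw [pderiv_congr h1, pderiv_smul h5 (hu _),
      pderiv_mul hSd hφ2', pderiv_inr_snd hφ2, hS2, h2]
    have h4 : S (y, r) * (2 * r) + r ^ 2 * (S (y, r) * (-(n + 1) * r⁻¹
        + pderiv (frameR n) (Sum.inr ()) D (y, r) / (2 * D (y, r))))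
        = S (y, r) * ((1 - n) * r
          + r ^ 2 * (pderiv (frameR n) (Sum.inr ()) D (y, r) / (2 * D (y, r)))) := by
      linear_combination S (y, r) * h3
    simp only [h4]
    module
  have t3 : ∀ i, pderiv (frameR n) (Sum.inl i) (fun q => (√(gPlus e γ q).det
        * (gPlus e γ q)⁻¹ (Sum.inl i) (Sum.inr ())) • pderiv (frameR n) (Sum.inr ()) u q) (y, r)
      = 0 := by
    intro i
    rw [pderiv_congr (g := fun _ => 0), pderiv_const]
    filter_upwards [hev] with q hq
    rw [inv_gPlus hq.1 hq.2.ne']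
    simp
  have t4 : ∀ j, pderiv (frameR n) (Sum.inr ()) (fun q => (√(gPlus e γ q).det
        * (gPlus e γ q)⁻¹ (Sum.inr ()) (Sum.inl j)) • pderiv (frameR n) (Sum.inl j) u q) (y, r)
      = 0 := by
    intro i
    rw [pderiv_congr (g := fun _ => 0), pderiv_const]
    filter_upwards [hev] with q hq
    rw [inv_gPlus hq.1 hq.2.ne']
    simp
  rw [laplacian]
  simp only [Fintype.sum_sum_type, Finset.univ_unique, Finset.sum_singleton, PUnit.default_eq_unit,
    t1, t2, t3, t4, t0, Finset.sum_const_zero, add_zero, zero_add]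
  rw [show (∑ i, ∑ j, S (y, r) • ((r ^ 2 * (pderiv (frameR n) (Sum.inl i) (I i j) (y, r)
            + I i j (y, r) * (pderiv (frameR n) (Sum.inl i) D (y, r) / (2 * D (y, r)))))
          • pderiv (frameR n) (Sum.inl j) u (y, r) + (r ^ 2 * I i j (y, r))
          • pderiv (frameR n) (Sum.inl i) (pderiv (frameR n) (Sum.inl j) u) (y, r)))
      = S (y, r) • (∑ i, ∑ j, (r ^ 2 * (pderiv (frameR n) (Sum.inl i) (I i j) (y, r)
            + I i j (y, r) * (pderiv (frameR n) (Sum.inl i) D (y, r) / (2 * D (y, r)))))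
          • pderiv (frameR n) (Sum.inl j) u (y, r) + ∑ i, ∑ j, (r ^ 2 * I i j (y, r))
          • pderiv (frameR n) (Sum.inl i) (pderiv (frameR n) (Sum.inl j) u) (y, r)) by
    simp only [Finset.smul_sum, smul_add, Finset.sum_add_distrib]]
  rw [← smul_add, smul_smul, inv_mul_cancel₀ hSp.ne', one_smul, ← add_assoc]

end Laplacian


/-! ## The recursion for the solution operators -/

section Recursion

/-! ### Differentiation of finite sums of complex powers of `r`. -/

section PowSum

variable {n : ℕ} {s : ℕ → ℂ} {F : ℕ → E n → ℂ} {K : ℕ} {y : E n} {r : ℝ}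

/-- The function `(y, r) ↦ ∑_{k ≤ K} r^{s_k} F_k(y)`. -/
def powSum (s : ℕ → ℂ) (F : ℕ → E n → ℂ) (K : ℕ) (q : E n × ℝ) : ℂ :=
  ∑ k ∈ Finset.range (K + 1), (q.2 : ℂ) ^ s k * F k q.1

theorem hasDerivAt_ofReal_cpow' (a : ℂ) (hr : 0 < r) :
    HasDerivAt (fun t : ℝ => (t : ℂ) ^ a) (a * (r : ℂ) ^ (a - 1)) r := by
  have h1 : HasDerivAt (fun z : ℂ => z ^ a) (a * (r : ℂ) ^ (a - 1) * 1) r :=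
    (hasDerivAt_id (r : ℂ)).cpow_const (Or.inl (by simpa using hr))
  rw [mul_one] at h1
  exact h1.comp_ofReal

theorem differentiableAt_powSum (hr : 0 < r)
    (hF : ∀ k ∈ Finset.range (K + 1), DifferentiableAt ℝ (F k) y) :
    DifferentiableAt ℝ (powSum s F K) (y, r) := by
  refine DifferentiableAt.fun_sum fun k hk => DifferentiableAt.mul ?_ ?_
  · exact DifferentiableAt.comp (g := fun t : ℝ => (t : ℂ) ^ s k) (y, r)
      (hasDerivAt_ofReal_cpow' (s k) hr).differentiableAt differentiableAt_snd
  · exact DifferentiableAt.comp (g := F k) (y, r) (hF k hk) differentiableAt_fst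

theorem pderiv_inl_powSum (hr : 0 < r)
    (hF : ∀ k ∈ Finset.range (K + 1), DifferentiableAt ℝ (F k) y) (j : Fin n) :
    pderiv (frameR n) (Sum.inl j) (powSum s F K) (y, r)
      = powSum s (fun k => pderiv (frame n) j (F k)) K (y, r) := by
  rw [pderiv_inl_eq (differentiableAt_powSum hr hF)]
  have h1 := (HasFDerivAt.fun_sum (u := Finset.range (K + 1)) fun k hk =>
    (hF k hk).hasFDerivAt.const_mul ((r : ℂ) ^ s k)).fderiv
  have h2 : pderiv (frame n) j (fun z => powSum s F K (z, r)) y = _ :=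
    DFunLike.congr_fun h1 (frame n j)
  rw [h2]
  simp [powSum, pderiv]

theorem pderiv_inr_powSum (hr : 0 < r)
    (hF : ∀ k ∈ Finset.range (K + 1), DifferentiableAt ℝ (F k) y) :
    pderiv (frameR n) (Sum.inr ()) (powSum s F K) (y, r)
      = powSum (fun k => s k - 1) (fun k z => s k * F k z) K (y, r) := by
  rw [pderiv_inr_eq (differentiableAt_powSum hr hF)]
  have h1 := (HasDerivAt.fun_sum (u := Finset.range (K + 1)) fun k _ =>
    (hasDerivAt_ofReal_cpow' (s k) hr).mul_const (F k y)).deriv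
  refine Eq.trans h1 (Finset.sum_congr rfl fun k _ => ?_)
  ring

end PowSum

variable {n m : ℕ} {M : Type*} [TopologicalSpace M] [ChartedSpace (E n) M]
  {γ : ℝ → Tensor2 n M} {h : ℕ → Tensor2 n M} {hbar : Tensor2 n M}
  {e : OpenPartialHomeomorph M (E n)} {y : E n} {r : ℝ}

/-- The operator `F ↦ ∑ p_{ij} ∂_j F + ∑ q_{ij} ∂_i ∂_j F` at `y`. -/
def jetOp (p q : Fin n → Fin n → ℝ) (y : E n) (F : E n → ℂ) : ℂ :=
  ∑ i, ∑ j, (p i j : ℂ) * pderiv (frame n) j F y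
    + ∑ i, ∑ j, (q i j : ℂ) * pderiv (frame n) i (pderiv (frame n) j F) y

theorem jetOp_eq_zero (p q : Fin n → Fin n → ℝ) {F : E n → ℂ} (hF : F =ᶠ[𝓝 y] 0) :
    jetOp p q y F = 0 := by
  have h1 : ∀ᶠ z in 𝓝 y, ∀ j, pderiv (frame n) j F z = 0 := by
    filter_upwards [hF.eventuallyEq_nhds] with z hz j
    rw [pderiv_congr hz]
    exact pderiv_const (0 : ℂ)
  have h2 : ∀ j, pderiv (frame n) j F =ᶠ[𝓝 y] fun _ => 0 := fun j => h1.mono fun z hz => hz j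
  have h3 : ∀ i j, pderiv (frame n) i (pderiv (frame n) j F) y = 0 := fun i j => by
    rw [pderiv_congr (h2 j)]
    exact pderiv_const (0 : ℂ)
  simp [jetOp, h3, h1.self_of_nhds]

theorem contDiffAt_pderiv {F : E n → ℂ} (hF : ContDiffAt ℝ ∞ F y) (j : Fin n) :
    ContDiffAt ℝ ∞ (pderiv (frame n) j F) y :=
  (hF.fderiv_right (m := ∞) (by simp)).clm_apply contDiffAt_const

theorem pderiv_sum_mul {ι : Type*} {s : Finset ι} (c : ι → ℂ) {F : ι → E n → ℂ}
    (hF : ∀ a ∈ s, DifferentiableAt ℝ (F a) y) (j : Fin n) :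
    pderiv (frame n) j (fun z => ∑ a ∈ s, c a * F a z) y
      = ∑ a ∈ s, c a * pderiv (frame n) j (F a) y := by
  have h1 := (HasFDerivAt.fun_sum (u := s) fun a ha =>
    (hF a ha).hasFDerivAt.const_mul (c a)).fderiv
  rw [pderiv, h1]
  simp [pderiv]

theorem jetOp_sum (p q : Fin n → Fin n → ℝ) {ι : Type*} {s : Finset ι} (c : ι → ℂ)
    {F : ι → E n → ℂ} (hF : ∀ a ∈ s, ContDiffAt ℝ ∞ (F a) y) :
    jetOp p q y (fun z => ∑ a ∈ s, c a * F a z) = ∑ a ∈ s, c a * jetOp p q y (F a) := by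
  have hd : ∀ᶠ z in 𝓝 y, ∀ a ∈ s, DifferentiableAt ℝ (F a) z := by
    rw [Filter.eventually_all_finset]
    intro a ha
    have := ((hF a ha).of_le (m := 1) (by exact_mod_cast le_top)).eventually (by simp)
    exact this.mono fun z hz => hz.differentiableAt (by simp)
  have h1 : ∀ j, pderiv (frame n) j (fun z => ∑ a ∈ s, c a * F a z)
      =ᶠ[𝓝 y] fun z => ∑ a ∈ s, c a * pderiv (frame n) j (F a) z := fun j =>
    hd.mono fun z hz => pderiv_sum_mul c hz j
  have h2 : ∀ i j, pderiv (frame n) i (pderiv (frame n) j (fun z => ∑ a ∈ s, c a * F a z)) y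
      = ∑ a ∈ s, c a * pderiv (frame n) i (pderiv (frame n) j (F a)) y := fun i j => by
    rw [pderiv_congr (h1 j), pderiv_sum_mul c fun a ha =>
      (contDiffAt_pderiv (hF a ha) j).differentiableAt (by simp)]
  simp only [jetOp, h2, (h1 _).self_of_nhds, mul_add, Finset.mul_sum, Finset.sum_add_distrib]
  congr 1
  all_goals
    rw [eq_comm, Finset.sum_comm]
    refine Finset.sum_congr rfl fun i _ => ?_
    rw [Finset.sum_comm]
    exact Finset.sum_congr rfl fun j _ => Finset.sum_congr rfl fun a _ => by ring

/-- The coefficient of the first order term `∂_j` in the part with `∂_i` outside of `Δ_{g_r}`. -/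
def firstOrder (e : OpenPartialHomeomorph M (E n)) (γ : ℝ → Tensor2 n M) (y : E n) (i j : Fin n)
    (r : ℝ) : ℝ :=
  pderiv (frameR n) (Sum.inl i) (fun q : E n × ℝ => (comp e (γ q.2) q.1)⁻¹ i j) (y, r)
    + (comp e (γ r) y)⁻¹ i j * (pderiv (frameR n) (Sum.inl i)
      (fun q : E n × ℝ => (comp e (γ q.2) q.1).det) (y, r) / (2 * (comp e (γ r) y).det))

/-- The function `r v'(r) / v(r)`. -/
def logDerivVol (e : OpenPartialHomeomorph M (E n)) (γ : ℝ → Tensor2 n M) (y : E n) (r : ℝ) : ℝ :=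
  r * deriv (fun r => (comp e (γ r) y).det) r / (2 * (comp e (γ r) y).det)

open PowerSeries in
/-- The expansion of `r v'(r) / v(r)`. -/
def logDerivSeries (e : OpenPartialHomeomorph M (E n)) (h : ℕ → Tensor2 n M) (y : E n) :
    PowerSeries ℝ :=
  X * d⁄dX ℝ (metricSeries e h y).det * (metricSeries e h y).det⁻¹

namespace MetricExpansion

theorem constantCoeff_det_ne_zero (H : MetricExpansion m γ h hbar) (he : e ∈ atlas (E n) M)
    (hy : y ∈ e.target) : PowerSeries.constantCoeff (metricSeries e h y).det ≠ 0 := by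
  rw [constantCoeff_det_metricSeries]
  exact (H.det_pos e he y hy).ne'

theorem hasExp_logDerivVol (H : MetricExpansion m γ h hbar) (he : e ∈ atlas (E n) M)
    (hy : y ∈ e.target) : HasExp m (logDerivVol e γ y) (logDerivSeries e h y) := by
  have h1 := ((H.hasExp_deriv_det he hy).mul ((H.hasExp_det he hy).inv
    (H.constantCoeff_det_ne_zero he hy))).const_mul (1 / 2)
  refine HasExp.congr_coeff (h1.congr' (Eventually.of_forall fun r => ?_)) fun k _ => ?_
  · simp only [logDerivVol]; ring
  · congr 1
    have : (2 : PowerSeries ℝ) = PowerSeries.C 2 := (map_ofNat (PowerSeries.C (R := ℝ)) 2).symm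
    rw [logDerivSeries, this, ← mul_assoc, ← mul_assoc, ← mul_assoc, ← map_mul]
    norm_num

theorem exists_hasExp_firstOrder (H : MetricExpansion m γ h hbar) (he : e ∈ atlas (E n) M)
    (hy : y ∈ e.target) (i j : Fin n) : ∃ a, HasExp (m - 1) (firstOrder e γ y i j) a := by
  obtain ⟨-, ⟨a, h1⟩, h2⟩ := H.inv_mem_expSubring he hy i j
  obtain ⟨-, -, h3⟩ := H.det_mem_expSubring he hy
  obtain ⟨b, h2⟩ := h2 i
  obtain ⟨d, h3⟩ := h3 i
  have h4 := ((H.hasExp_det he hy).mono (Nat.sub_le m 1)).inv (H.constantCoeff_det_ne_zero he hy)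
  refine ⟨_, (h2.add (h1.mul ((h3.mul h4).const_mul (1 / 2)))).congr'
    (Eventually.of_forall fun r => ?_)⟩
  simp only [firstOrder]
  ring

/-- `-Δ_{g₊} u - λ (n - λ) u` for a finite sum `u = ∑ r^{λ + 2k} F_k`. -/
theorem laplacian_powSum (H : MetricExpansion m γ h hbar) (he : e ∈ atlas (E n) M)
    (hy : y ∈ e.target) (lam : ℂ) {F : ℕ → E n → ℂ} {K : ℕ}
    (hF : ∀ k ∈ Finset.range (K + 1), ContDiffAt ℝ ∞ (F k) y) :
    ∀ᶠ r in 𝓝[>] (0 : ℝ),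
      -laplacian (frameR n) (gPlus e γ) (powSum (fun k => lam + 2 * k) F K) (y, r)
        - lam * (n - lam) * powSum (fun k => lam + 2 * k) F K (y, r)
      = -((r : ℂ) ^ lam * ∑ k ∈ Finset.range (K + 1), (r : ℂ) ^ (2 * k) *
          (4 * k * (lam + k - n / 2) * F k y + (lam + 2 * k) * F k y * (logDerivVol e γ y r : ℝ)
            + (r : ℂ) ^ 2 * jetOp (fun i j => firstOrder e γ y i j r)
              (fun i j => (comp e (γ r) y)⁻¹ i j) y (F k))) := by
  have hI : ∀ᶠ r in 𝓝[>] (0 : ℝ), ∀ i j,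
      DifferentiableAt ℝ (fun q : E n × ℝ => (comp e (γ q.2) q.1)⁻¹ i j) (y, r) :=
    eventually_all.2 fun i => eventually_all.2 fun j => (H.inv_mem_expSubring he hy i j).1
  have hDpos : ∀ᶠ r in 𝓝[>] (0 : ℝ), 0 < (comp e (γ r) y).det := by
    refine (H.hasExp_det he hy).tendsto.eventually_const_lt ?_
    rw [constantCoeff_det_metricSeries]
    exact H.det_pos e he y hy
  have hd : ∀ᶠ z in 𝓝 y, ∀ k ∈ Finset.range (K + 1), DifferentiableAt ℝ (F k) z := by
    rw [Filter.eventually_all_finset]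
    intro a ha
    have := ((hF a ha).of_le (m := 1) (by exact_mod_cast le_top)).eventually (by simp)
    exact this.mono fun z hz => hz.differentiableAt (by simp)
  filter_upwards [hI, hDpos, (H.det_mem_expSubring he hy).1, self_mem_nhdsWithin]
    with r hI hDpos hD (hr : 0 < r)
  set s : ℕ → ℂ := fun k => lam + 2 * k with hs
  have hpos : ∀ᶠ q in 𝓝 (y, r), 0 < (comp e (γ q.2) q.1).det :=
    hD.continuousAt.eventually (eventually_gt_nhds hDpos)
  have hev : ∀ᶠ q in 𝓝 (y, r), 0 < q.2 ∧ ∀ k ∈ Finset.range (K + 1), DifferentiableAt ℝ (F k) q.1 :=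
    ((continuous_snd.tendsto (y, r)).eventually (eventually_gt_nhds hr)).and
      ((continuous_fst.tendsto (y, r)).eventually hd)
  have u1 : ∀ j, pderiv (frameR n) (Sum.inl j) (powSum s F K)
      =ᶠ[𝓝 (y, r)] powSum s (fun k => pderiv (frame n) j (F k)) K := fun j =>
    hev.mono fun q hq => pderiv_inl_powSum hq.1 hq.2 j
  have u2 : pderiv (frameR n) (Sum.inr ()) (powSum s F K)
      =ᶠ[𝓝 (y, r)] powSum (fun k => s k - 1) (fun k z => s k * F k z) K :=
    hev.mono fun q hq => pderiv_inr_powSum hq.1 hq.2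
  have d1 : ∀ j, ∀ k ∈ Finset.range (K + 1), DifferentiableAt ℝ (pderiv (frame n) j (F k)) y :=
    fun j k hk => (contDiffAt_pderiv (hF k hk) j).differentiableAt (by simp)
  have d2 : ∀ k ∈ Finset.range (K + 1), DifferentiableAt ℝ (fun z => s k * F k z) y :=
    fun k hk => ((hF k hk).differentiableAt (by simp)).const_mul (s k)
  have hu : ∀ c, DifferentiableAt ℝ (pderiv (frameR n) c (powSum s F K)) (y, r) := by
    rintro (j | ⟨⟩)
    · exact (u1 j).differentiableAt_iff.2 (differentiableAt_powSum hr (d1 j))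
    · exact u2.differentiableAt_iff.2 (differentiableAt_powSum hr d2)
  rw [laplacian_gPlus hr hpos hD hI hu]
  have v1 : ∀ i j, pderiv (frameR n) (Sum.inl i) (pderiv (frameR n) (Sum.inl j) (powSum s F K)) (y, r)
      = powSum s (fun k => pderiv (frame n) i (pderiv (frame n) j (F k))) K (y, r) := fun i j => by
    rw [pderiv_congr (u1 j), pderiv_inl_powSum hr (d1 j)]
  have v2 : pderiv (frameR n) (Sum.inr ()) (pderiv (frameR n) (Sum.inr ()) (powSum s F K)) (y, r)
      = powSum (fun k => s k - 1 - 1) (fun k z => (s k - 1) * (s k * F k z)) K (y, r) := by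
    rw [pderiv_congr u2, pderiv_inr_powSum hr d2]
  simp only [v1, v2, (u1 _).self_of_nhds, u2.self_of_nhds]
  rw [pderiv_inr_eq hD]
  have hrc : (r : ℂ) ≠ 0 := by exact_mod_cast hr.ne'
  have e1 : ∀ k, (r : ℂ) ^ s k = (r : ℂ) ^ lam * (r : ℂ) ^ (2 * k) := fun k => by
    rw [hs, Complex.cpow_add _ _ hrc]
    congr 1
    exact_mod_cast Complex.cpow_natCast (r : ℂ) (2 * k)
  have e2 : ∀ k, (r : ℂ) ^ (s k - 1) = (r : ℂ) ^ lam * (r : ℂ) ^ (2 * k) * (r : ℂ)⁻¹ := fun k => by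
    rw [Complex.cpow_sub _ _ hrc, e1, Complex.cpow_one, div_eq_mul_inv]
  have e3 : ∀ k, (r : ℂ) ^ (s k - 1 - 1)
      = (r : ℂ) ^ lam * (r : ℂ) ^ (2 * k) * (r : ℂ)⁻¹ * (r : ℂ)⁻¹ := fun k => by
    rw [Complex.cpow_sub _ _ hrc, e2, Complex.cpow_one, div_eq_mul_inv]
  have w1 : ∑ i, ∑ j, (r ^ 2 * firstOrder e γ y i j r)
        • powSum s (fun k => pderiv (frame n) j (F k)) K (y, r)
      + ∑ i, ∑ j, (r ^ 2 * (comp e (γ r) y)⁻¹ i j)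
        • powSum s (fun k => pderiv (frame n) i (pderiv (frame n) j (F k))) K (y, r)
      = ∑ k ∈ Finset.range (K + 1), (r : ℂ) ^ lam * (r : ℂ) ^ (2 * k) * ((r : ℂ) ^ 2 *
          jetOp (fun i j => firstOrder e γ y i j r) (fun i j => (comp e (γ r) y)⁻¹ i j) y (F k)) := by
    simp only [jetOp, powSum, mul_add, Finset.sum_add_distrib, Finset.smul_sum, Finset.mul_sum]
    congr 1
    all_goals
      rw [eq_comm, Finset.sum_comm]
      refine Finset.sum_congr rfl fun i _ => ?_
      rw [Finset.sum_comm]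
      refine Finset.sum_congr rfl fun j _ => Finset.sum_congr rfl fun k _ => ?_
      rw [e1, Complex.real_smul]
      push_cast
      ring
  have w2 : ((1 - n) * r + r ^ 2 * (deriv (fun s => (comp e (γ s) y).det) r
      / (2 * (comp e (γ r) y).det))) = r * ((1 - n) + logDerivVol e γ y r) := by
    rw [logDerivVol]; ring
  simp only [firstOrder] at w1
  rw [w1, w2]
  simp only [powSum, e1, e2, e3, Complex.real_smul, Finset.mul_sum, ← Finset.sum_add_distrib,
    ← Finset.sum_neg_distrib, ← Finset.sum_sub_distrib]
  -- With `s = λ + 2k`, the indicial factor is `s(s - 1) + (1 - n)s + λ(n - λ) = 4k(λ + k - n/2)`.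
  refine Finset.sum_congr rfl fun k _ => ?_
  simp only [hs, firstOrder]
  generalize jetOp _ _ y (F k) = J
  push_cast
  field_simp
  ring

-- The factor `r²` recovers the order given up in `comp_mem_expSubring`.
open PowerSeries in
theorem hasExp_sq_mul {f : ℝ → ℂ} {a : PowerSeries ℂ} (hm : 1 ≤ m) (hf : HasExp (m - 1) f a) :
    HasExp m (fun r : ℝ => (r : ℂ) ^ 2 * f r) (X * a) := by
  have h1 : (fun r : ℝ => (r : ℂ) ^ 2) =O[𝓝[>] (0 : ℝ)] fun r : ℝ => r ^ 2 :=
    IsBigO.of_bound 1 (Eventually.of_forall fun r => by simp)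
  have h2 := h1.mul_isLittleO hf.isLittleO_sum
  obtain ⟨k, rfl⟩ := Nat.exists_eq_add_of_le' hm
  refine HasExp.of_isLittleO_sum (h2.congr (fun r => ?_) fun r => ?_)
  · rw [Finset.sum_range_succ' _ (k + 1), mul_sub, Finset.mul_sum]
    simp only [coeff_succ_X_mul, coeff_zero_X_mul, Nat.add_sub_cancel, zero_mul, add_zero]
    congr 1
    refine Finset.sum_congr rfl fun j _ => ?_
    simp only [Complex.coe_algebraMap]
    ring
  · simp only [Nat.add_sub_cancel]
    ring

/-- The coefficient of `r^{2K}` in the eigenvalue equation for `∑ r^{λ + 2k} F_k`. -/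
theorem exists_recursion (H : MetricExpansion m γ h hbar) (he : e ∈ atlas (E n) M)
    (hy : y ∈ e.target) : ∃ p q : ℕ → Fin n → Fin n → ℝ, ∀ (K : ℕ) (lam : ℂ) (F : ℕ → E n → ℂ),
      K ≤ m → (∀ k ∈ Finset.range (K + 1), ContDiffAt ℝ ∞ (F k) y) →
      (fun r : ℝ => -laplacian (frameR n) (gPlus e γ) (powSum (fun k => lam + 2 * k) F K) (y, r)
        - lam * (n - lam) * powSum (fun k => lam + 2 * k) F K (y, r))
        =o[𝓝[>] (0 : ℝ)] (fun r => r ^ (lam.re + 2 * K)) →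
      4 * K * (lam + K - n / 2) * F K y
        + ∑ k ∈ Finset.range K, ((lam + 2 * k)
            * (PowerSeries.coeff (K - k) (logDerivSeries e h y) : ℝ) * F k y
          + jetOp (p (K - 1 - k)) (q (K - 1 - k)) y (F k)) = 0 := by
  choose a ha using H.exists_hasExp_firstOrder he hy
  have hb : ∀ i j, ∃ b, HasExp (m - 1) (fun r => (comp e (γ r) y)⁻¹ i j) b :=
    fun i j => (H.inv_mem_expSubring he hy i j).2.1
  choose b hb using hb
  -- The operators are made from the coefficients of `g_r` alone, so they depend neither on `λ` nor
  -- on `F`; the degree count in `λ` relies on this.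
  refine ⟨fun k i j => PowerSeries.coeff k (a i j), fun k i j => PowerSeries.coeff k (b i j), ?_⟩
  intro K lam F hK hF hT
  set A : PowerSeries ℂ := PowerSeries.map (algebraMap ℝ ℂ) (logDerivSeries e h y) with hA
  have hA' : HasExp m (fun r => (logDerivVol e γ y r : ℂ)) A := (H.hasExp_logDerivVol he hy).ofReal
  set B : ℕ → PowerSeries ℂ := fun k => PowerSeries.mk fun l =>
    jetOp (fun i j => PowerSeries.coeff l (a i j)) (fun i j => PowerSeries.coeff l (b i j)) y (F k)
    with hB
  have hB' : ∀ k, HasExp (m - 1) (fun r => jetOp (fun i j => firstOrder e γ y i j r)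
      (fun i j => (comp e (γ r) y)⁻¹ i j) y (F k)) (B k) := by
    intro k
    have h1 : HasExp (m - 1) (fun r => jetOp (fun i j => firstOrder e γ y i j r)
        (fun i j => (comp e (γ r) y)⁻¹ i j) y (F k))
        (∑ i, ∑ j, PowerSeries.map (algebraMap ℝ ℂ) (a i j)
            * PowerSeries.C (pderiv (frame n) j (F k) y)
          + ∑ i, ∑ j, PowerSeries.map (algebraMap ℝ ℂ) (b i j)
            * PowerSeries.C (pderiv (frame n) i (pderiv (frame n) j (F k)) y)) :=
      (HasExp.sum fun i _ => HasExp.sum fun j _ => (ha i j).ofReal.mul (hasExp_const _)).add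
        (HasExp.sum fun i _ => HasExp.sum fun j _ => (hb i j).ofReal.mul (hasExp_const _))
    refine h1.congr_coeff fun l _ => ?_
    simp [hB, jetOp, PowerSeries.coeff_mul_C]
  set G : ℕ → PowerSeries ℂ := fun k => PowerSeries.C (4 * k * (lam + k - n / 2) * F k y)
      + PowerSeries.C ((lam + 2 * k) * F k y) * A + PowerSeries.X * B k with hG
  have hsum : HasExp m (fun r : ℝ => ∑ k ∈ Finset.range (K + 1), (r : ℂ) ^ (2 * k) *
      (4 * k * (lam + k - n / 2) * F k y + (lam + 2 * k) * F k y * (logDerivVol e γ y r : ℝ)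
        + (r : ℂ) ^ 2 * jetOp (fun i j => firstOrder e γ y i j r)
          (fun i j => (comp e (γ r) y)⁻¹ i j) y (F k)))
      (∑ k ∈ Finset.range (K + 1), PowerSeries.X ^ k * G k) :=
    HasExp.sum fun k _ => (hasExp_pow k).mul
      (((hasExp_const _).add (hA'.const_mul _)).add (hasExp_sq_mul H.one_le (hB' k)))
  have hzero : (fun r : ℝ => ∑ k ∈ Finset.range (K + 1), (r : ℂ) ^ (2 * k) *
      (4 * k * (lam + k - n / 2) * F k y + (lam + 2 * k) * F k y * (logDerivVol e γ y r : ℝ)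
        + (r : ℂ) ^ 2 * jetOp (fun i j => firstOrder e γ y i j r)
          (fun i j => (comp e (γ r) y)⁻¹ i j) y (F k)))
      =o[𝓝[>] (0 : ℝ)] fun r : ℝ => r ^ (2 * K) := by
    have h1 := hT.congr' (H.laplacian_powSum he hy lam hF) EventuallyEq.rfl
    -- Division by `r^λ`, of absolute value `r^{Re λ}`, turns the error bound into `o(r^{2K})` for a
    -- function with an ordinary even expansion.
    have h2 : (fun r : ℝ => ((r : ℂ) ^ lam)⁻¹) =O[𝓝[>] (0 : ℝ)] fun r : ℝ => (r ^ lam.re)⁻¹ := by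
      refine IsBigO.of_bound 1 ?_
      filter_upwards [self_mem_nhdsWithin] with r (hr : 0 < r)
      rw [norm_inv, Complex.norm_cpow_eq_rpow_re_of_pos hr, one_mul, norm_inv,
        Real.norm_of_nonneg (by positivity)]
    refine ((h2.mul_isLittleO h1).neg_left).congr' ?_ ?_
    · filter_upwards [self_mem_nhdsWithin] with r (hr : 0 < r)
      have h3 : (r : ℂ) ^ lam ≠ 0 := by
        rw [Ne, Complex.cpow_eq_zero_iff]
        simp [hr.ne']
      rw [mul_neg, neg_neg, inv_mul_cancel_left₀ h3]
    · filter_upwards [self_mem_nhdsWithin] with r (hr : 0 < r)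
      have h3 : r ^ lam.re ≠ 0 := by positivity
      rw [Real.rpow_add hr, inv_mul_cancel_left₀ h3]
      exact_mod_cast Real.rpow_natCast r (2 * K)
  have hz2 : HasExp K (fun _ => (0 : ℂ)) (∑ k ∈ Finset.range (K + 1), PowerSeries.X ^ k * G k) :=
    (hsum.mono hK).of_sub_isLittleO (hzero.neg_left.congr (fun r => by ring) fun _ => rfl)
  have key := hz2.coeff_eq_zero K le_rfl
  -- `r v'/v` has no constant term, so `F K` enters the equation only through the indicial factor.
  have hA0 : PowerSeries.coeff 0 A = 0 := by
    simp [hA, logDerivSeries]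
  have hGk : ∀ k ∈ Finset.range K, PowerSeries.coeff K (PowerSeries.X ^ k * G k)
      = (lam + 2 * k) * (PowerSeries.coeff (K - k) (logDerivSeries e h y) : ℝ) * F k y
        + jetOp (fun i j => PowerSeries.coeff (K - 1 - k) (a i j))
          (fun i j => PowerSeries.coeff (K - 1 - k) (b i j)) y (F k) := by
    intro k hk
    have hk' := Finset.mem_range.1 hk
    obtain ⟨l, hl⟩ : ∃ l, K - k = l + 1 := ⟨K - k - 1, by omega⟩
    have hl2 : K - 1 - k = l := by omega
    rw [PowerSeries.coeff_X_pow_mul', if_pos hk'.le, hG, hl2, hl]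
    simp only [map_add, PowerSeries.coeff_succ_X_mul, PowerSeries.coeff_C_mul, PowerSeries.coeff_C,
      hA, hB, PowerSeries.coeff_mk, PowerSeries.coeff_map, Complex.coe_algebraMap]
    simp
    ring
  have hGK : PowerSeries.coeff K (PowerSeries.X ^ K * G K)
      = 4 * K * (lam + K - n / 2) * F K y := by
    rw [PowerSeries.coeff_X_pow_mul', if_pos le_rfl, Nat.sub_self, hG]
    simp only [map_add, PowerSeries.coeff_zero_X_mul, PowerSeries.coeff_C_mul, hA0,
      PowerSeries.coeff_zero_C]
    ring
  rw [map_sum, Finset.sum_range_succ, hGK, Finset.sum_congr rfl hGk] at key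
  rw [add_comm]
  exact key

end MetricExpansion

end Recursion


/-! ## Dependence of the solution operators on the spectral parameter -/

section SpectralParameter

open Polynomial

/-- The polynomial `∏_{1 ≤ k ≤ j} (λ - n/2 + k)`. -/
def polePoly (n j : ℕ) : ℂ[X] := ∏ k ∈ Finset.Icc 1 j, (X + C (k - n / 2 : ℂ))

theorem eval_polePoly (n j : ℕ) (lam : ℂ) :
    (polePoly n j).eval lam = ∏ k ∈ Finset.Icc 1 j, (lam - n / 2 + k) := by
  rw [polePoly, eval_prod]
  exact Finset.prod_congr rfl fun k _ => by simp; ring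

theorem IsRegular.eval_ne_zero {n j : ℕ} {lam : ℂ} (h : IsRegular n j lam) :
    (polePoly n j).eval lam ≠ 0 := by
  rw [eval_polePoly, Finset.prod_ne_zero_iff]
  intro k hk h0
  exact h k hk (by linear_combination h0)

theorem IsRegular.mono {n i j : ℕ} {lam : ℂ} (h : IsRegular n j lam) (hij : i ≤ j) :
    IsRegular n i lam := fun k hk =>
  h k (by simp only [Finset.mem_Icc] at hk ⊢; omega)

/-- The interpolation nodes `n/2, n/2 + 1, …`. -/
def node (n a : ℕ) : ℂ := n / 2 + a

theorem node_injective (n : ℕ) : Function.Injective (node n) := fun a b h => by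
  simpa [node] using h

/-- The excluded values lie to the left of `n/2`, the nodes at or to the right of it. -/
theorem isRegular_node (n j a : ℕ) : IsRegular n j (node n a) := by
  intro k hk h
  have h1 : ((a + k : ℕ) : ℂ) = 0 := by
    push_cast
    rw [node] at h
    linear_combination h
  have := Nat.cast_eq_zero.1 h1
  have := (Finset.mem_Icc.1 hk).1
  omega

/-- The Lagrange basis polynomials of degree `j` for the nodes `n/2, …, n/2 + j`. -/
def nodeBasis (n j a : ℕ) : ℂ[X] := Lagrange.basis (Finset.range (j + 1)) (node n) a

theorem natDegree_nodeBasis (n : ℕ) {j a : ℕ} (ha : a ∈ Finset.range (j + 1)) :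
    (nodeBasis n j a).natDegree = j := by
  rw [nodeBasis, Lagrange.natDegree_basis (node_injective n).injOn ha, Finset.card_range,
    Nat.add_sub_cancel]

theorem eq_sum_nodeBasis (n : ℕ) {j : ℕ} {P : ℂ[X]} (hP : P.natDegree ≤ j) :
    P = ∑ a ∈ Finset.range (j + 1), C (P.eval (node n a)) * nodeBasis n j a := by
  have h := Lagrange.eq_interpolate (s := Finset.range (j + 1)) (v := node n)
    (node_injective n).injOn (f := P) (by
      rw [Finset.card_range]
      exact degree_le_natDegree.trans_lt (by exact_mod_cast Nat.lt_succ_of_le hP))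
  rwa [Lagrange.interpolate_apply] at h

theorem natDegree_sum_nodeBasis_le (n j : ℕ) (b : ℕ → ℂ) :
    (∑ a ∈ Finset.range (j + 1), C (b a) * nodeBasis n j a).natDegree ≤ j :=
  natDegree_sum_le_of_forall_le _ _ fun _ ha =>
    (natDegree_C_mul_le _ _).trans (natDegree_nodeBasis n ha).le

/-- The product of the factors of `polePoly n (j - 1)` which do not occur in `polePoly n i`. -/
def poleRatio (n i j : ℕ) : ℂ[X] := ∏ k ∈ Finset.Ico (i + 1) j, (X + C (k - n / 2 : ℂ))

theorem poleRatio_monic (n i j : ℕ) : (poleRatio n i j).Monic :=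
  monic_prod_of_monic _ _ fun _ _ => monic_X_add_C _

theorem natDegree_poleRatio (n i j : ℕ) : (poleRatio n i j).natDegree = j - (i + 1) := by
  rw [poleRatio, natDegree_prod_of_monic _ _ fun _ _ => monic_X_add_C _,
    Finset.sum_congr rfl fun k _ => natDegree_X_add_C _]
  simp

theorem polePoly_mul_poleRatio (n : ℕ) {i j : ℕ} (hij : i ≤ j) :
    polePoly n i * poleRatio n i (j + 1) = polePoly n j := by
  have h : ∀ a : ℕ, Finset.Icc 1 a = Finset.Ico 1 (a + 1) := fun a => by
    ext; simp only [Finset.mem_Icc, Finset.mem_Ico]; omega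
  rw [polePoly, polePoly, poleRatio, h, h, Finset.prod_Ico_consecutive _ (by omega) (by omega)]

theorem polePoly_succ (n j : ℕ) :
    polePoly n (j + 1) = polePoly n j * (X + C ((j + 1 : ℕ) - n / 2 : ℂ)) := by
  rw [polePoly, polePoly, Finset.prod_Icc_succ_top (by omega)]

variable {n m : ℕ} {M : Type*} [TopologicalSpace M] [ChartedSpace (E n) M]

/-- A family of operators satisfying a recursion of the type of the one of the solution operators,
where `L l x` is a linear differential operator. -/
structure IsRecursiveFamily (m : ℕ) (A : ℕ → M → ℝ) (L : ℕ → M → (M → ℂ) → ℂ)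
    (T : ℕ → ℂ → (M → ℂ) → M → ℂ) : Prop where
  smooth : ∀ K, K ≤ m → ∀ lam, IsRegular n K lam → ∀ f, IsSmooth n f → IsSmooth n (T K lam f)
  zero : ∀ lam f, IsSmooth n f → T 0 lam f = f
  recursion : ∀ K, K ≤ m → ∀ lam, IsRegular n K lam → ∀ f, IsSmooth n f → ∀ x,
    4 * K * (lam + K - n / 2) * T K lam f x + ∑ k ∈ Finset.range K,
      ((lam + 2 * k) * A (K - k) x * T k lam f x + L (K - 1 - k) x (T k lam f)) = 0
  linear : ∀ l x (s : Finset ℕ) (c : ℕ → ℂ) (G : ℕ → M → ℂ), (∀ a ∈ s, IsSmooth n (G a)) →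
    L l x (fun z => ∑ a ∈ s, c a * G a z) = ∑ a ∈ s, c a * L l x (G a)
  locality : ∀ l x G, G =ᶠ[𝓝 x] 0 → L l x G = 0

namespace IsRecursiveFamily

variable {A : ℕ → M → ℝ} {L : ℕ → M → (M → ℂ) → ℂ} {T : ℕ → ℂ → (M → ℂ) → M → ℂ}

/-- Locality is not part of the definition of the solution operators. It follows inductively from
the recursion, whose indicial factor is nonzero at regular `λ`, and it keeps the integrals against
compactly supported functions finite. -/
theorem eq_zero_of_notMem_tsupport (H : IsRecursiveFamily (n := n) m A L T) {f : M → ℂ}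
    (hf : IsSmooth n f) : ∀ K, K ≤ m → ∀ lam, IsRegular n K lam → ∀ x ∉ tsupport f,
      T K lam f x = 0 := by
  intro K
  induction K using Nat.strong_induction_on with
  | _ K ih =>
    intro hK lam hlam x hx
    rcases Nat.eq_zero_or_pos K with rfl | hpos
    · rw [H.zero lam f hf]
      exact image_eq_zero_of_notMem_tsupport hx
    · have h1 := H.recursion K hK lam hlam f hf x
      rw [Finset.sum_eq_zero, add_zero] at h1
      · have h2 : lam + K - n / 2 ≠ 0 := fun h0 =>
          hlam K (Finset.mem_Icc.2 ⟨hpos, le_rfl⟩) (by linear_combination h0)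
        have h3 : (4 * K : ℂ) ≠ 0 := mul_ne_zero (by norm_num) (Nat.cast_ne_zero.2 hpos.ne')
        exact (mul_eq_zero.1 h1).resolve_left (mul_ne_zero h3 h2)
      · intro k hk
        have hk' := Finset.mem_range.1 hk
        have h2 : T k lam f =ᶠ[𝓝 x] 0 := by
          filter_upwards [(isClosed_tsupport f).isOpen_compl.mem_nhds hx] with z hz
          exact ih k hk' (by omega) lam (hlam.mono hk'.le) z hz
        rw [H.locality _ _ _ h2, h2.self_of_nhds]
        simp

/-- The recursion is multiplied by `polePoly n j`, which cancels all denominators. In the step to `j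
+ 1`, the `i`-th term is the monic `poleRatio` of degree `j - i` times a polynomial of degree at
most `i + 1`. The terms with `L` do not raise the degree in `λ`, so the top coefficient only sees `λ
A`; the hypothesis on `c` is the resulting recursion. -/
theorem exists_polynomial (H : IsRecursiveFamily (n := n) m A L T) {c : ℕ → M → ℝ}
    (hc0 : ∀ x, c 0 x = 1)
    (hc : ∀ j, 1 ≤ j → ∀ x, 4 * j * c j x = -∑ i ∈ Finset.range j, A (j - i) x * c i x)
    {f : M → ℂ} (hf : IsSmooth n f) : ∀ j, j ≤ m → ∃ P : M → ℂ[X],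
      (∀ x, (P x).natDegree ≤ j) ∧ (∀ x, (P x).coeff j = c j x * f x) ∧
      ∀ lam, IsRegular n j lam → ∀ x, (polePoly n j).eval lam * T j lam f x = (P x).eval lam := by
  intro j
  induction j using Nat.strong_induction_on with
  | _ j ih =>
    intro hj
    rcases j with _ | j
    · refine ⟨fun x => C (f x), fun x => by simp, fun x => by simp [hc0], fun lam _ x => ?_⟩
      simp [polePoly, H.zero lam f hf]
    choose! P hP1 hP2 hP3 using fun i (hi : i < j + 1) => ih i hi (by omega)
    -- `L` differentiates in `x`, while no regularity of `x ↦ P i x` is at hand. Interpolation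
    -- writes `T i lam f` as a combination of the smooth functions `T i (node n a) f` with
    -- coefficients free of `x`, and linearity of `L` then suffices.
    set Q : ℕ → M → ℂ[X] := fun i x => ∑ a ∈ Finset.range (i + 1),
      C ((polePoly n i).eval (node n a) * L (j - i) x (T i (node n a) f)) * nodeBasis n i a with hQ
    have hQeval : ∀ i < j + 1, ∀ lam, IsRegular n i lam → ∀ x,
        (polePoly n i).eval lam * L (j - i) x (T i lam f) = (Q i x).eval lam := by
      intro i hi lam hlam x
      have hne := hlam.eval_ne_zero
      have h1 : T i lam f = fun z => ∑ a ∈ Finset.range (i + 1),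
          (((polePoly n i).eval lam)⁻¹ * ((polePoly n i).eval (node n a)
            * (nodeBasis n i a).eval lam)) * T i (node n a) f z := by
        funext z
        have h2 := congrArg (eval lam) (eq_sum_nodeBasis n (hP1 i hi z))
        rw [← hP3 i hi lam hlam z, eval_finsetSum] at h2
        simp only [eval_mul, eval_C, ← hP3 i hi _ (isRegular_node n i _) z] at h2
        rw [← mul_right_inj' hne, h2, Finset.mul_sum]
        refine Finset.sum_congr rfl fun a _ => ?_
        field_simp
      rw [h1, H.linear (j - i) x _ _ (fun a => T i (node n a) f) fun a _ =>
        H.smooth i (by omega) _ (isRegular_node n i a) f hf, hQ, Finset.mul_sum, eval_finsetSum]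
      refine Finset.sum_congr rfl fun a _ => ?_
      rw [eval_mul, eval_C]
      field_simp
    have hQdeg : ∀ i x, (Q i x).natDegree ≤ i := fun i x => natDegree_sum_nodeBasis_le n i _
    set B : ℕ → M → ℂ[X] := fun i x =>
      (X + C (2 * (i : ℂ))) * (C (A (j + 1 - i) x : ℂ) * P i x) + Q i x with hB
    have hBdeg : ∀ i < j + 1, ∀ x, (B i x).natDegree ≤ i + 1 := by
      intro i hi x
      have h1 : (X + C (2 * (i : ℂ))).natDegree ≤ 1 := (natDegree_X_add_C _).le
      have h2 : (C (A (j + 1 - i) x : ℂ) * P i x).natDegree ≤ i :=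
        (natDegree_C_mul_le _ _).trans (hP1 i hi x)
      have h3 := natDegree_mul_le_of_le h1 h2
      rw [add_comm 1 i] at h3
      exact natDegree_add_le_of_degree_le h3 ((hQdeg i x).trans (Nat.le_succ i))
    have hBcoeff : ∀ i < j + 1, ∀ x, (B i x).coeff (i + 1) = A (j + 1 - i) x * (c i x * f x) := by
      intro i hi x
      have h1 : (X + C (2 * (i : ℂ))).natDegree ≤ 1 := (natDegree_X_add_C _).le
      have h2 : (C (A (j + 1 - i) x : ℂ) * P i x).natDegree ≤ i :=
        (natDegree_C_mul_le _ _).trans (hP1 i hi x)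
      have h3 := coeff_mul_add_eq_of_natDegree_le h1 h2
      have h4 : (Q i x).coeff (1 + i) = 0 :=
        coeff_eq_zero_of_natDegree_lt (by have := hQdeg i x; omega)
      have h5 : (X + C (2 * (i : ℂ))).coeff 1 = 1 := by
        rw [coeff_add, coeff_X_one, coeff_C_succ, add_zero]
      rw [add_comm i 1, hB, coeff_add, h3, h4, h5, coeff_C_mul, hP2 i hi x, add_zero, one_mul]
    refine ⟨fun x => C (-(1 / (4 * (j + 1 : ℕ)) : ℂ)) * ∑ i ∈ Finset.range (j + 1),
      poleRatio n i (j + 1) * B i x, fun x => ?_, fun x => ?_, fun lam hlam x => ?_⟩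
    · refine (natDegree_C_mul_le _ _).trans (natDegree_sum_le_of_forall_le _ _ fun i hi => ?_)
      have hi' := Finset.mem_range.1 hi
      refine (natDegree_mul_le_of_le (natDegree_poleRatio n i (j + 1)).le
        (hBdeg i hi' x)).trans ?_
      omega
    · have h1 : ∀ i ∈ Finset.range (j + 1), (poleRatio n i (j + 1) * B i x).coeff (j + 1)
          = (A (j + 1 - i) x * c i x : ℝ) * f x := by
        intro i hi
        have hi' := Finset.mem_range.1 hi
        have h2 := coeff_mul_add_eq_of_natDegree_le (natDegree_poleRatio n i (j + 1)).le (hBdeg i hi' x)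
        rw [hBcoeff i hi' x, show j + 1 - (i + 1) + (i + 1) = j + 1 by omega] at h2
        rw [h2]
        have h3 := poleRatio_monic n i (j + 1)
        rw [Monic, leadingCoeff, natDegree_poleRatio] at h3
        rw [h3]
        push_cast
        ring
      rw [coeff_C_mul, finsetSum_coeff, Finset.sum_congr rfl h1, ← Finset.sum_mul,
        ← Complex.ofReal_sum]
      have h4 := hc (j + 1) (by omega) x
      have h5 : ∑ i ∈ Finset.range (j + 1), A (j + 1 - i) x * c i x = -(4 * (j + 1 : ℕ) * c (j + 1) x) := by
        rw [h4, neg_neg]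
      rw [h5]
      have h6 : ((j + 1 : ℕ) : ℂ) ≠ 0 := Nat.cast_ne_zero.2 (by omega)
      push_cast at h6 ⊢
      field_simp
    · have h1 := H.recursion (j + 1) hj lam hlam f hf x
      have h6 : ((j + 1 : ℕ) : ℂ) ≠ 0 := Nat.cast_ne_zero.2 (by omega)
      have h2 : (polePoly n j).eval lam * ∑ i ∈ Finset.range (j + 1),
          ((lam + 2 * i) * A (j + 1 - i) x * T i lam f x + L (j + 1 - 1 - i) x (T i lam f))
          = ∑ i ∈ Finset.range (j + 1), (poleRatio n i (j + 1) * B i x).eval lam := by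
        rw [Finset.mul_sum]
        refine Finset.sum_congr rfl fun i hi => ?_
        have hi' := Finset.mem_range.1 hi
        have hreg := hlam.mono hi'.le
        rw [← polePoly_mul_poleRatio n (Nat.lt_succ_iff.1 hi'), eval_mul, eval_mul, hB, eval_add,
          ← hQeval i hi' lam hreg x, eval_mul, eval_mul, ← hP3 i hi' lam hreg x, eval_C,
          Nat.add_sub_cancel]
        simp only [eval_add, eval_X, eval_C]
        ring
      rw [eval_mul, eval_C, eval_finsetSum, ← h2, polePoly_succ, eval_mul, eval_add, eval_X, eval_C]
      have h7 : ∑ i ∈ Finset.range (j + 1),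
          ((lam + 2 * i) * A (j + 1 - i) x * T i lam f x + L (j + 1 - 1 - i) x (T i lam f))
          = -(4 * (j + 1 : ℕ) * (lam + (j + 1 : ℕ) - n / 2) * T (j + 1) lam f x) := by
        linear_combination h1
      rw [h7]
      field_simp
      ring

end IsRecursiveFamily

end SpectralParameter


/-! ## Formal adjoints -/

section Adjoint

variable {n : ℕ} {M : Type*} [TopologicalSpace M] {e : OpenPartialHomeomorph M (E n)}

open Classical in
/-- The extension by zero of the function `χ` of the coordinates. -/
def chartExtend (e : OpenPartialHomeomorph M (E n)) (χ : E n → ℝ) (x : M) : ℂ :=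
  if x ∈ e.source then (χ (e x) : ℂ) else 0

theorem chartExtend_symm {χ : E n → ℝ} {y : E n} (hy : y ∈ e.target) :
    chartExtend e χ (e.symm y) = χ y := by
  simp [chartExtend, e.map_target hy, e.right_inv hy]

/-- The density need not be integrable on the chart domain. The integrand vanishes off the compact
image of the support of `f` and is continuous there. -/
theorem integrableOn_target {ψ f : M → ℂ} {ρ : E n → ℂ} (hψ : Continuous ψ)
    (hρ : ContinuousOn ρ e.target) (hf : HasCompactSupport f) (hfe : tsupport f ⊆ e.source)
    (h0 : ∀ x ∉ tsupport f, ψ x = 0) :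
    IntegrableOn (fun y => ψ (e.symm y) * ρ y) e.target := by
  have hK : IsCompact (e '' tsupport f) :=
    hf.isCompact.image_of_continuousOn (e.continuousOn.mono hfe)
  have hKt : e '' tsupport f ⊆ e.target := by
    rintro _ ⟨x, hx, rfl⟩
    exact e.map_source (hfe hx)
  have hcont : ContinuousOn (fun y => ψ (e.symm y) * ρ y) e.target :=
    (hψ.comp_continuousOn e.symm.continuousOn).mul hρ
  refine ((hcont.mono hKt).integrableOn_compact hK).of_forall_sdiff_eq_zero
    e.open_target.measurableSet fun y hy => ?_
  rw [h0, zero_mul]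
  intro hmem
  exact hy.2 ⟨_, hmem, e.right_inv hy.1⟩

theorem tsupport_chartExtend_subset [T2Space M] {χ : E n → ℝ}
    (hc : HasCompactSupport χ) (hχ : tsupport χ ⊆ e.target) :
    tsupport (chartExtend e χ) ⊆ e.symm '' tsupport χ := by
  have h1 : IsCompact (e.symm '' tsupport χ) :=
    hc.isCompact.image_of_continuousOn (e.symm.continuousOn.mono hχ)
  refine closure_minimal (fun x hx => ?_) h1.isClosed
  rw [Function.mem_support, chartExtend] at hx
  split_ifs at hx with h
  · refine ⟨e x, subset_tsupport _ ?_, e.left_inv h⟩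
    rw [Function.mem_support]
    exact_mod_cast hx
  · exact absurd rfl hx

theorem hasCompactSupport_chartExtend [T2Space M] {χ : E n → ℝ}
    (hc : HasCompactSupport χ) (hχ : tsupport χ ⊆ e.target) : HasCompactSupport (chartExtend e χ) :=
  (hc.isCompact.image_of_continuousOn (e.symm.continuousOn.mono hχ)).of_isClosed_subset
    (isClosed_tsupport _) (tsupport_chartExtend_subset hc hχ)

theorem tsupport_chartExtend_subset_source [T2Space M] {χ : E n → ℝ}
    (hc : HasCompactSupport χ) (hχ : tsupport χ ⊆ e.target) : tsupport (chartExtend e χ) ⊆ e.source := by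
  refine (tsupport_chartExtend_subset hc hχ).trans ?_
  rintro _ ⟨y, hy, rfl⟩
  exact e.map_target (hχ hy)

variable [ChartedSpace (E n) M] [IsManifold 𝓘(ℝ, E n) ∞ M]

theorem continuousOn_density {g : Metric n M} {T : Tensor2 n M} (hT : IsSmoothSymm T)
    (hg : T = g.inner) (he : e ∈ atlas (E n) M) :
    ContinuousOn (fun y => (√(comp e g.inner y).det : ℂ)) e.target := by
  have h1 : ContinuousOn (fun y => (comp e g.inner y).det) e.target := by
    simp only [Matrix.det_apply]
    refine continuousOn_finsetSum _ fun σ _ => ContinuousOn.const_smul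
      (continuousOn_finsetProd _ fun i _ => ?_) _
    rw [← hg]
    exact (hT.smooth e he _ _).continuousOn
  exact Complex.continuous_ofReal.comp_continuousOn h1.sqrt

variable [T2Space M]

theorem isSmooth_chartExtend (he : e ∈ atlas (E n) M) {χ : E n → ℝ} (hs : ContDiff ℝ ∞ χ)
    (hc : HasCompactSupport χ) (hχ : tsupport χ ⊆ e.target) : IsSmooth n (chartExtend e χ) := by
  refine contMDiff_of_tsupport fun x hx => ?_
  have hx' := tsupport_chartExtend_subset_source hc hχ hx
  have h1 : ContMDiffAt 𝓘(ℝ, E n) 𝓘(ℝ, ℂ) ∞ (fun z => (χ (e z) : ℂ)) x :=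
    ((Complex.ofRealCLM.contDiff.comp hs).contMDiff.contMDiffAt).comp x
      (contMDiffAt_of_mem_maximalAtlas (mem_maximalAtlas_of_mem_atlas he) hx')
  refine h1.congr_of_eventuallyEq ?_
  filter_upwards [e.open_source.mem_nhds hx'] with z hz
  simp [chartExtend, hz]

/-- A linear combination of local operators which is multiplication by a function is formally
self-adjoint. -/
theorem sum_adjoint_eq {g : Metric n M} {T : Tensor2 n M} (hT : IsSmoothSymm T)
    (hg : T = g.inner) {ι : Type*} {s : Finset ι} {c : ι → ℂ} {A B : ι → (M → ℂ) → M → ℂ}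
    (hAB : ∀ a ∈ s, IsFormalAdjoint g (A a) (B a))
    (hA : ∀ a ∈ s, ∀ f, IsSmooth n f → IsSmooth n (A a f))
    (hloc : ∀ a ∈ s, ∀ f, IsSmooth n f → ∀ x ∉ tsupport f, A a f x = 0) {φ : M → ℂ}
    (hφ : ∀ f, IsSmooth n f → ∀ x, ∑ a ∈ s, c a * A a f x = φ x * f x) {h : M → ℂ}
    (hh : IsSmooth n h) (x : M) : ∑ a ∈ s, c a * B a h x = φ x * h x := by
  set e := chartAt (E n) x with he_def
  have he : e ∈ atlas (E n) M := chart_mem_atlas _ x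
  have hρ := continuousOn_density hT hg he
  set ρ : E n → ℂ := fun y => (√(comp e g.inner y).det : ℂ) with hρ_def
  have hρ0 : ∀ y ∈ e.target, ρ y ≠ 0 := fun y hy => by
    have := Real.sqrt_pos.2 (det_comp_metric_pos g he hy)
    simp only [hρ_def]
    exact_mod_cast this.ne'
  -- Applying the identity to the constant function `1` exhibits `φ` as a combination of smooth
  -- functions.
  have hφc : Continuous φ := by
    have h1 : φ = fun x => ∑ a ∈ s, c a * A a (fun _ => 1) x := by
      funext z
      rw [hφ _ contMDiff_const, mul_one]
    rw [h1]
    exact continuous_finsetSum _ fun a ha =>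
      continuous_const.mul (hA a ha _ contMDiff_const).continuous
  set W : M → ℂ := fun z => ∑ a ∈ s, c a * B a h z - φ z * h z with hW
  have hWc : Continuous W :=
    (continuous_finsetSum _ fun a ha =>
      continuous_const.mul ((hAB a ha).smooth h hh).continuous).sub (hφc.mul hh.continuous)
  have hFc : ContinuousOn (fun y => W (e.symm y) * ρ y) e.target :=
    (hWc.comp_continuousOn e.symm.continuousOn).mul hρ
  -- The fundamental lemma of the calculus of variations: bump functions of the coordinates,
  -- extended by zero to `M`, serve as `f`. Continuity later upgrades the almost everywhere
  -- statement.
  have hae : ∀ᵐ y, y ∈ e.target → W (e.symm y) * ρ y = 0 := by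
    refine e.open_target.ae_eq_zero_of_integral_contDiff_smul_eq_zero
      (hFc.locallyIntegrableOn e.open_target.measurableSet) fun χ hχs hχc hχt => ?_
    set f := chartExtend e χ with hf_def
    have hf : IsSmooth n f := isSmooth_chartExtend he hχs hχc hχt
    have hfc : HasCompactSupport f := hasCompactSupport_chartExtend hχc hχt
    have hfe : tsupport f ⊆ e.source := tsupport_chartExtend_subset_source hχc hχt
    rw [← setIntegral_eq_integral_of_forall_compl_eq_zero (s := e.target) (fun y hy => by
      rw [image_eq_zero_of_notMem_tsupport fun hy' => hy (hχt hy'), zero_smul])]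
    have i1 : ∀ a ∈ s, IntegrableOn (fun y => c a * (A a f (e.symm y) * h (e.symm y) * ρ y))
        e.target := fun a ha =>
      (integrableOn_target (ψ := fun z => A a f z * h z)
        ((hA a ha f hf).continuous.mul hh.continuous) hρ hfc hfe
        fun z hz => by rw [hloc a ha f hf z hz, zero_mul]).const_mul (c a)
    have i2 : ∀ a ∈ s, IntegrableOn (fun y => c a * (f (e.symm y) * B a h (e.symm y) * ρ y))
        e.target := fun a ha =>
      (integrableOn_target (ψ := fun z => f z * B a h z)
        (hf.continuous.mul ((hAB a ha).smooth h hh).continuous) hρ hfc hfe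
        fun z hz => by rw [image_eq_zero_of_notMem_tsupport hz, zero_mul]).const_mul (c a)
    have i3 : IntegrableOn (fun y => φ (e.symm y) * f (e.symm y) * h (e.symm y) * ρ y) e.target :=
      integrableOn_target (ψ := fun z => φ z * f z * h z)
        ((hφc.mul hf.continuous).mul hh.continuous) hρ hfc hfe
        fun z hz => by rw [image_eq_zero_of_notMem_tsupport hz, mul_zero, zero_mul]
    have k1 : ∑ a ∈ s, ∫ y in e.target, c a * (A a f (e.symm y) * h (e.symm y) * ρ y)
        = ∑ a ∈ s, ∫ y in e.target, c a * (f (e.symm y) * B a h (e.symm y) * ρ y) := by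
      refine Finset.sum_congr rfl fun a ha => ?_
      rw [integral_const_mul, integral_const_mul, (hAB a ha).adjoint e he f h hf hh hfc hfe]
    rw [← integral_finsetSum _ i1, ← integral_finsetSum _ i2] at k1
    have k2 : ∫ y in e.target, ∑ a ∈ s, c a * (A a f (e.symm y) * h (e.symm y) * ρ y)
        = ∫ y in e.target, φ (e.symm y) * f (e.symm y) * h (e.symm y) * ρ y := by
      refine integral_congr_ae (Eventually.of_forall fun y => ?_)
      simp only [← hφ f hf, Finset.sum_mul]
      exact Finset.sum_congr rfl fun a _ => by ring
    have k3 : ∫ y in e.target, χ y • (W (e.symm y) * ρ y)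
        = ∫ y in e.target, (∑ a ∈ s, c a * (f (e.symm y) * B a h (e.symm y) * ρ y)
          - φ (e.symm y) * f (e.symm y) * h (e.symm y) * ρ y) := by
      refine setIntegral_congr_fun e.open_target.measurableSet fun y hy => ?_
      have h1 : f (e.symm y) = χ y := chartExtend_symm hy
      have h2 : ∑ a ∈ s, c a * (f (e.symm y) * B a h (e.symm y) * ρ y)
          = χ y * (∑ a ∈ s, c a * B a h (e.symm y)) * ρ y := by
        rw [Finset.mul_sum, Finset.sum_mul]
        exact Finset.sum_congr rfl fun a _ => by rw [h1]; ring
      rw [h2, h1, Complex.real_smul]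
      simp only [hW]
      ring
    rw [k3, integral_sub (integrable_finsetSum _ i2) i3, ← k1, k2, sub_self]
  have hzero := Measure.eqOn_open_of_ae_eq (μ := volume) (f := fun y => W (e.symm y) * ρ y)
    (g := fun _ => 0) ((ae_restrict_iff' e.open_target.measurableSet).2 hae) e.open_target hFc
    continuousOn_const
  have hx : e x ∈ e.target := e.map_source (mem_chart_source _ x)
  have h1 := (mul_eq_zero.1 (hzero hx)).resolve_right (hρ0 _ hx)
  rw [e.left_inv (mem_chart_source _ x), hW] at h1
  exact sub_eq_zero.1 h1

end Adjoint


/-! ## The `Q`-curvature polynomials -/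

section QPolynomial

variable {n m : ℕ} {M : Type*} [TopologicalSpace M] [ChartedSpace (E n) M]
  {γ : ℝ → Tensor2 n M} {h : ℕ → Tensor2 n M} {hbar : Tensor2 n M}

/-- The coefficients of `1 / √v` at `x`. -/
def invSqrtVol (h : ℕ → Tensor2 n M) (j : ℕ) (x : M) : ℝ :=
  PowerSeries.coeff j (sqrtSeries (volSeries (chartAt (E n) x) h (chartAt (E n) x x)))⁻¹

theorem invSqrtVol_zero (h : ℕ → Tensor2 n M) (x : M) : invSqrtVol h 0 x = 1 := by
  rw [invSqrtVol, PowerSeries.coeff_zero_eq_constantCoeff_apply, PowerSeries.constantCoeff_inv,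
    constantCoeff_sqrtSeries, inv_one]

open PowerSeries in
/-- If `D = d w⁴` with a constant `d` then `4 X (1/w)' = - (X D'/D) (1/w)`. -/
theorem euler_inv_of_eq_pow_four {D w : PowerSeries ℝ} {d : ℝ} (hd : d ≠ 0)
    (hw : constantCoeff w ≠ 0) (hD : D = C d * w ^ 4) :
    4 * (X * d⁄dX ℝ w⁻¹) = -(X * d⁄dX ℝ D * D⁻¹ * w⁻¹) := by
  have hwc : w * w⁻¹ = 1 := PowerSeries.mul_inv_cancel _ hw
  have hdc : (C d : PowerSeries ℝ) * C d⁻¹ = 1 := by rw [← map_mul, mul_inv_cancel₀ hd, map_one]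
  have hD0 : constantCoeff D ≠ 0 := by
    rw [hD, map_mul, map_pow, constantCoeff_C]
    positivity
  have hDinv : D⁻¹ = C d⁻¹ * w⁻¹ ^ 4 := by
    rw [PowerSeries.inv_eq_iff_mul_eq_one hD0, hD]
    calc C d⁻¹ * w⁻¹ ^ 4 * (C d * w ^ 4) = (C d * C d⁻¹) * (w * w⁻¹) ^ 4 := by ring
      _ = 1 := by rw [hwc, hdc]; ring
  have hD' : d⁄dX ℝ D = C d * (4 * w ^ 3 * d⁄dX ℝ w) := by
    rw [hD, Derivation.leibniz, derivative_C, derivative_pow]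
    simp
  rw [hDinv, hD', derivative_inv']
  calc 4 * (X * (-w⁻¹ ^ 2 * d⁄dX ℝ w)) = -(4 * X * d⁄dX ℝ w * w⁻¹ ^ 2) := by ring
    _ = -(4 * X * d⁄dX ℝ w * w⁻¹ ^ 2 * (C d * C d⁻¹) * (w * w⁻¹) ^ 3) := by rw [hwc, hdc]; ring
    _ = _ := by ring

-- From `det g_r = det g · v² = det g · (√v)⁴` the series `r v'/v` is four times the logarithmic
-- derivative `X w'/w` of `w = √v`. So the coefficients of `1/√v` obey the recursion of the top
-- coefficients in `IsRecursiveFamily.exists_polynomial`.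
open scoped PowerSeries in
theorem MetricExpansion.invSqrtVol_recursion (H : MetricExpansion m γ h hbar) (j : ℕ) (x : M) :
    4 * j * invSqrtVol h j x = -∑ i ∈ Finset.range j,
      PowerSeries.coeff (j - i) (logDerivSeries (chartAt (E n) x) h (chartAt (E n) x x))
        * invSqrtVol h i x := by
  set e := chartAt (E n) x
  have he : e ∈ atlas (E n) M := chart_mem_atlas _ x
  have hy : e x ∈ e.target := e.map_source (mem_chart_source _ x)
  have hd := (H.det_pos e he _ hy).ne'
  set w := sqrtSeries (volSeries e h (e x)) with hw
  have hD : (metricSeries e h (e x)).det = PowerSeries.C (comp e (h 0) (e x)).det * w ^ 4 := by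
    have h1 : w * w = volSeries e h (e x) := sqrtSeries_mul_self (constantCoeff_volSeries _ _ _)
    have h2 : volSeries e h (e x) * volSeries e h (e x) = detRatioSeries e h (e x) :=
      sqrtSeries_mul_self (H.constantCoeff_detRatioSeries he hy)
    have h3 : w ^ 4 = detRatioSeries e h (e x) := by rw [← h2, ← h1]; ring
    rw [h3, detRatioSeries, ← mul_assoc, ← map_mul, mul_inv_cancel₀ hd, map_one, one_mul]
  have h4 := congrArg (PowerSeries.coeff j) (euler_inv_of_eq_pow_four hd (w := w)
    (by rw [hw, constantCoeff_sqrtSeries]; exact one_ne_zero) hD)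
  rw [show (4 : PowerSeries ℝ) = PowerSeries.C 4 from (map_ofNat (PowerSeries.C (R := ℝ)) 4).symm,
    PowerSeries.coeff_C_mul, coeff_X_mul_derivative, map_neg, mul_comm _ w⁻¹,
    PowerSeries.coeff_mul, Finset.Nat.sum_antidiagonal_eq_sum_range_succ
      (fun a b => PowerSeries.coeff a w⁻¹ * PowerSeries.coeff b (PowerSeries.X
        * d⁄dX ℝ (metricSeries e h (e x)).det * (metricSeries e h (e x)).det⁻¹)),
    Finset.sum_range_succ] at h4
  have h5 : PowerSeries.coeff 0 (PowerSeries.X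
        * d⁄dX ℝ (metricSeries e h (e x)).det * (metricSeries e h (e x)).det⁻¹) = 0 := by
    simp
  rw [Nat.sub_self, h5, mul_zero, add_zero, ← mul_assoc] at h4
  refine h4.trans ?_
  congr 1
  exact Finset.sum_congr rfl fun i _ => mul_comm _ _

open Polynomial

variable [IsManifold 𝓘(ℝ, E n) ∞ M] {g : Metric n M} {T Tadj : ℕ → ℂ → (M → ℂ) → M → ℂ}

theorem MetricExpansion.exists_isRecursiveFamily (H : MetricExpansion m γ h hbar)
    (hT : IsSolutionFamily γ T) : ∃ L : ℕ → M → (M → ℂ) → ℂ,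
      IsRecursiveFamily (n := n) m (fun k x => PowerSeries.coeff k
        (logDerivSeries (chartAt (E n) x) h (chartAt (E n) x x))) L T := by
  have hy : ∀ x : M, chartAt (E n) x x ∈ (chartAt (E n) x).target := fun x =>
    (chartAt (E n) x).map_source (mem_chart_source _ x)
  have hF : ∀ (x : M) {f : M → ℂ}, IsSmooth n f →
      ContDiffAt ℝ ∞ (fun z => f ((chartAt (E n) x).symm z)) (chartAt (E n) x x) := fun x f hf =>
    (hf.contDiffOn (chart_mem_atlas _ x)).contDiffAt
      ((chartAt (E n) x).open_target.mem_nhds (hy x))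
  have hleft : ∀ x : M, (chartAt (E n) x).symm (chartAt (E n) x x) = x := fun x =>
    (chartAt (E n) x).left_inv (mem_chart_source _ x)
  choose p q hpq using fun x : M => H.exists_recursion (chart_mem_atlas (E n) x) (hy x)
  refine ⟨fun l x G => jetOp (p x l) (q x l) (chartAt (E n) x x)
    (fun z => G ((chartAt (E n) x).symm z)), ?_, hT.zero, ?_, ?_, ?_⟩
  · intro K hK
    exact hT.smooth K (by have := H.dim; omega)
  · intro K hK lam hlam f hf x
    have hKn : 2 * K ≤ n := by have := H.dim; omega
    have h1 := hpq x K lam (fun k z => T k lam f ((chartAt (E n) x).symm z)) hK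
      (fun k hk => hF x (hT.smooth k (by have := Finset.mem_range.1 hk; omega) lam
        (hlam.mono (by have := Finset.mem_range.1 hk; omega)) f hf)) ?_
    · simpa only [hleft] using h1
    · refine (hT.eigen K hKn lam hlam f hf x).congr (fun r => ?_) fun r => rfl
      have e1 : partialSum T K lam f x r = powSum (fun k => lam + 2 * k)
          (fun k z => T k lam f ((chartAt (E n) x).symm z)) K (chartAt (E n) x x, r) := by
        simp only [partialSum, powSum, hleft]
      rw [e1]
      rfl
  · intro l x s c G hG
    exact jetOp_sum _ _ c fun a ha => hF x (hG a ha)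
  · intro l x G hG
    refine jetOp_eq_zero _ _ ?_
    have h1 : Tendsto (chartAt (E n) x).symm (𝓝 (chartAt (E n) x x)) (𝓝 x) := by
      have := (chartAt (E n) x).continuousAt_symm (hy x)
      rwa [ContinuousAt, hleft] at this
    exact h1.eventually hG

/-- `Tadj` is only known as an adjoint for each `λ` separately, so its polynomial is defined by
interpolation at the nodes. `sum_adjoint_eq` is used twice: with `φ = invSqrtVol h j` for the top
coefficient, and with `φ = 0` to carry the interpolation identity of `T` over to `Tadj` at every
regular `λ`. -/
theorem MetricExpansion.exists_adjoint_polynomial [T2Space M] (H : MetricExpansion m γ h hbar)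
    (h0 : h 0 = g.inner) (hT : IsSolutionFamily γ T) (hTadj : IsAdjointFamily g T Tadj) {j : ℕ}
    (hj : j ≤ m) {f : M → ℂ} (hf : IsSmooth n f) : ∃ P : M → ℂ[X],
      (∀ x, (P x).natDegree ≤ j) ∧ (∀ x, (P x).coeff j = invSqrtVol h j x * f x) ∧
      ∀ lam, IsRegular n j lam → ∀ x,
        (polePoly n j).eval lam * Tadj j lam f x = (P x).eval lam := by
  obtain ⟨L, hL⟩ := H.exists_isRecursiveFamily hT
  have hjn : 2 * j ≤ n := by have := H.dim; omega
  have hpoly := fun u (hu : IsSmooth n u) => hL.exists_polynomial (invSqrtVol_zero h)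
    (fun j _ x => H.invSqrtVol_recursion j x) hu j hj
  have hsm : ∀ lam, IsRegular n j lam → ∀ u, IsSmooth n u → IsSmooth n (T j lam u) :=
    fun lam hlam u hu => hL.smooth j hj lam hlam u hu
  have hloc : ∀ lam, IsRegular n j lam → ∀ u, IsSmooth n u → ∀ x ∉ tsupport u, T j lam u x = 0 :=
    fun lam hlam u hu => hL.eq_zero_of_notMem_tsupport hu j hj lam hlam
  refine ⟨fun x => ∑ a ∈ Finset.range (j + 1),
    C ((polePoly n j).eval (node n a) * Tadj j (node n a) f x) * nodeBasis n j a,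
    fun x => natDegree_sum_nodeBasis_le n j _, fun x => ?_, fun lam hlam x => ?_⟩
  · have h1 := sum_adjoint_eq (H.smooth 0) h0 (s := Finset.range (j + 1))
      (c := fun a => (polePoly n j).eval (node n a) * (nodeBasis n j a).coeff j)
      (A := fun a => T j (node n a)) (B := fun a => Tadj j (node n a))
      (fun a _ => hTadj j hjn _ (isRegular_node n j a))
      (fun a _ => hsm _ (isRegular_node n j a)) (fun a _ => hloc _ (isRegular_node n j a))
      (φ := fun x => (invSqrtVol h j x : ℂ)) (fun u hu z => ?_) hf x
    · rw [← h1, finsetSum_coeff]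
      refine Finset.sum_congr rfl fun a _ => ?_
      rw [coeff_C_mul]
      ring
    · obtain ⟨P, hP1, hP2, hP3⟩ := hpoly u hu
      have h2 := congrArg (fun p => p.coeff j) (eq_sum_nodeBasis n (hP1 z))
      simp only [finsetSum_coeff, coeff_C_mul] at h2
      rw [← hP2, h2]
      refine Finset.sum_congr rfl fun a _ => ?_
      rw [← hP3 _ (isRegular_node n j a)]
      ring
  -- `none` stands for `λ` itself and `some a` for the nodes; the indices stay distinct even if `λ`
  -- is a node.
  · let mu : Option ℕ → ℂ := fun o => o.elim lam (node n)
    have hmu : ∀ o, IsRegular n j (mu o) := fun o => by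
      cases o with
      | none => exact hlam
      | some a => exact isRegular_node n j a
    have h1 := sum_adjoint_eq (H.smooth 0) h0 (s := Finset.insertNone (Finset.range (j + 1)))
      (c := fun o => o.elim ((polePoly n j).eval lam)
        fun a => -((polePoly n j).eval (node n a) * (nodeBasis n j a).eval lam))
      (A := fun o => T j (mu o)) (B := fun o => Tadj j (mu o))
      (fun o _ => hTadj j hjn _ (hmu o)) (fun o _ => hsm _ (hmu o)) (fun o _ => hloc _ (hmu o))
      (φ := fun _ => 0) (fun u hu z => ?_) hf x
    · rw [Finset.sum_insertNone, zero_mul] at h1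
      simp only [Option.elim, mu, neg_mul, Finset.sum_neg_distrib] at h1
      rw [← sub_eq_add_neg, sub_eq_zero] at h1
      rw [h1, eval_finsetSum]
      refine Finset.sum_congr rfl fun a _ => ?_
      rw [eval_mul, eval_C]
      ring
    · obtain ⟨P, hP1, hP2, hP3⟩ := hpoly u hu
      have h2 := congrArg (eval lam) (eq_sum_nodeBasis n (hP1 z))
      simp only [eval_finsetSum, eval_mul, eval_C] at h2
      rw [Finset.sum_insertNone, zero_mul]
      simp only [Option.elim, mu, neg_mul, Finset.sum_neg_distrib]
      rw [← sub_eq_add_neg, sub_eq_zero, hP3 lam hlam, h2]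
      refine Finset.sum_congr rfl fun a _ => ?_
      rw [← hP3 _ (isRegular_node n j a)]
      ring

/-- The values at regular `λ` determine a polynomial, so the continuation to the excluded `λ` is
unique. -/
theorem infinite_setOf_isRegular (n N : ℕ) (c : ℂ) : {lam : ℂ | IsRegular n N (lam + c)}.Infinite :=
  Set.infinite_of_injective_forall_mem (f := fun a : ℕ => node n a - c)
    (fun a b hab => node_injective n (sub_left_injective hab)) fun a => by
      simpa using isRegular_node n N a

/-- The `Q`-curvature polynomial exists, and its degree and leading coefficient. -/
theorem MetricExpansion.exists_isQPolynomial [T2Space M] (H : MetricExpansion m γ h hbar)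
    (h0 : h 0 = g.inner) (hT : IsSolutionFamily γ T) (hTadj : IsAdjointFamily g T Tadj) {N : ℕ}
    (hN : N ≤ m) : ∃ P : M → ℂ[X], IsQPolynomial g γ Tadj N P ∧ ∀ x, (P x).natDegree ≤ N ∧
      (P x).coeff N = -(2 ^ (2 * N) * (N.factorial : ℂ)) * (holoSqrt g γ (2 * N) x : ℂ) := by
  have hv : ∀ j, IsSmooth n (fun x => (holo g γ (2 * (N - j)) x : ℂ)) := fun j =>
    H.isSmooth_holo h0 (by omega)
  choose! P hP1 hP2 hP3 using fun j (hj : j ≤ m) =>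
    H.exists_adjoint_polynomial h0 hT hTadj hj (hv j)
  have hPr : ∀ j ∈ Finset.range (N + 1), j ≤ m := fun j hj => by
    have := Finset.mem_range.1 hj
    omega
  -- `poleRatio n j (N + 1)` is what remains of the prefactor `polePoly n N` after clearing the
  -- poles of the `j`-th summand.
  set R : M → ℂ[X] := fun x => ∑ j ∈ Finset.range (N + 1), poleRatio n j (N + 1) * P j x with hR
  have hterm : ∀ j ∈ Finset.range (N + 1), ∀ x,
      (poleRatio n j (N + 1) * P j x).natDegree ≤ N ∧
      (poleRatio n j (N + 1) * P j x).coeff N = invSqrtVol h j x * holo g γ (2 * (N - j)) x := by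
    intro j hj x
    have hj' := Finset.mem_range.1 hj
    have h1 := natDegree_poleRatio n j (N + 1)
    have h2 := hP1 j (hPr j hj) x
    have h3 := coeff_mul_add_eq_of_natDegree_le h1.le h2
    have h4 := poleRatio_monic n j (N + 1)
    rw [Monic, leadingCoeff, h1] at h4
    rw [h4, one_mul, hP2 j (hPr j hj) x, show N + 1 - (j + 1) + j = N by omega] at h3
    refine ⟨(natDegree_mul_le_of_le h1.le h2).trans (by omega), h3⟩
  have hRdeg : ∀ x, (R x).natDegree ≤ N := fun x =>
    natDegree_sum_le_of_forall_le _ _ fun j hj => (hterm j hj x).1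
  have hRcoeff : ∀ x, (R x).coeff N = (holoSqrt g γ (2 * N) x : ℂ) := by
    intro x
    set e := chartAt (E n) x with he_def
    have he : e ∈ atlas (E n) M := chart_mem_atlas _ x
    have hx := mem_chart_source (E n) x
    have hy : e x ∈ e.target := e.map_source hx
    have hleft : e.symm (e x) = x := e.left_inv hx
    have h1 : ∀ k ≤ m, holo g γ (2 * k) x = PowerSeries.coeff k (volSeries e h (e x)) :=
      fun k hk => by
        have := H.holo_eq h0 he hy hk
        rwa [hleft] at this
    have h2 : holoSqrt g γ (2 * N) x = PowerSeries.coeff N (sqrtSeries (volSeries e h (e x))) := by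
      have := H.holoSqrt_eq h0 he hy hN
      rwa [hleft] at this
    -- The Cauchy product of `1/√v` and `v` is `√v`; this is where `w_{2N}` appears.
    have h3 : sqrtSeries (volSeries e h (e x))
        = (sqrtSeries (volSeries e h (e x)))⁻¹ * volSeries e h (e x) := by
      have h4 : PowerSeries.constantCoeff (sqrtSeries (volSeries e h (e x))) ≠ 0 := by
        rw [constantCoeff_sqrtSeries]
        exact one_ne_zero
      rw [mul_comm, PowerSeries.eq_mul_inv_iff_mul_eq h4]
      exact sqrtSeries_mul_self (constantCoeff_volSeries e h (e x))
    rw [hR, finsetSum_coeff, Finset.sum_congr rfl fun j hj => (hterm j hj x).2, h2, congrArg (PowerSeries.coeff N) h3,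
      PowerSeries.coeff_mul, Finset.Nat.sum_antidiagonal_eq_sum_range_succ
        (fun a b => PowerSeries.coeff a (sqrtSeries (volSeries e h (e x)))⁻¹
          * PowerSeries.coeff b (volSeries e h (e x)))]
    push_cast
    refine Finset.sum_congr rfl fun j _ => ?_
    rw [h1 (N - j) (by omega)]
    rfl
  set c : ℂ := n - 2 * N with hc
  refine ⟨fun x => C (-(2 ^ (2 * N) * (N.factorial : ℂ))) * (R x).comp (X + C c), ?_, fun x => ⟨?_, ?_⟩⟩
  · intro lam hlam x
    rw [eval_mul, eval_C, eval_comp, eval_add, eval_X, eval_C, qRes, mul_assoc]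
    congr 1
    have hlam' : IsRegular n N (lam + c) := by rwa [hc, ← add_sub_assoc]
    have h1 : ∏ k ∈ Finset.Icc 1 N, (lam + n / 2 - 2 * N + k) = (polePoly n N).eval (lam + c) := by
      rw [eval_polePoly]
      refine Finset.prod_congr rfl fun k _ => ?_
      rw [hc]
      ring
    rw [h1, hR, eval_finsetSum, Finset.mul_sum]
    refine Finset.sum_congr rfl fun j hj => ?_
    have hj' := Nat.lt_succ_iff.1 (Finset.mem_range.1 hj)
    rw [eval_mul, ← hP3 j (hPr j hj) _ (hlam'.mono hj') x, ← polePoly_mul_poleRatio n hj', eval_mul,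
      hc, ← add_sub_assoc]
    ring
  · refine (natDegree_C_mul_le _ _).trans (natDegree_comp_le.trans ?_)
    rw [natDegree_X_add_C, mul_one]
    exact hRdeg x
  · rw [coeff_C_mul, ← hRcoeff]
    congr 1
    -- The shift `λ ↦ λ + n - 2N` is monic of degree one and preserves the coefficient of `λ^N`: it
    -- is the leading one if the degree is `N`, and zero on both sides otherwise.
    rcases (hRdeg x).lt_or_eq with hlt | heq
    · have h1 : ((R x).comp (X + C c)).natDegree < N := by
        refine natDegree_comp_le.trans_lt ?_
        rwa [natDegree_X_add_C, mul_one]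
      rw [coeff_eq_zero_of_natDegree_lt h1, coeff_eq_zero_of_natDegree_lt hlt]
    · have h1 := leadingCoeff_comp (p := R x) (q := X + C c)
        (by rw [natDegree_X_add_C]; exact one_ne_zero)
      rwa [leadingCoeff_X_add_C, one_pow, mul_one, leadingCoeff, leadingCoeff, natDegree_comp,
        natDegree_X_add_C, mul_one, heq] at h1

theorem IsQPolynomial.unique {N : ℕ} {P Q : M → ℂ[X]} (hP : IsQPolynomial g γ Tadj N P)
    (hQ : IsQPolynomial g γ Tadj N Q) : P = Q := by
  funext x
  refine eq_of_infinite_eval_eq _ _ ((infinite_setOf_isRegular n N (n - 2 * N)).mono ?_)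
  intro lam hlam
  have h1 : IsRegular n N (lam + n - 2 * N) := by
    rw [add_sub_assoc]
    exact hlam
  exact (hP lam h1 x).trans (hQ lam h1 x).symm

end QPolynomial

end QCurvature

end

/-! ### The theorem for Poincaré–Einstein metrics. -/

theorem proposition4p3 (n : ℕ) (hn : Even n) (hn2 : 2 ≤ n)
    {M : Type*} [TopologicalSpace M] [T2Space M] [SecondCountableTopology M]
    [ChartedSpace (QCurvature.E n) M] [IsManifold 𝓘(ℝ, QCurvature.E n) ∞ M]
    (g : QCurvature.Metric n M)
    (ε : ℝ) (γ : ℝ → QCurvature.Tensor2 n M) (hγ : QCurvature.IsPoincareEinstein g ε γ)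
    (T Tadj : ℕ → ℂ → (M → ℂ) → M → ℂ)
    (hT : QCurvature.IsSolutionFamily γ T) (hTadj : QCurvature.IsAdjointFamily g T Tadj)
    (N : ℕ) (hN : 2 * N ≤ n) :
    -- `v(r)` and `√v(r)` have even Taylor expansions up to `r^n`, with coefficients `v_{2j}`, `w_{2j}`
    (∀ x, (fun r : ℝ => QCurvature.volRatio g γ x r
        - ∑ j ∈ Finset.range (n / 2 + 1), QCurvature.holo g γ (2 * j) x * r ^ (2 * j))
      =o[𝓝[>] (0 : ℝ)] fun r => r ^ n) ∧
    (∀ x, (fun r : ℝ => √(QCurvature.volRatio g γ x r)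
        - ∑ j ∈ Finset.range (n / 2 + 1), QCurvature.holoSqrt g γ (2 * j) x * r ^ (2 * j))
      =o[𝓝[>] (0 : ℝ)] fun r => r ^ n) ∧
    -- `Q_{2N}^{res}(λ)` is a polynomial in `λ`, of degree at most `N`
    (∃! P : M → ℂ[X], QCurvature.IsQPolynomial g γ Tadj N P) ∧
    ∀ P : M → ℂ[X], QCurvature.IsQPolynomial g γ Tadj N P → ∀ x,
      (P x).natDegree ≤ N ∧
      (P x).coeff N = -(2 ^ (2 * N) * (N.factorial : ℂ)) * (QCurvature.holoSqrt g γ (2 * N) x : ℂ) := by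
  obtain ⟨m, hm⟩ := hn
  have hm2 : n / 2 = m := by omega
  have hpow : ∀ r : ℝ, r ^ n = r ^ (2 * m) := fun r => by rw [hm, two_mul]
  obtain ⟨h, hbar, h0, H⟩ := hγ.exists_metricExpansion (m := m) (by omega) (by omega)
  obtain ⟨P, hP, hP'⟩ := H.exists_isQPolynomial h0 hT hTadj (N := N) (by omega)
  have he : ∀ x : M, chartAt (QCurvature.E n) x ∈ atlas (QCurvature.E n) M := chart_mem_atlas _
  have hy : ∀ x : M, chartAt (QCurvature.E n) x x ∈ (chartAt (QCurvature.E n) x).target :=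
    fun x => (chartAt (QCurvature.E n) x).map_source (mem_chart_source _ x)
  have hleft : ∀ x : M, (chartAt (QCurvature.E n) x).symm (chartAt (QCurvature.E n) x x) = x :=
    fun x => (chartAt (QCurvature.E n) x).left_inv (mem_chart_source _ x)
  refine ⟨fun x => ?_, fun x => ?_, ⟨P, hP, fun Q hQ => hQ.unique hP⟩, fun Q hQ x => ?_⟩
  · refine (H.hasExp_volRatio h0 (he x) (hy x)).isLittleO_sum.congr (fun r => ?_)
      fun r => (hpow r).symm
    rw [hleft, hm2]
    congr 1
    refine Finset.sum_congr rfl fun k hk => ?_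
    have := H.holo_eq h0 (he x) (hy x) (Nat.lt_succ_iff.1 (Finset.mem_range.1 hk))
    rw [hleft] at this
    rw [this]
    rfl
  · refine (H.hasExp_sqrt_volRatio h0 (he x) (hy x)).isLittleO_sum.congr (fun r => ?_)
      fun r => (hpow r).symm
    rw [hleft, hm2]
    congr 1
    refine Finset.sum_congr rfl fun k hk => ?_
    have := H.holoSqrt_eq h0 (he x) (hy x) (Nat.lt_succ_iff.1 (Finset.mem_range.1 hk))
    rw [hleft] at this
    rw [this]
    rfl
  · rw [hQ.unique hP]
    exact hP' x
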